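/- **Conventions.** For $s\ge 0$ let $Z=\mathbb R^{2s}$ with the symplectic form $\Delta(z,z')=z^t\Delta z'$, $\Delta=\mathrm{diag}\left[\begin{smallmatrix}0&-1\\1&0\end{smallmatrix}\right]_{j=1,\dots,s}$, and Lebesgue (= symplectic) volume $d^{2s}z$. A Weyl system on a Hilbert space $\mathcal H$ is an irreducible, strongly continuous family of unitaries $W(z)$, $z\in Z$, with $W(z)W(z')=e^{\frac i2\Delta(z,z')}W(z+z')$; its canonical variables $R=[R_1,\dots,R_{2s}]$ are the self-adjoint generators of $t\mapsto W(te_j)$. Let $W_A$ on $\mathcal H_A$ (over $Z_A$, $\dim Z_A=2s_A$) and $W_B$ on $\mathcal H_B$ (over $Z_B$, $\dim Z_B=2s$) be Weyl systems. Fix an orthonormal basis $\{|i\rangle\}$ of $\mathcal H_A$, put $\bar\psi=\sum_i|i\rangle\overline{\langle i|\psi\rangle}$, and let $X^\top$ be the transpose of a bounded operator $X$ on $\mathcal H_A$ in this basis. Let $\mathcal H_B\times\mathcal H_A$ be the algebraic tensor product, i.e. the linear span of the product vectors in the Hilbert space $\mathcal H_B\otimes\mathcal H_A$. A channel is a linear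 map $\Phi$ from the trace-class operators on $\mathcal H_A$ to those on $\mathcal H_B$ which maps density operators to density operators and satisfies $\sum_{i,j}\langle\psi_i|\Phi(|i\rangle\langle j|)|\psi_j\rangle\ge0$ for all finite families $\psi_i\in\mathcal H_B$. Its dual $\Phi^*$ maps bounded operators on $\mathcal H_B$ to bounded operators on $\mathcal H_A$ and is determined by $\mathrm{Tr}\,\Phi(\rho)X=\mathrm{Tr}\,\rho\,\Phi^*(X)$. The Choi–Jamiolkowski form $\Omega_\Phi$ is the sesquilinear form (antilinear in the first argument) on $\mathcal H_B\times\mathcal H_A$ with $$\Omega_\Phi(\psi_B\otimes\psi_A;\psi_B'\otimes\psi_A')=\langle\psi_B|\Phi(|\bar\psi_A\rangle\langle\bar\psi_A'|)|\psi_B'\rangle .$$ **Theorem.** Let $\Phi$ be a channel from $\mathcal H_A$ to $\mathcal H_B$. Then $\Phi^*$ is well defined (for each bounded $X$ on $\mathcal H_B$ the operator $\Phi^*(X)$ exists and is unique), and $$\Omega_\Phi=\frac1{(2\pi)^{s}}\int_{Z_B}W_B(-z)\otimes\Phi^*(W_B(z))^\top\,d^{2s}z$$ in the sense of forms on $\mathcal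 H_B\times\mathcal H_A$: for all $x,y\in\mathcal H_B\times\mathcal H_A$ the function $z\mapsto\langle x|W_B(-z)\otimes\Phi^*(W_B(z))^\top|y\rangle$ is integrable and $(2\pi)^{-s}$ times its integral equals $\Omega_\Phi(x;y)$. Suppose moreover that $\Phi$ is a centered Gaussian channel: $\Phi^*(W_B(z))=W_A(Kz)\,e^{-\frac12z^t\mu z}$ for $z\in Z_B$, where $K$ is a real $2s_A\times 2s$ matrix and $\mu$ a real $2s\times2s$ matrix with $\mu\ge\pm\frac i2\Delta_K$, $\Delta_K=\Delta_B-K^t\Delta_AK$. Then, in the same sense of forms, $$\Omega_\Phi=\frac1{(2\pi)^{s}}\int_{Z_B}W_B(-z)\otimes W_A(Kz)^\top e^{-\frac12z^t\mu z}\,d^{2s}z =\frac1{(2\pi)^{s}}\int_{Z_B}\exp(-iR_{BA}\cdot z)\,e^{-\frac12z^t\mu z}\,d^{2s}z .$$ Here $R_{BA}=R_B\otimes I-I\otimes R_A^\top K$, where $R_A^\top$ is the row vector of the generators of $t\mapsto W_A(te_k)^\top$; for every $z\in Z_B$ the operator $R_{BA}\cdot z=\sum_jz_j(R_{BA})_j$,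 defined on its natural domain in the algebraic tensor product, is essentially self-adjoint on the Hilbert space $\mathcal H_B\otimes\mathcal H_A$, and $\exp(iR_{BA}\cdot z)=W_B(z)\otimes W_A(-Kz)^\top$. -/

import Mathlib

open scoped TensorProduct InnerProductSpace ComplexOrder Matrix
open MeasureTheory

noncomputable section

namespace CJ

section TraceClass

variable {H : Type*} [NormedAddCommGroup H] [InnerProductSpace ℂ H]

/-- The space `𝔗(H)` of trace-class (that is, nuclear) operators: the operators
`∑ₙ |xₙ⟩⟨yₙ|` with `∑ₙ ‖xₙ‖ ‖yₙ‖ < ∞`. -/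
def traceClass (H : Type*) [NormedAddCommGroup H] [InnerProductSpace ℂ H] :
    Submodule ℂ (H →L[ℂ] H) where
  carrier := {T | ∃ x y : ℕ → H, Summable (fun n => ‖x n‖ * ‖y n‖) ∧
    HasSum (fun n => InnerProductSpace.rankOne ℂ (x n) (y n)) T}
  zero_mem' := ⟨0, 0, by simp, by simp⟩
  add_mem' := by
    rintro S T ⟨x, y, h, hS⟩ ⟨x', y', h', hT⟩
    let e : ℕ ⊕ ℕ ≃ ℕ := Equiv.natSumNatEquivNat
    refine ⟨Sum.elim x x' ∘ e.symm, Sum.elim y y' ∘ e.symm, ?_, ?_⟩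
    · refine (Equiv.summable_iff e).1 ?_
      exact (Summable.sum (f := fun i : ℕ ⊕ ℕ => ‖Sum.elim x x' i‖ * ‖Sum.elim y y' i‖) h h').congr
        (fun i => by simp)
    · refine (Equiv.hasSum_iff e).1 ?_
      have := HasSum.sum (f := fun i : ℕ ⊕ ℕ =>
        InnerProductSpace.rankOne ℂ (Sum.elim x x' i) (Sum.elim y y' i)) hS hT
      convert this using 2 with i
      simp
  smul_mem' := by
    rintro c T ⟨x, y, h, hT⟩
    refine ⟨fun n => c • x n, y, ?_, ?_⟩
    · simpa [norm_smul, mul_assoc] using h.mul_left ‖c‖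
    · simpa using hT.const_smul c

/-- `|x⟩⟨y|` as a trace-class operator. -/
def ketBra (x y : H) : traceClass H :=
  ⟨InnerProductSpace.rankOne ℂ x y,
    fun n => if n = 0 then x else 0, fun n => if n = 0 then y else 0, by
      refine summable_of_ne_finset_zero (s := {0}) fun n hn => ?_
      simp only [Finset.mem_singleton] at hn
      simp [hn], by
      convert hasSum_ite_eq 0 (InnerProductSpace.rankOne ℂ x y) using 2 with n
      by_cases h : n = 0 <;> simp [h]⟩

theorem ketBra_add_left (x x' y : H) : ketBra (x + x') y = ketBra x y + ketBra x' y :=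
  Subtype.ext (by simp [ketBra])

theorem ketBra_add_right (x y y' : H) : ketBra x (y + y') = ketBra x y + ketBra x y' :=
  Subtype.ext (by simp [ketBra])

theorem ketBra_smul_left (c : ℂ) (x y : H) : ketBra (c • x) y = c • ketBra x y :=
  Subtype.ext (by simp [ketBra])

theorem ketBra_smul_right (c : ℂ) (x y : H) :
    ketBra x (c • y) = starRingEnd ℂ c • ketBra x y :=
  Subtype.ext (by simp [ketBra])

variable [CompleteSpace H]

/-- `Tr T = ∑ᵢ ⟨eᵢ, T eᵢ⟩` in a complete orthonormal system; for trace-class `T` the sum converges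
absolutely and does not depend on the system. -/
def trace (T : H →L[ℂ] H) : ℂ :=
  ∑' i, ⟪(exists_hilbertBasis ℂ H).choose_spec.choose i,
    T ((exists_hilbertBasis ℂ H).choose_spec.choose i)⟫_ℂ

/-- Density operators: positive operators of unit trace. -/
def IsState (ρ : traceClass H) : Prop :=
  (ρ : H →L[ℂ] H).IsPositive ∧ trace (ρ : H →L[ℂ] H) = 1

end TraceClass

section Transposition

variable {ι H : Type*} [NormedAddCommGroup H] [InnerProductSpace ℂ H]

/-- Complex conjugation `ψ ↦ ψ̄ = ∑ᵢ |i⟩ conj ⟨i|ψ⟩` in the basis `b`. -/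
def conjugation (b : HilbertBasis ι ℂ H) : H ≃ₗᵢ⋆[ℂ] H :=
  (b.repr.trans (starₗᵢ ℂ)).trans b.repr.symm

variable [CompleteSpace H]

/-- Transposition `Xᵀ` in the basis `b`, i.e. `⟨i|Xᵀ|j⟩ = ⟨j|X|i⟩`: the operator `ψ ↦ conj (X* ψ̄)`. -/
def transpose (b : HilbertBasis ι ℂ H) (X : H →L[ℂ] H) : H →L[ℂ] H :=
  ((conjugation b).toContinuousLinearEquiv : H →L⋆[ℂ] H).comp
    ((ContinuousLinearMap.adjoint X).comp
      ((conjugation b).toContinuousLinearEquiv : H →L⋆[ℂ] H))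

end Transposition

section Channels

variable {ι HA HB : Type*}
  [NormedAddCommGroup HA] [InnerProductSpace ℂ HA]
  [NormedAddCommGroup HB] [InnerProductSpace ℂ HB]

/-- Channels: linear maps of trace-class operators which take states to states and have a positive
semidefinite block matrix `[Φ(|i⟩⟨j|)]` in the basis `b`. -/
structure IsChannel [CompleteSpace HA] [CompleteSpace HB] (b : HilbertBasis ι ℂ HA)
    (Φ : traceClass HA →ₗ[ℂ] traceClass HB) : Prop where
  map_state : ∀ ρ, IsState ρ → IsState (Φ ρ)
  block_nonneg : ∀ (t : Finset ι) (ψ : ι → HB),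
    0 ≤ ∑ i ∈ t, ∑ j ∈ t, ⟪ψ i, (Φ (ketBra (b i) (b j)) : HB →L[ℂ] HB) (ψ j)⟫_ℂ

/-- `Y = Φ*(X)`, i.e. `Tr Φ(ρ) X = Tr ρ Y` for all trace-class `ρ`. -/
def IsDualValue [CompleteSpace HA] [CompleteSpace HB] (Φ : traceClass HA →ₗ[ℂ] traceClass HB)
    (X : HB →L[ℂ] HB) (Y : HA →L[ℂ] HA) : Prop :=
  ∀ ρ : traceClass HA, trace ((Φ ρ : HB →L[ℂ] HB) ∘L X) = trace ((ρ : HA →L[ℂ] HA) ∘L Y)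

/-- The dual map `Φ* : 𝔅(H_B) → 𝔅(H_A)`. -/
def dual [CompleteSpace HA] [CompleteSpace HB] (Φ : traceClass HA →ₗ[ℂ] traceClass HB)
    (X : HB →L[ℂ] HB) : HA →L[ℂ] HA :=
  Classical.epsilon (IsDualValue Φ X)

/-- The Choi-Jamiolkowski form `Ω_Φ` on the algebraic tensor product `H_B ⊗ H_A`, antilinear in the
first argument:
`Ω_Φ(ψ_B ⊗ ψ_A; ψ_B' ⊗ ψ_A') = ⟨ψ_B| Φ(|ψ̄_A⟩⟨ψ̄_A'|) |ψ_B'⟩`. -/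
def cjForm (b : HilbertBasis ι ℂ HA) (Φ : traceClass HA →ₗ[ℂ] traceClass HB) :
    (HB ⊗[ℂ] HA) →ₗ⋆[ℂ] (HB ⊗[ℂ] HA) →ₗ[ℂ] ℂ :=
  TensorProduct.lift (LinearMap.mk₂'ₛₗ (starRingEnd ℂ) (starRingEnd ℂ)
    (fun ψB ψA => TensorProduct.lift (LinearMap.mk₂ ℂ
      (fun ψB' ψA' => ⟪ψB, (Φ (ketBra (conjugation b ψA) (conjugation b ψA')) : HB →L[ℂ] HB) ψB'⟫_ℂ)
      (fun _ _ _ => by simp)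
      (fun _ _ _ => by simp)
      (fun _ _ _ => by simp [ketBra_add_right])
      (fun _ _ _ => by simp [LinearIsometryEquiv.map_smulₛₗ, ketBra_smul_right])))
    (fun _ _ _ => TensorProduct.ext' fun _ _ => by simp)
    (fun _ _ _ => TensorProduct.ext' fun _ _ => by simp [mul_comm])
    (fun _ _ _ => TensorProduct.ext' fun _ _ => by simp [ketBra_add_left])
    (fun _ _ _ => TensorProduct.ext' fun _ _ => by
      simp [LinearIsometryEquiv.map_smulₛₗ, ketBra_smul_left]))

theorem cjForm_tmul (b : HilbertBasis ι ℂ HA) (Φ : traceClass HA →ₗ[ℂ] traceClass HB)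
    (ψB ψB' : HB) (ψA ψA' : HA) :
    cjForm b Φ (ψB ⊗ₜ ψA) (ψB' ⊗ₜ ψA') =
      ⟪ψB, (Φ (ketBra (conjugation b ψA) (conjugation b ψA')) : HB →L[ℂ] HB) ψB'⟫_ℂ :=
  rfl

end Channels

section UnboundedOperators

variable {E : Type*} [NormedAddCommGroup E] [InnerProductSpace ℂ E]

/-- Strongly continuous one-parameter unitary groups. -/
structure IsUnitaryGroup [CompleteSpace E] (U : ℝ → E →L[ℂ] E) : Prop where
  mem_unitary : ∀ t, U t ∈ unitary (E →L[ℂ] E)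
  map_add : ∀ t t', U (t + t') = U t ∘L U t'
  continuous : ∀ x, Continuous fun t => U t x

/-- The Stone generator `x ↦ -i (d/dt) U(t) x |_{t = 0}`, defined on all `x` for which the
derivative exists. -/
def stoneGenerator (U : ℝ → E →L[ℂ] E) : E →ₗ.[ℂ] E where
  domain :=
    { carrier := {x | DifferentiableAt ℝ (fun t => U t x) 0}
      zero_mem' := by simp
      add_mem' := fun {x y} hx hy => by
        simpa using DifferentiableAt.fun_add hx hy
      smul_mem' := fun c x hx => by
        simpa using DifferentiableAt.fun_const_smul hx c }
  toFun :=
    { toFun := fun x => -Complex.I • deriv (fun t => U t (x : E)) 0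
      map_add' := fun x y => by
        simp only [Submodule.coe_add, map_add]
        rw [deriv_fun_add x.2 y.2, smul_add]
      map_smul' := fun c x => by
        simp only [Submodule.coe_smul, map_smul, RingHom.id_apply]
        rw [deriv_fun_const_smul c x.2, smul_comm] }

/-- `U(t) = exp(itA)`: `U` is the strongly continuous unitary group whose generator is the closure
of `A` (so that `A` is essentially self-adjoint). -/
def IsExpGroup [CompleteSpace E] (A : E →ₗ.[ℂ] E) (U : ℝ → E →L[ℂ] E) : Prop :=
  IsUnitaryGroup U ∧ stoneGenerator U = A.closure

/-- The unitary operator `exp(itA)` for an essentially self-adjoint `A`. -/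
def expI [CompleteSpace E] (A : E →ₗ.[ℂ] E) (t : ℝ) : E →L[ℂ] E :=
  Classical.epsilon (IsExpGroup A) t

/-- The unbounded operator with domain the range of the injection `j`, which maps `j v` to `f v`. -/
def ofInjective {V : Type*} [AddCommGroup V] [Module ℂ V] (j f : V →ₗ[ℂ] E)
    (hj : Function.Injective j) : E →ₗ.[ℂ] E where
  domain := LinearMap.range j
  toFun := f ∘ₗ (LinearEquiv.ofInjective j hj).symm.toLinearMap

end UnboundedOperators

section HilbertTensor

variable {HA HB : Type*}
  [NormedAddCommGroup HA] [InnerProductSpace ℂ HA]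
  [NormedAddCommGroup HB] [InnerProductSpace ℂ HB]

/-- The Hilbert space tensor product of `H_B` and `H_A`. -/
abbrev HTensor (HB HA : Type*) [NormedAddCommGroup HB] [InnerProductSpace ℂ HB]
    [NormedAddCommGroup HA] [InnerProductSpace ℂ HA] : Type _ :=
  UniformSpace.Completion (HB ⊗[ℂ] HA)

/-- The inclusion of the algebraic tensor product into the Hilbert space tensor product. -/
def incl : (HB ⊗[ℂ] HA) →ₗ[ℂ] HTensor HB HA :=
  (UniformSpace.Completion.toComplₗᵢ (𝕜 := ℂ) (E := HB ⊗[ℂ] HA)).toLinearMap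

theorem incl_injective : Function.Injective (incl : (HB ⊗[ℂ] HA) →ₗ[ℂ] HTensor HB HA) :=
  (UniformSpace.Completion.toComplₗᵢ (𝕜 := ℂ) (E := HB ⊗[ℂ] HA)).injective

/-- `A ⊗ I`, with domain the algebraic tensor product `dom A ⊗ H_A`. -/
def tensorId (A : HB →ₗ.[ℂ] HB) : HTensor HB HA →ₗ.[ℂ] HTensor HB HA :=
  ofInjective (incl ∘ₗ TensorProduct.map A.domain.subtype (LinearMap.id : HA →ₗ[ℂ] HA))
    (incl ∘ₗ TensorProduct.map A.toFun (LinearMap.id : HA →ₗ[ℂ] HA))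
    (incl_injective.comp (Module.Flat.rTensor_preserves_injective_linearMap
      A.domain.subtype A.domain.injective_subtype))

/-- `I ⊗ A`, with domain the algebraic tensor product `H_B ⊗ dom A`. -/
def idTensor (A : HA →ₗ.[ℂ] HA) : HTensor HB HA →ₗ.[ℂ] HTensor HB HA :=
  ofInjective (incl ∘ₗ TensorProduct.map (LinearMap.id : HB →ₗ[ℂ] HB) A.domain.subtype)
    (incl ∘ₗ TensorProduct.map (LinearMap.id : HB →ₗ[ℂ] HB) A.toFun)
    (incl_injective.comp (Module.Flat.lTensor_preserves_injective_linearMap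
      A.domain.subtype A.domain.injective_subtype))

end HilbertTensor

section CCR

/-- The coordinate space `Z = ℝ^{2s}`; `z (0, j)` and `z (1, j)` are the two coordinates of the
`j`-th mode. -/
abbrev Z (s : ℕ) : Type := Fin 2 × Fin s → ℝ

/-- The matrix `Δ = diag [[0, -1], [1, 0]]` of the symplectic form `Δ(z, z') = zᵗ Δ z'`. -/
def sympl (s : ℕ) : Matrix (Fin 2 × Fin s) (Fin 2 × Fin s) ℝ :=
  Matrix.blockDiagonal fun _ : Fin s => !![0, -1; 1, 0]

/-- An irreducible strongly continuous representation of the CCR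
`W(z) W(z') = exp((i/2) Δ(z, z')) W(z + z')` by unitary operators in `H`. -/
structure WeylSystem (s : ℕ) (H : Type*) [NormedAddCommGroup H] [InnerProductSpace ℂ H]
    [CompleteSpace H] where
  W : Z s → H →L[ℂ] H
  mem_unitary : ∀ z, W z ∈ unitary (H →L[ℂ] H)
  ccr : ∀ z z', W z ∘L W z' =
    Complex.exp (Complex.I / 2 * ((z ⬝ᵥ sympl s *ᵥ z' : ℝ) : ℂ)) • W (z + z')
  continuous : ∀ ψ, Continuous fun z => W z ψ
  nontrivial : Nontrivial H
  irreducible : ∀ V : Submodule ℂ H, IsClosed (V : Set H) →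
    (∀ z, ∀ ψ ∈ V, W z ψ ∈ V) → V = ⊥ ∨ V = ⊤

variable {H : Type*} [NormedAddCommGroup H] [InnerProductSpace ℂ H]

/-- The entries `R_j` of the row-vector `R` of canonical variables of a Weyl system
`W(z) = exp(i R·z)`: the generators of `t ↦ W(t e_j)`. -/
def canonicalVariables {s : ℕ} (W : Z s → H →L[ℂ] H) (j : Fin 2 × Fin s) : H →ₗ.[ℂ] H :=
  stoneGenerator fun t => W (t • Pi.single j 1)

/-- `R·z = ∑ⱼ zⱼ Rⱼ` for a vector of unbounded operators. -/
def dotOp {s : ℕ} (R : Fin 2 × Fin s → H →ₗ.[ℂ] H) (z : Z s) : H →ₗ.[ℂ] H :=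
  ∑ j, z j • R j

variable {ι HA HB : Type*}
  [NormedAddCommGroup HA] [InnerProductSpace ℂ HA] [CompleteSpace HA]
  [NormedAddCommGroup HB] [InnerProductSpace ℂ HB] [CompleteSpace HB]

/-- The row-vector `R_BA = R_B ⊗ I - I ⊗ R_Aᵀ K`, where `R_Aᵀ` are the canonical variables of the
transposed Weyl system `W_A(z)ᵀ = exp(i R_Aᵀ·z)`. -/
def RBA {sA sB : ℕ} (b : HilbertBasis ι ℂ HA) (WA : WeylSystem sA HA) (WB : WeylSystem sB HB)
    (K : Matrix (Fin 2 × Fin sA) (Fin 2 × Fin sB) ℝ) (j : Fin 2 × Fin sB) :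
    HTensor HB HA →ₗ.[ℂ] HTensor HB HA :=
  tensorId (canonicalVariables WB.W j) -
    idTensor (∑ k, K k j • canonicalVariables (fun z => transpose b (WA.W z)) k)

/-- Centered Gaussian channels with parameters `K`, `μ`:
`Φ*(W_B(z)) = W_A(Kz) exp(-zᵗμz/2)`, where `μ ≥ ± (i/2) Δ_K` and `Δ_K = Δ_B - Kᵗ Δ_A K`. -/
structure IsGaussian {sA sB : ℕ} (WA : WeylSystem sA HA) (WB : WeylSystem sB HB)
    (K : Matrix (Fin 2 × Fin sA) (Fin 2 × Fin sB) ℝ)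
    (μ : Matrix (Fin 2 × Fin sB) (Fin 2 × Fin sB) ℝ)
    (Φ : traceClass HA →ₗ[ℂ] traceClass HB) : Prop where
  dual_weyl : ∀ z, dual Φ (WB.W z) =
    ((Real.exp (-(1 / 2) * (z ⬝ᵥ μ *ᵥ z)) : ℝ) : ℂ) • WA.W (K *ᵥ z)
  pos : (μ.map Complex.ofReal -
    (Complex.I / 2) • (sympl sB - Kᵀ * sympl sA * K).map Complex.ofReal).PosSemidef
  pos' : (μ.map Complex.ofReal +
    (Complex.I / 2) • (sympl sB - Kᵀ * sympl sA * K).map Complex.ofReal).PosSemidef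

end CCR

end CJ

end

noncomputable section

namespace CJ

/-! ### Nuclear operators and the trace. -/

section TraceFormulas

variable {H : Type*} [NormedAddCommGroup H] [InnerProductSpace ℂ H]

/-! The inversion formula is the weak Weyl expansion of a trace-class operator, σ = (2π)^{-s} ∫ Tr(σ
W(z)) W(-z) dz (`integral_inner_mul_traceMul`), applied to σ = Φ(|ψ̄⟩⟨ψ̄'|): duality turns Tr(σ
W(z)) into ⟨ψ̄', Φ*(W(z)) ψ̄⟩, and this is a matrix element of the transpose. For σ = |a⟩⟨b| the
expansion is Schur orthogonality (`integral_inner_mul_inner`), and nuclear series reduce the general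
case to this one.

Schur orthogonality follows von Neumann's proof of uniqueness of the CCR. The operator P = ∫
exp(-|z|²/4) W(z) dz satisfies P W(w) P = (2π)^s exp(-|w|²/4) P, and it is nonzero by Fourier
inversion. Irreducibility then makes P a multiple of the projection to one vacuum vector Ω
(`exists_vacuum`). On the coherent vectors W(u)Ω orthogonality is a restatement of the rank-one form
of P. It extends by density, with continuity supplied by Fatou and Cauchy-Schwarz.

A channel is not assumed continuous, so existence of Φ* needs a bound. Positive operators are
multiples of states, which gives |Tr Φ(T)X| ≤ ‖X‖ Tr T for the positive operators occurring here,
and polarization extends this to all nuclear operators up to a constant (`norm_traceMul_map_le`).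

For the exponential form, (z, z') ↦ W_B(z) ⊗ W_A(z')ᵀ is a projective representation, and R_BA·z is
a restriction of the generator of its line through (z, -Kz). The domain of R_BA·z is dense, since it
contains products of smooth vectors, and invariant under the group. So R_BA·z is essentially
self-adjoint with that generator as closure (`stoneGenerator_eq_closure`). -/

theorem sum_norm_inner_mul_norm_inner_le {w : Type*} {e : w → H} (he : Orthonormal ℂ e) (x y : H)
    (t : Finset w) : ∑ i ∈ t, ‖⟪e i, x⟫_ℂ‖ * ‖⟪e i, y⟫_ℂ‖ ≤ ‖x‖ * ‖y‖ := by
  refine (Real.sum_mul_le_sqrt_mul_sqrt _ _ _).trans ?_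
  gcongr
  · exact Real.sqrt_le_iff.2 ⟨norm_nonneg _, he.sum_inner_products_le x⟩
  · exact Real.sqrt_le_iff.2 ⟨norm_nonneg _, he.sum_inner_products_le y⟩

/-- Cauchy-Schwarz and Bessel bound the fibre over `n` by `‖x n‖ * ‖y n‖`. Absolute summability over
pairs is what permits exchanging the basis sum with the nuclear sum. -/
theorem summable_inner_mul_inner_prod {w : Type*} {e : w → H} (he : Orthonormal ℂ e)
    {x y : ℕ → H} (h : Summable fun n => ‖x n‖ * ‖y n‖) :
    Summable fun p : ℕ × w => ⟪y p.1, e p.2⟫_ℂ * ⟪e p.2, x p.1⟫_ℂ := by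
  refine Summable.of_norm ?_
  have key : ∀ n (t : Finset w), ∑ i ∈ t, ‖⟪y n, e i⟫_ℂ * ⟪e i, x n⟫_ℂ‖ ≤ ‖x n‖ * ‖y n‖ := by
    intro n t
    refine le_trans (le_of_eq ?_) (sum_norm_inner_mul_norm_inner_le he (x n) (y n) t)
    refine Finset.sum_congr rfl fun i _ => ?_
    rw [norm_mul, mul_comm, norm_inner_symm (y n)]
  have hs : ∀ n, Summable fun i => ‖⟪y n, e i⟫_ℂ * ⟪e i, x n⟫_ℂ‖ := fun n =>
    summable_of_sum_le (fun _ => norm_nonneg _) (key n)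
  refine (summable_prod_of_nonneg fun _ => norm_nonneg _).2 ⟨hs, ?_⟩
  refine Summable.of_nonneg_of_le (fun n => tsum_nonneg fun _ => norm_nonneg _) (fun n => ?_) h
  exact (hs n).tsum_le_of_sum_le (key n)

theorem summable_rankOne {x y : ℕ → H} [CompleteSpace H] (h : Summable fun n => ‖x n‖ * ‖y n‖) :
    Summable fun n => InnerProductSpace.rankOne ℂ (x n) (y n) :=
  Summable.of_norm (by simpa using h)

variable [CompleteSpace H]

/-- The orthonormal system used in the definition of the trace. -/
def traceBasis (H : Type*) [NormedAddCommGroup H] [InnerProductSpace ℂ H] [CompleteSpace H] :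
    HilbertBasis (exists_hilbertBasis ℂ H).choose ℂ H :=
  (exists_hilbertBasis ℂ H).choose_spec.choose

/-- Both series are iterated sums of one double family ⟨yₙ, eᵢ⟩⟨eᵢ, xₙ⟩: the fibres over `n` are
summed by Parseval, those over `i` by the expansion of `T`. -/
theorem hasSum_trace_pair {T : H →L[ℂ] H} {x y : ℕ → H}
    (h : Summable fun n => ‖x n‖ * ‖y n‖)
    (hT : HasSum (fun n => InnerProductSpace.rankOne ℂ (x n) (y n)) T) :
    HasSum (fun i => ⟪traceBasis H i, T (traceBasis H i)⟫_ℂ) (trace T) ∧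
      HasSum (fun n => ⟪y n, x n⟫_ℂ) (trace T) := by
  have hs := summable_inner_mul_inner_prod (traceBasis H).orthonormal h
  obtain ⟨a, ha⟩ := hs
  have h1 : HasSum (fun n => ⟪y n, x n⟫_ℂ) a :=
    ha.prod_fiberwise fun n => (traceBasis H).hasSum_inner_mul_inner (y n) (x n)
  have h2 : HasSum (fun i => ⟪traceBasis H i, T (traceBasis H i)⟫_ℂ) a := by
    refine HasSum.prod_fiberwise (((Equiv.prodComm _ _).hasSum_iff).2 ha) fun i => ?_
    have := (hT.mapL (ContinuousLinearMap.apply ℂ H (traceBasis H i))).mapL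
      (innerSL ℂ (traceBasis H i))
    simpa [inner_smul_right] using this
  have h3 : trace T = a := h2.tsum_eq
  exact h3 ▸ ⟨h2, h1⟩

theorem hasSum_trace_of_nuclear {T : H →L[ℂ] H} {x y : ℕ → H}
    (h : Summable fun n => ‖x n‖ * ‖y n‖)
    (hT : HasSum (fun n => InnerProductSpace.rankOne ℂ (x n) (y n)) T) :
    HasSum (fun n => ⟪y n, x n⟫_ℂ) (trace T) :=
  (hasSum_trace_pair h hT).2

omit [CompleteSpace H] in
theorem summable_norm_mul_norm_map {x y : ℕ → H} (h : Summable fun n => ‖x n‖ * ‖y n‖)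
    (X : H →L[ℂ] H) : Summable fun n => ‖x n‖ * ‖X (y n)‖ := by
  refine Summable.of_nonneg_of_le (fun n => by positivity) (fun n => ?_) (h.mul_left ‖X‖)
  calc ‖x n‖ * ‖X (y n)‖ ≤ ‖x n‖ * (‖X‖ * ‖y n‖) := by gcongr; exact X.le_opNorm _
    _ = ‖X‖ * (‖x n‖ * ‖y n‖) := by ring

theorem hasSum_rankOne_comp {T : H →L[ℂ] H} {x y : ℕ → H}
    (hT : HasSum (fun n => InnerProductSpace.rankOne ℂ (x n) (y n)) T) (X : H →L[ℂ] H) :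
    HasSum (fun n => InnerProductSpace.rankOne ℂ (x n) (ContinuousLinearMap.adjoint X (y n)))
      (T ∘L X) := by
  have h : (fun n => InnerProductSpace.rankOne ℂ (x n) (ContinuousLinearMap.adjoint X (y n))) =
      fun n => (ContinuousLinearMap.compL ℂ H H H).flip X
        (InnerProductSpace.rankOne ℂ (x n) (y n)) := by
    funext n
    ext v
    simp [ContinuousLinearMap.adjoint_inner_left]
  rw [h]
  exact hT.mapL ((ContinuousLinearMap.compL ℂ H H H).flip X)

theorem hasSum_trace_comp {T : H →L[ℂ] H} {x y : ℕ → H}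
    (h : Summable fun n => ‖x n‖ * ‖y n‖)
    (hT : HasSum (fun n => InnerProductSpace.rankOne ℂ (x n) (y n)) T) (X : H →L[ℂ] H) :
    HasSum (fun n => ⟪y n, X (x n)⟫_ℂ) (trace (T ∘L X)) := by
  simpa only [ContinuousLinearMap.adjoint_inner_left] using
    hasSum_trace_of_nuclear (summable_norm_mul_norm_map h _) (hasSum_rankOne_comp hT X)

/-- Unlike the nuclear series, the basis expression is visibly linear in `T`; this is what makes
`traceMul` linear. -/
theorem hasSum_trace_comp_basis (T : traceClass H) (X : H →L[ℂ] H) :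
    HasSum (fun i => ⟪traceBasis H i, (T : H →L[ℂ] H) (X (traceBasis H i))⟫_ℂ)
      (trace ((T : H →L[ℂ] H) ∘L X)) := by
  obtain ⟨T, x, y, h, hT⟩ := T
  exact (hasSum_trace_pair (summable_norm_mul_norm_map h _) (hasSum_rankOne_comp hT X)).1

/-- The linear functional `ρ ↦ Tr ρ X` on the trace class. -/
def traceMul (X : H →L[ℂ] H) : traceClass H →ₗ[ℂ] ℂ where
  toFun ρ := trace ((ρ : H →L[ℂ] H) ∘L X)
  map_add' ρ σ := by
    refine (hasSum_trace_comp_basis (ρ + σ) X).unique ?_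
    simpa [inner_add_right] using
      (hasSum_trace_comp_basis ρ X).add (hasSum_trace_comp_basis σ X)
  map_smul' c ρ := by
    refine (hasSum_trace_comp_basis (c • ρ) X).unique ?_
    simpa [inner_smul_right] using (hasSum_trace_comp_basis ρ X).mul_left c

theorem traceMul_apply (X : H →L[ℂ] H) (ρ : traceClass H) :
    traceMul X ρ = trace ((ρ : H →L[ℂ] H) ∘L X) := rfl

theorem traceMul_one (ρ : traceClass H) : traceMul 1 ρ = trace (ρ : H →L[ℂ] H) := rfl

theorem traceMul_ketBra (X : H →L[ℂ] H) (x y : H) : traceMul X (ketBra x y) = ⟪y, X x⟫_ℂ := by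
  let x' : ℕ → H := fun n => if n = 0 then x else 0
  let y' : ℕ → H := fun n => if n = 0 then y else 0
  have h : Summable fun n => ‖x' n‖ * ‖y' n‖ := by
    refine summable_of_ne_finset_zero (s := {0}) fun n hn => ?_
    simp only [Finset.mem_singleton] at hn
    simp [x', hn]
  have hT : HasSum (fun n => InnerProductSpace.rankOne ℂ (x' n) (y' n)) (ketBra x y : H →L[ℂ] H) := by
    change HasSum _ (InnerProductSpace.rankOne ℂ x y)
    convert hasSum_ite_eq 0 (InnerProductSpace.rankOne ℂ x y) using 2 with n
    by_cases h : n = 0 <;> simp [h, x', y']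
  refine (hasSum_trace_comp h hT X).unique ?_
  convert hasSum_ite_eq 0 (⟪y, X x⟫_ℂ) using 2 with n
  by_cases h : n = 0 <;> simp [h, x', y']

/-- The trace-class operator `∑ₙ |xₙ⟩⟨yₙ|`. -/
def nuclear (x y : ℕ → H) (h : Summable fun n => ‖x n‖ * ‖y n‖) : traceClass H :=
  ⟨∑' n, InnerProductSpace.rankOne ℂ (x n) (y n), x, y, h, (summable_rankOne h).hasSum⟩

theorem hasSum_nuclear (x y : ℕ → H) (h : Summable fun n => ‖x n‖ * ‖y n‖) :
    HasSum (fun n => InnerProductSpace.rankOne ℂ (x n) (y n)) (nuclear x y h : H →L[ℂ] H) :=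
  (summable_rankOne h).hasSum

/-- The squared Hilbert-Schmidt norm does not change under taking adjoints. -/
theorem tsum_enorm_sq_adjoint {w : Type*} (e : HilbertBasis w ℂ H) (S : H →L[ℂ] H) :
    ∑' i, ‖ContinuousLinearMap.adjoint S (e i)‖ₑ ^ 2 = ∑' i, ‖S (e i)‖ₑ ^ 2 := by
  have parseval : ∀ v : H, ‖v‖ₑ ^ 2 = ∑' i, ‖⟪e i, v⟫_ℂ‖ₑ ^ 2 := by
    intro v
    have h1 : HasSum (fun i => ‖⟪e i, v⟫_ℂ‖ ^ 2) (‖v‖ ^ 2) := by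
      have := (e.hasSum_inner_mul_inner v v).mapL Complex.reCLM
      convert this using 1
      · funext i
        simp only [Complex.reCLM_apply]
        rw [← inner_conj_symm v (e i), ← Complex.normSq_eq_conj_mul_self, Complex.ofReal_re,
          Complex.normSq_eq_norm_sq]
      · rw [inner_self_eq_norm_sq_to_K]
        norm_cast
    have h2 : ENNReal.ofReal (‖v‖ ^ 2) = ∑' i, ENNReal.ofReal (‖⟪e i, v⟫_ℂ‖ ^ 2) := by
      rw [← h1.tsum_eq, ENNReal.ofReal_tsum_of_nonneg (fun _ => by positivity) h1.summable]
    simpa only [ENNReal.ofReal_pow (norm_nonneg _), ofReal_norm] using h2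
  calc ∑' i, ‖ContinuousLinearMap.adjoint S (e i)‖ₑ ^ 2
      = ∑' i, ∑' j, ‖⟪e j, ContinuousLinearMap.adjoint S (e i)⟫_ℂ‖ₑ ^ 2 :=
        tsum_congr fun i => parseval _
    _ = ∑' j, ∑' i, ‖⟪e j, ContinuousLinearMap.adjoint S (e i)⟫_ℂ‖ₑ ^ 2 := ENNReal.tsum_comm
    _ = ∑' j, ∑' i, ‖⟪e i, S (e j)⟫_ℂ‖ₑ ^ 2 := by
        refine tsum_congr fun j => tsum_congr fun i => ?_
        rw [ContinuousLinearMap.adjoint_inner_right, ← inner_conj_symm, RCLike.enorm_conj]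
    _ = ∑' i, ‖S (e i)‖ₑ ^ 2 := tsum_congr fun i => (parseval _).symm

/-- With T = S*S, the trace of TX is the Hilbert-Schmidt pairing of S and SX. Cauchy-Schwarz leaves
‖SX‖₂ ≤ ‖X‖ ‖S‖₂, which is clear for the adjoints, where X* acts last. -/
theorem norm_trace_comp_le (T : traceClass H) (hT : (T : H →L[ℂ] H).IsPositive) (X : H →L[ℂ] H) :
    ‖trace ((T : H →L[ℂ] H) ∘L X)‖ ≤ ‖X‖ * (trace (T : H →L[ℂ] H)).re := by
  obtain ⟨S, hS⟩ := CStarAlgebra.nonneg_iff_eq_star_mul_self.1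
    ((ContinuousLinearMap.nonneg_iff_isPositive _).2 hT)
  have hST : ∀ v u, ⟪v, (T : H →L[ℂ] H) u⟫_ℂ = ⟪S v, S u⟫_ℂ := fun v u => by
    rw [hS, ContinuousLinearMap.star_eq_adjoint, mul_apply_eq_comp,
      ContinuousLinearMap.adjoint_inner_right]
  set e := traceBasis H
  have h1 : HasSum (fun i => ‖S (e i)‖ ^ 2) (trace (T : H →L[ℂ] H)).re := by
    have := (hasSum_trace_comp_basis T 1).mapL Complex.reCLM
    convert this using 1
    · funext i
      simp only [Complex.reCLM_apply, one_apply_eq_self]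
      rw [hST, inner_self_eq_norm_sq_to_K]
      norm_cast
    · rfl
  have h1e : ∑' i, ‖S (e i)‖ₑ ^ 2 = ENNReal.ofReal (trace (T : H →L[ℂ] H)).re := by
    rw [← h1.tsum_eq, ENNReal.ofReal_tsum_of_nonneg (fun _ => by positivity) h1.summable]
    simp only [ENNReal.ofReal_pow (norm_nonneg _), ofReal_norm]
  -- Hilbert-Schmidt sums are handled in `ENNReal`, so that summability for `S ∘L X` is an outcome
  -- and not a prerequisite.
  have h2e : ∑' i, ‖S (X (e i))‖ₑ ^ 2 ≤ ENNReal.ofReal (‖X‖ ^ 2 * (trace (T : H →L[ℂ] H)).re) := by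
    calc ∑' i, ‖S (X (e i))‖ₑ ^ 2 = ∑' i, ‖(S ∘L X) (e i)‖ₑ ^ 2 := rfl
      _ = ∑' i, ‖ContinuousLinearMap.adjoint X (ContinuousLinearMap.adjoint S (e i))‖ₑ ^ 2 := by
        rw [← tsum_enorm_sq_adjoint, ContinuousLinearMap.adjoint_comp]; rfl
      _ ≤ ∑' i, ‖X‖ₑ ^ 2 * ‖ContinuousLinearMap.adjoint S (e i)‖ₑ ^ 2 := by
        refine ENNReal.tsum_le_tsum fun i => ?_
        rw [← mul_pow]
        gcongr
        refine (ContinuousLinearMap.le_opENorm _ _).trans_eq ?_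
        congr 1
        simp [← ofReal_norm]
      _ = ENNReal.ofReal (‖X‖ ^ 2 * (trace (T : H →L[ℂ] H)).re) := by
        rw [ENNReal.tsum_mul_left, tsum_enorm_sq_adjoint, h1e, ENNReal.ofReal_mul (by positivity),
          ENNReal.ofReal_pow (norm_nonneg _), ofReal_norm]
  have ht : 0 ≤ (trace (T : H →L[ℂ] H)).re := h1.nonneg fun _ => by positivity
  have h2 : ∀ t : Finset _, ∑ i ∈ t, ‖S (X (e i))‖ ^ 2 ≤ ‖X‖ ^ 2 * (trace (T : H →L[ℂ] H)).re := by
    intro t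
    rw [← ENNReal.ofReal_le_ofReal_iff (by positivity),
      ENNReal.ofReal_sum_of_nonneg fun _ _ => by positivity]
    simp only [ENNReal.ofReal_pow (norm_nonneg _), ofReal_norm]
    exact (ENNReal.sum_le_tsum t).trans h2e
  refine le_of_tendsto ((hasSum_trace_comp_basis T X).norm) (Filter.Eventually.of_forall fun t => ?_)
  calc ‖∑ i ∈ t, ⟪e i, (T : H →L[ℂ] H) (X (e i))⟫_ℂ‖
      ≤ ∑ i ∈ t, ‖S (e i)‖ * ‖S (X (e i))‖ := by
        refine (norm_sum_le _ _).trans (Finset.sum_le_sum fun i _ => ?_)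
        rw [hST]
        exact norm_inner_le_norm _ _
    _ ≤ √(∑ i ∈ t, ‖S (e i)‖ ^ 2) * √(∑ i ∈ t, ‖S (X (e i))‖ ^ 2) :=
        Real.sum_mul_le_sqrt_mul_sqrt _ _ _
    _ ≤ √(trace (T : H →L[ℂ] H)).re * √(‖X‖ ^ 2 * (trace (T : H →L[ℂ] H)).re) := by
        gcongr
        · exact sum_le_hasSum t (fun _ _ => by positivity) h1
        · exact h2 t
    _ = ‖X‖ * (trace (T : H →L[ℂ] H)).re := by
        rw [Real.sqrt_mul (by positivity), Real.sqrt_sq (norm_nonneg _), mul_left_comm,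
          Real.mul_self_sqrt ht]

end TraceFormulas

/-! ### Continuity of channels and existence of the dual map. -/

section DualMap

variable {H : Type*} [NormedAddCommGroup H] [InnerProductSpace ℂ H]

/-- Balancing each term so that both factors have squared norm ‖xₙ‖‖yₙ‖ makes the two sequences
separately square summable, as polarization requires. -/
theorem exists_nuclear_summable_sq (T : traceClass H) : ∃ x y : ℕ → H,
    Summable (fun n => ‖x n‖ ^ 2) ∧ Summable (fun n => ‖y n‖ ^ 2) ∧
    HasSum (fun n => InnerProductSpace.rankOne ℂ (x n) (y n)) (T : H →L[ℂ] H) := by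
  obtain ⟨T, x, y, h, hT⟩ := T
  have aux : ∀ u v : H, ‖((√(‖v‖ / ‖u‖) : ℝ) : ℂ) • u‖ ^ 2 = ‖u‖ * ‖v‖ := by
    intro u v
    rw [norm_smul, mul_pow, Complex.norm_real, Real.norm_eq_abs, sq_abs,
      Real.sq_sqrt (by positivity)]
    by_cases hu : ‖u‖ = 0
    · simp [hu]
    · field_simp
  refine ⟨fun n => ((√(‖y n‖ / ‖x n‖) : ℝ) : ℂ) • x n,
    fun n => ((√(‖x n‖ / ‖y n‖) : ℝ) : ℂ) • y n, ?_, ?_, ?_⟩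
  · simpa only [aux] using h
  · simpa only [aux, mul_comm] using h
  · refine (congrArg (HasSum · _) (funext fun n => ?_)).mpr hT
    -- If a factor vanishes, division by zero makes the rescaling degenerate, but then the term
    -- |xₙ⟩⟨yₙ| is zero anyway.
    have h1 : √(‖y n‖ / ‖x n‖) * √(‖x n‖ / ‖y n‖) = 1 ∨ x n = 0 ∨ y n = 0 := by
      by_cases hx : x n = 0
      · exact Or.inr (Or.inl hx)
      by_cases hy : y n = 0
      · exact Or.inr (Or.inr hy)
      left
      rw [← Real.sqrt_mul (by positivity), div_mul_div_comm, mul_comm ‖x n‖,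
        div_self (by positivity), Real.sqrt_one]
    rcases h1 with h1 | h1 | h1
    · simp only [map_smul, map_smulₛₗ, _root_.smul_apply, smul_smul,
        Complex.conj_ofReal, ← Complex.ofReal_mul]
      rw [mul_comm, h1]
      simp
    · simp [h1]
    · simp [h1]

variable [CompleteSpace H]

omit [InnerProductSpace ℂ H] [CompleteSpace H] in
theorem summable_norm_mul_norm {x y : ℕ → H} (hx : Summable fun n => ‖x n‖ ^ 2)
    (hy : Summable fun n => ‖y n‖ ^ 2) : Summable fun n => ‖x n‖ * ‖y n‖ :=
  Summable.of_nonneg_of_le (fun _ => by positivity)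
    (fun n => by nlinarith [sq_nonneg (‖x n‖ - ‖y n‖), sq_nonneg (‖x n‖), sq_nonneg (‖y n‖)])
    (hx.add hy)

theorem isPositive_nuclear_self (x : ℕ → H) (h : Summable fun n => ‖x n‖ * ‖x n‖) :
    (nuclear x x h : H →L[ℂ] H).IsPositive := by
  have key : ∀ v u, HasSum (fun n => ⟪v, x n⟫_ℂ * ⟪x n, u⟫_ℂ)
      ⟪v, (nuclear x x h : H →L[ℂ] H) u⟫_ℂ := fun v u => by
    simpa [inner_smul_right, mul_comm] using
      ((hasSum_nuclear x x h).mapL (ContinuousLinearMap.apply ℂ H u)).mapL (innerSL ℂ v)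
  refine ContinuousLinearMap.isPositive_iff_complex _ |>.2 fun v => ?_
  rw [← inner_conj_symm]
  have h2 := key v v
  have h3 : HasSum (fun n => ((‖⟪x n, v⟫_ℂ‖ ^ 2 : ℝ) : ℂ))
      ⟪v, (nuclear x x h : H →L[ℂ] H) v⟫_ℂ := by
    convert h2 using 2 with n
    rw [← inner_conj_symm v, ← Complex.normSq_eq_conj_mul_self, Complex.normSq_eq_norm_sq]
  have h4 := h3.summable
  rw [Complex.summable_ofReal] at h4
  rw [← h3.tsum_eq, ← Complex.ofReal_tsum]
  refine ⟨by simp, ?_⟩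
  simpa using tsum_nonneg fun n => by positivity

variable {HA HB : Type*}
  [NormedAddCommGroup HA] [InnerProductSpace ℂ HA] [CompleteSpace HA]
  [NormedAddCommGroup HB] [InnerProductSpace ℂ HB] [CompleteSpace HB]

/-- Divided by its trace ∑ ‖xₙ‖² the operator becomes a state, whose image is positive of trace one,
so `norm_trace_comp_le` applies. If the trace is zero, so is the operator. -/
theorem norm_traceMul_map_nuclear_self_le {Φ : traceClass HA →ₗ[ℂ] traceClass HB}
    (hΦ : ∀ ρ, IsState ρ → IsState (Φ ρ)) (X : HB →L[ℂ] HB) (x : ℕ → HA)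
    (h : Summable fun n => ‖x n‖ * ‖x n‖) :
    ‖traceMul X (Φ (nuclear x x h))‖ ≤ ‖X‖ * ∑' n, ‖x n‖ ^ 2 := by
  set P := nuclear x x h with hP
  set r := ∑' n, ‖x n‖ ^ 2 with hr
  have hs : Summable fun n => ‖x n‖ ^ 2 := by simpa only [sq] using h
  have htr : trace (P : HA →L[ℂ] HA) = r := by
    refine (hasSum_trace_of_nuclear h (hasSum_nuclear x x h)).unique ?_
    have := hs.hasSum.mapL Complex.ofRealCLM
    simpa [inner_self_eq_norm_sq_to_K] using this
  have hr0 : 0 ≤ r := tsum_nonneg fun _ => by positivity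
  rcases hr0.eq_or_lt with h0 | h0
  · have hx : ∀ n, x n = 0 := fun n => by
      have h1 := hs.le_tsum n fun _ _ => by positivity
      rw [← hr, ← h0] at h1
      simpa using le_antisymm h1 (by positivity)
    have : P = 0 := Subtype.ext (by simp [hP, nuclear, hx])
    simp [this, ← h0]
  · set ρ : traceClass HA := ((r⁻¹ : ℝ) : ℂ) • P with hρ
    have hstate : IsState ρ := by
      refine ⟨?_, ?_⟩
      · have := (isPositive_nuclear_self x h).smul_of_nonneg
          (c := ((r⁻¹ : ℝ) : ℂ)) (by rw [Complex.zero_le_real]; positivity)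
        simpa [hρ] using this
      · rw [← traceMul_one, hρ, map_smul, traceMul_one, htr, smul_eq_mul, ← Complex.ofReal_mul,
          inv_mul_cancel₀ h0.ne', Complex.ofReal_one]
    have hPρ : P = (r : ℂ) • ρ := by
      rw [hρ, smul_smul, ← Complex.ofReal_mul, mul_inv_cancel₀ h0.ne', Complex.ofReal_one, one_smul]
    have hb := norm_trace_comp_le (Φ ρ) (hΦ ρ hstate).1 X
    rw [(hΦ ρ hstate).2] at hb
    rw [hPρ, map_smul, map_smul, norm_smul, Complex.norm_real, Real.norm_of_nonneg hr0, mul_comm]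
    gcongr
    simpa [traceMul_apply] using hb

/-- This supplies the continuity which a channel is not assumed to have. Polarization, 4|x⟩⟨y| = ∑ c
|x + cy⟩⟨x + cy| over c ∈ {1, -1, i, -i}, reduces it to four positive operators, each with trace at
most 2 ∑ (‖xₙ‖² + ‖yₙ‖²). -/
theorem norm_traceMul_map_le {Φ : traceClass HA →ₗ[ℂ] traceClass HB}
    (hΦ : ∀ ρ, IsState ρ → IsState (Φ ρ)) (X : HB →L[ℂ] HB) {ρ : traceClass HA} {x y : ℕ → HA}
    (hx : Summable fun n => ‖x n‖ ^ 2) (hy : Summable fun n => ‖y n‖ ^ 2)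
    (hρ : HasSum (fun n => InnerProductSpace.rankOne ℂ (x n) (y n)) (ρ : HA →L[ℂ] HA)) :
    ‖traceMul X (Φ ρ)‖ ≤ 2 * ‖X‖ * ∑' n, (‖x n‖ ^ 2 + ‖y n‖ ^ 2) := by
  have hle : ∀ c : ℂ, ‖c‖ = 1 → ∀ n, ‖x n + c • y n‖ ^ 2 ≤ 2 * (‖x n‖ ^ 2 + ‖y n‖ ^ 2) := by
    intro c hc n
    have h1 := norm_add_le (x n) (c • y n)
    rw [norm_smul, hc, one_mul] at h1
    nlinarith [norm_nonneg (x n + c • y n), sq_nonneg (‖x n‖ - ‖y n‖)]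
  have hs : ∀ c : ℂ, ‖c‖ = 1 → Summable fun n => ‖x n + c • y n‖ * ‖x n + c • y n‖ :=
    fun c hc => Summable.of_nonneg_of_le (fun _ => by positivity)
      (fun n => by rw [← sq]; exact hle c hc n) ((hx.add hy).mul_left 2)
  have hI : ‖Complex.I‖ = 1 := Complex.norm_I
  have hI' : ‖-Complex.I‖ = 1 := by simp
  have h1' : ‖(1 : ℂ)‖ = 1 := by simp
  have h1'' : ‖(-1 : ℂ)‖ = 1 := by simp
  let P : (c : ℂ) → ‖c‖ = 1 → traceClass HA := fun c hc =>
    nuclear (fun n => x n + c • y n) (fun n => x n + c • y n) (hs c hc)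
  have hpol : (4 : ℂ) • ρ = P 1 h1' - P (-1) h1'' + Complex.I • P Complex.I hI
      - Complex.I • P (-Complex.I) hI' := by
    refine Subtype.ext ((hρ.const_smul (4 : ℂ)).unique ?_)
    have := (((hasSum_nuclear _ _ (hs 1 h1')).sub (hasSum_nuclear _ _ (hs _ h1''))).add
      ((hasSum_nuclear _ _ (hs _ hI)).const_smul Complex.I)).sub
      ((hasSum_nuclear _ _ (hs _ hI')).const_smul Complex.I)
    refine (congrArg (HasSum · _) (funext fun n => ?_)).mpr this
    ext v
    simp only [map_add, map_smul, map_smulₛₗ, _root_.smul_apply,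
      _root_.add_apply, _root_.sub_apply,
      InnerProductSpace.rankOne_apply, Complex.conj_I, map_neg, map_one]
    match_scalars
    · linear_combination (2 * ⟪y n, v⟫_ℂ) * Complex.I_sq
    · linear_combination (-2 * ⟪x n, v⟫_ℂ) * Complex.I_sq
  have hP : ∀ c hc, ‖traceMul X (Φ (P c hc))‖ ≤ ‖X‖ * (2 * ∑' n, (‖x n‖ ^ 2 + ‖y n‖ ^ 2)) := by
    intro c hc
    refine (norm_traceMul_map_nuclear_self_le hΦ X _ (hs c hc)).trans ?_
    gcongr
    rw [← tsum_mul_left]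
    exact Summable.tsum_le_tsum (hle c hc) (by simpa only [sq] using hs c hc)
      ((hx.add hy).mul_left 2)
  have h4 : (4 : ℂ) * traceMul X (Φ ρ) = traceMul X (Φ (P 1 h1')) - traceMul X (Φ (P (-1) h1''))
      + Complex.I * traceMul X (Φ (P Complex.I hI))
      - Complex.I * traceMul X (Φ (P (-Complex.I) hI')) := by
    have := congrArg (fun T => traceMul X (Φ T)) hpol
    simpa only [map_sub, map_add, map_smul, smul_eq_mul] using this
  have h5 : 4 * ‖traceMul X (Φ ρ)‖ ≤ 4 * (‖X‖ * (2 * ∑' n, (‖x n‖ ^ 2 + ‖y n‖ ^ 2))) := by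
    calc 4 * ‖traceMul X (Φ ρ)‖ = ‖(4 : ℂ) * traceMul X (Φ ρ)‖ := by simp
      _ ≤ ‖traceMul X (Φ (P 1 h1'))‖ + ‖traceMul X (Φ (P (-1) h1''))‖ +
          ‖Complex.I * traceMul X (Φ (P Complex.I hI))‖ +
          ‖Complex.I * traceMul X (Φ (P (-Complex.I) hI'))‖ := by
        rw [h4]
        refine (norm_sub_le _ _).trans ?_
        gcongr
        refine (norm_add_le _ _).trans ?_
        gcongr
        exact norm_sub_le _ _
      _ ≤ _ := by
        simp only [norm_mul, Complex.norm_I, one_mul]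
        linarith [hP _ h1', hP _ h1'', hP _ hI, hP _ hI']
  linarith

/-- The quadratic bound is used for unit vectors only, whence 4 = 2(1 + 1); homogeneity then yields
the product of norms needed for a bounded sesquilinear form. -/
theorem norm_traceMul_map_ketBra_le {Φ : traceClass HA →ₗ[ℂ] traceClass HB}
    (hΦ : ∀ ρ, IsState ρ → IsState (Φ ρ)) (X : HB →L[ℂ] HB) (x y : HA) :
    ‖traceMul X (Φ (ketBra x y))‖ ≤ 4 * ‖X‖ * ‖x‖ * ‖y‖ := by
  have h1 : ∀ x y : HA, ‖traceMul X (Φ (ketBra x y))‖ ≤ 2 * ‖X‖ * (‖x‖ ^ 2 + ‖y‖ ^ 2) := by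
    intro x y
    have hs : ∀ v : HA, HasSum (fun n : ℕ => ‖if n = 0 then v else 0‖ ^ 2) (‖v‖ ^ 2) := fun v => by
      convert hasSum_ite_eq 0 (‖v‖ ^ 2) using 2 with n
      by_cases h : n = 0 <;> simp [h]
    have hT : HasSum (fun n : ℕ => InnerProductSpace.rankOne ℂ (if n = 0 then x else 0)
        (if n = 0 then y else 0)) (ketBra x y : HA →L[ℂ] HA) := by
      change HasSum _ (InnerProductSpace.rankOne ℂ x y)
      convert hasSum_ite_eq 0 (InnerProductSpace.rankOne ℂ x y) using 2 with n
      by_cases h : n = 0 <;> simp [h]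
    have := norm_traceMul_map_le hΦ X (hs x).summable (hs y).summable hT
    rwa [((hs x).add (hs y)).tsum_eq] at this
  by_cases hx : x = 0
  · have : ketBra x y = 0 := Subtype.ext (by simp [ketBra, hx])
    rw [this]; simp [hx]
  by_cases hy : y = 0
  · have : ketBra x y = 0 := Subtype.ext (by simp [ketBra, hy])
    rw [this]; simp [hy]
  have hx' : (‖x‖ : ℂ) ≠ 0 := by simpa using hx
  have hy' : (‖y‖ : ℂ) ≠ 0 := by simpa using hy
  have hxy : ketBra x y = ((‖x‖ : ℂ) * ‖y‖) • ketBra ((‖x‖ : ℂ)⁻¹ • x) ((‖y‖ : ℂ)⁻¹ • y) := by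
    rw [ketBra_smul_left, ketBra_smul_right, smul_smul, smul_smul]
    have : (‖x‖ : ℂ) * ‖y‖ * (‖x‖ : ℂ)⁻¹ * (starRingEnd ℂ) (‖y‖ : ℂ)⁻¹ = 1 := by
      rw [map_inv₀, Complex.conj_ofReal]; field_simp
    rw [this, one_smul]
  rw [hxy, map_smul, map_smul, norm_smul]
  have := h1 ((‖x‖ : ℂ)⁻¹ • x) ((‖y‖ : ℂ)⁻¹ • y)
  rw [norm_smul, norm_smul, norm_inv, norm_inv, Complex.norm_real, Complex.norm_real, norm_norm,
    norm_norm, inv_mul_cancel₀ (by simpa using hx), inv_mul_cancel₀ (by simpa using hy)] at this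
  rw [norm_mul, Complex.norm_real, Complex.norm_real, norm_norm, norm_norm]
  calc ‖x‖ * ‖y‖ * _ ≤ ‖x‖ * ‖y‖ * (2 * ‖X‖ * (1 ^ 2 + 1 ^ 2)) := by gcongr
    _ = 4 * ‖X‖ * ‖x‖ * ‖y‖ := by ring

/-- The bounded sesquilinear form `(y, x) ↦ Tr Φ(|x⟩⟨y|) X`. -/
def dualForm {Φ : traceClass HA →ₗ[ℂ] traceClass HB}
    (hΦ : ∀ ρ, IsState ρ → IsState (Φ ρ)) (X : HB →L[ℂ] HB) : HA →L⋆[ℂ] HA →L[ℂ] ℂ :=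
  LinearMap.mkContinuous₂
    (LinearMap.mk₂'ₛₗ (starRingEnd ℂ) (RingHom.id ℂ) (fun y x => traceMul X (Φ (ketBra x y)))
      (fun _ _ _ => by rw [ketBra_add_right, map_add, map_add])
      (fun _ _ _ => by rw [ketBra_smul_right, map_smul, map_smul])
      (fun _ _ _ => by rw [ketBra_add_left, map_add, map_add])
      (fun _ _ _ => by rw [ketBra_smul_left, map_smul, map_smul]; rfl))
    (4 * ‖X‖) (fun y x => by
      simpa [mul_assoc, mul_comm, mul_left_comm] using norm_traceMul_map_ketBra_le hΦ X x y)

/-- `Y` represents the bounded form `dualForm`, so the trace identity holds for rank-one operators.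
It passes to a balanced nuclear series because `norm_traceMul_map_le` makes the tails negligible. -/
theorem exists_isDualValue {Φ : traceClass HA →ₗ[ℂ] traceClass HB}
    (hΦ : ∀ ρ, IsState ρ → IsState (Φ ρ)) (X : HB →L[ℂ] HB) : ∃ Y, IsDualValue Φ X Y := by
  set Y := ContinuousLinearMap.adjoint
    (InnerProductSpace.continuousLinearMapOfBilin (dualForm hΦ X)) with hY
  have hYxy : ∀ x y, traceMul X (Φ (ketBra x y)) = ⟪y, Y x⟫_ℂ := fun x y => by
    rw [hY, ContinuousLinearMap.adjoint_inner_right,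
      InnerProductSpace.continuousLinearMapOfBilin_apply]
    rfl
  refine ⟨Y, fun ρ => ?_⟩
  obtain ⟨x, y, hx, hy, hρ⟩ := exists_nuclear_summable_sq ρ
  have h1 := hasSum_trace_comp (summable_norm_mul_norm hx hy) hρ Y
  refine HasSum.unique (f := fun n => traceMul X (Φ (ketBra (x n) (y n)))) ?_
    (by simpa only [hYxy] using h1)
  have hsum := hx.add hy
  have h2 : Filter.Tendsto (fun N => traceMul X (Φ ρ) -
      ∑ n ∈ Finset.range N, traceMul X (Φ (ketBra (x n) (y n)))) Filter.atTop (nhds 0) := by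
    have hlim : Filter.Tendsto (fun N => 2 * ‖X‖ * ∑' n, (‖x (n + N)‖ ^ 2 + ‖y (n + N)‖ ^ 2))
        Filter.atTop (nhds 0) := by
      simpa only [mul_zero] using
        (tendsto_sum_nat_add fun n => ‖x n‖ ^ 2 + ‖y n‖ ^ 2).const_mul (2 * ‖X‖)
    refine squeeze_zero_norm (fun N => ?_) hlim
    -- The remainder after `N` terms is the nuclear operator of the shifted sequences.
    have h3 : HasSum (fun n => InnerProductSpace.rankOne ℂ (x (n + N)) (y (n + N)))
        ((ρ - ∑ n ∈ Finset.range N, ketBra (x n) (y n) : traceClass HA) : HA →L[ℂ] HA) := by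
      have h := (hasSum_nat_add_iff' N).2 hρ
      rwa [Submodule.coe_sub, Submodule.coe_sum]
    have := norm_traceMul_map_le hΦ X ((summable_nat_add_iff N).2 hx)
      ((summable_nat_add_iff N).2 hy) h3
    rwa [map_sub, map_sub, map_sum, map_sum] at this
  have h4 : Summable fun n => traceMul X (Φ (ketBra (x n) (y n))) := by
    simpa only [hYxy] using h1.summable
  rw [h4.hasSum_iff_tendsto_nat]
  have := (tendsto_const_nhds (x := traceMul X (Φ ρ))).sub h2
  simpa [traceMul_apply] using this

theorem IsDualValue.inner_eq {Φ : traceClass HA →ₗ[ℂ] traceClass HB} {X : HB →L[ℂ] HB}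
    {Y : HA →L[ℂ] HA} (h : IsDualValue Φ X Y) (x y : HA) :
    ⟪y, Y x⟫_ℂ = traceMul X (Φ (ketBra x y)) := by
  rw [← traceMul_ketBra]
  exact (h (ketBra x y)).symm

theorem IsDualValue.unique {Φ : traceClass HA →ₗ[ℂ] traceClass HB} {X : HB →L[ℂ] HB}
    {Y Y' : HA →L[ℂ] HA} (h : IsDualValue Φ X Y) (h' : IsDualValue Φ X Y') : Y = Y' := by
  ext x
  refine ext_inner_left ℂ fun y => ?_
  rw [h.inner_eq, h'.inner_eq]

theorem isDualValue_dual {Φ : traceClass HA →ₗ[ℂ] traceClass HB}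
    (hΦ : ∀ ρ, IsState ρ → IsState (Φ ρ)) (X : HB →L[ℂ] HB) : IsDualValue Φ X (dual Φ X) :=
  Classical.epsilon_spec (exists_isDualValue hΦ X)

end DualMap

/-! ### The symplectic form. -/

section SymplecticForm

variable {s : ℕ}

/-- The symplectic form on `Z`. -/
def symp (z z' : Z s) : ℝ := z ⬝ᵥ sympl s *ᵥ z'

theorem sympl_mulVec (z : Z s) :
    sympl s *ᵥ z = fun i => if i.1 = 0 then -z (1, i.2) else z (0, i.2) := by
  funext ⟨i, j⟩
  simp only [sympl, Matrix.mulVec, dotProduct, Fintype.sum_prod_type, Matrix.blockDiagonal_apply]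
  fin_cases i <;> simp

theorem symp_eq_sum (z z' : Z s) : symp z z' = ∑ i, z i * (sympl s *ᵥ z') i := rfl

theorem symp_add_left (x y z : Z s) : symp (x + y) z = symp x z + symp y z := add_dotProduct _ _ _

theorem symp_add_right (x y z : Z s) : symp x (y + z) = symp x y + symp x z := by
  rw [symp, Matrix.mulVec_add, dotProduct_add]; rfl

theorem symp_smul_left (t : ℝ) (x y : Z s) : symp (t • x) y = t * symp x y := smul_dotProduct _ _ _

theorem symp_smul_right (t : ℝ) (x y : Z s) : symp x (t • y) = t * symp x y := by
  rw [symp, Matrix.mulVec_smul, dotProduct_smul]; rfl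

theorem symp_neg_left (x y : Z s) : symp (-x) y = -symp x y := neg_dotProduct _ _

theorem symp_neg_right (x y : Z s) : symp x (-y) = -symp x y := by
  rw [symp, Matrix.mulVec_neg, dotProduct_neg]; rfl

theorem symp_swap (x y : Z s) : symp x y = -symp y x := by
  simp only [symp, sympl_mulVec, dotProduct, Fintype.sum_prod_type, Fin.sum_univ_two]
  simp [mul_comm]

theorem symp_self (x : Z s) : symp x x = 0 := by
  have := symp_swap x x
  linarith

theorem sum_sympl_sq (z : Z s) : ∑ i, (sympl s *ᵥ z) i ^ 2 = ∑ i, z i ^ 2 := by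
  simp only [sympl_mulVec, Fintype.sum_prod_type, Fin.sum_univ_two]
  simp [add_comm]

theorem sympl_mulVec_sympl (z : Z s) : sympl s *ᵥ (sympl s *ᵥ z) = -z := by
  rw [sympl_mulVec, sympl_mulVec]
  funext ⟨i, j⟩
  fin_cases i <;> simp

end SymplecticForm

/-! ### Gaussian integrals with a symplectic phase. -/

section Gaussian

variable {s : ℕ}

/-- The Gaussian `exp(-|z|²/4)`. -/
def gauss (z : Z s) : ℂ := Complex.exp (-(1 / 4) * ∑ i, (z i : ℂ) ^ 2)

theorem gauss_eq_ofReal (z : Z s) : gauss z = (Real.exp (-(1 / 4) * ∑ i, z i ^ 2) : ℝ) := by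
  simp [gauss]

theorem gauss_neg (z : Z s) : gauss (-z) = gauss z := by simp [gauss]

theorem gauss_zero : gauss (0 : Z s) = 1 := by simp [gauss]

@[fun_prop]
theorem continuous_gauss : Continuous (gauss : Z s → ℂ) := by
  unfold gauss
  fun_prop

theorem integrable_gauss : Integrable (gauss : Z s → ℂ) := by
  have := GaussianFourier.integrable_cexp_neg_mul_sum_add (ι := Fin 2 × Fin s)
    (b := (1 / 4 : ℂ)) (by norm_num) 0
  exact this.congr (Filter.Eventually.of_forall fun z => by simp [gauss])

/-- The normalization constant `(2π)^s`. -/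
def planck (s : ℕ) : ℂ := (2 * Real.pi : ℂ) ^ s

theorem planck_ne_zero : planck s ≠ 0 :=
  pow_ne_zero _ (by simp [Real.pi_ne_zero])

theorem planck_eq_ofReal : planck s = (((2 * Real.pi) ^ s : ℝ) : ℂ) := by simp [planck]

/-- This is the scalar kernel of P W(w) P, where P is `vacuumMap`. In z the exponent is -|z|²/2 plus
a linear term with coefficient (u - w)/2 + (i/2)Δ(w + u). After completing the square the cross term
cancels the remaining phase, and the parallelogram law separates u from w. -/
theorem integral_gauss_mul_gauss (u w : Z s) :
    ∫ z : Z s, gauss z * gauss (u - (z + w)) *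
      Complex.exp (Complex.I / 2 * (symp z w + symp (z + w) (u - (z + w)) : ℝ)) =
    planck s * (gauss w * gauss u) := by
  set d := sympl s *ᵥ (w + u) with hd
  have hd2 : ∑ i, d i ^ 2 = ∑ i, (w i + u i) ^ 2 := sum_sympl_sq (w + u)
  have hvd : ∑ i, (u i - w i) * d i = -2 * symp w u := by
    have h : ∑ i, (u i - w i) * d i = symp (u + -w) (w + u) := by
      rw [symp_eq_sum]; simp [hd, sub_eq_add_neg]
    rw [h, symp_add_right, symp_add_left, symp_add_left, symp_neg_left, symp_neg_left, symp_self,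
      symp_self, symp_swap u w]
    ring
  have hint := GaussianFourier.integral_cexp_neg_mul_sum_add (ι := Fin 2 × Fin s)
    (b := (1 / 2 : ℂ)) (by norm_num)
    (fun i => (((u i - w i) / 2 : ℝ) : ℂ) + Complex.I / 2 * (d i : ℝ))
  -- The space has dimension 2s and b = 1/2, so (π/b)^{dim/2} = (2π)^s.
  have hpi : ((Real.pi : ℂ) / (1 / 2)) ^ ((Fintype.card (Fin 2 × Fin s) : ℂ) / 2) = planck s := by
    have : ((Fintype.card (Fin 2 × Fin s) : ℂ) / 2) = s := by simp
    rw [this, Complex.cpow_natCast, planck]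
    congr 1
    ring
  rw [hpi] at hint
  have hphase : ∀ z : Z s, symp z w + symp (z + w) (u - (z + w)) = ∑ i, z i * d i + symp w u := by
    intro z
    have h1 : ∑ i, z i * d i = symp z (w + u) := rfl
    rw [h1, sub_eq_add_neg, symp_add_right, symp_neg_right, symp_self, symp_add_left,
      symp_add_right]
    ring
  have hexp : ∀ z : Z s, gauss z * gauss (u - (z + w)) *
      Complex.exp (Complex.I / 2 * (symp z w + symp (z + w) (u - (z + w)) : ℝ)) =
      Complex.exp (-(1 / 2) * ∑ i, (z i : ℂ) ^ 2 +
        ∑ i, ((((u i - w i) / 2 : ℝ) : ℂ) + Complex.I / 2 * (d i : ℝ)) * z i) *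
      Complex.exp (-(1 / 4) * ∑ i, ((u i : ℂ) - w i) ^ 2 + Complex.I / 2 * symp w u) := by
    intro z
    rw [hphase, gauss, gauss, ← Complex.exp_add, ← Complex.exp_add, ← Complex.exp_add]
    congr 1
    push_cast
    simp only [Pi.sub_apply, Pi.add_apply, Complex.ofReal_sub, Complex.ofReal_add, mul_add,
      Finset.mul_sum]
    rw [← add_assoc, ← add_assoc]
    congr 1
    simp only [← Finset.sum_add_distrib]
    refine Finset.sum_congr rfl fun i _ => ?_
    ring
  simp_rw [hexp]
  rw [integral_mul_const, hint, mul_assoc, gauss, gauss, ← Complex.exp_add, ← Complex.exp_add]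
  congr 2
  have hd2' : ∑ i, (d i : ℂ) ^ 2 = ∑ i, ((w i : ℂ) + u i) ^ 2 := by exact_mod_cast hd2
  have hvd' : ∑ i, ((u i : ℂ) - w i) * d i = -2 * symp w u := by exact_mod_cast hvd
  have h3 : ∑ i, ((((u i - w i) / 2 : ℝ) : ℂ) + Complex.I / 2 * (d i : ℝ)) ^ 2 =
      1 / 4 * ∑ i, ((u i : ℂ) - w i) ^ 2 - 1 / 4 * ∑ i, ((w i : ℂ) + u i) ^ 2
        - Complex.I * symp w u := by
    have : Complex.I * symp w u = -(Complex.I / 2) * ∑ i, ((u i : ℂ) - w i) * d i := by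
      rw [hvd']; ring
    rw [this, ← hd2']
    simp only [Finset.mul_sum, ← Finset.sum_sub_distrib]
    refine Finset.sum_congr rfl fun i _ => ?_
    push_cast
    linear_combination (1 / 4 * (d i : ℂ) ^ 2) * Complex.I_sq
  have h4 : ∑ i, ((u i : ℂ) - w i) ^ 2 + ∑ i, ((w i : ℂ) + u i) ^ 2 =
      2 * ∑ i, (w i : ℂ) ^ 2 + 2 * ∑ i, (u i : ℂ) ^ 2 := by
    simp only [Finset.mul_sum, ← Finset.sum_add_distrib]
    refine Finset.sum_congr rfl fun i _ => ?_
    ring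
  rw [h3]
  linear_combination (-(1 / 8) : ℂ) * h4

end Gaussian

/-! ### Weyl systems and the vacuum vector. -/

namespace WeylSystem

variable {s : ℕ} {H : Type*} [NormedAddCommGroup H] [InnerProductSpace ℂ H] [CompleteSpace H]
  (W : WeylSystem s H)

theorem apply_apply (z z' : Z s) (x : H) :
    W.W z (W.W z' x) = Complex.exp (Complex.I / 2 * (symp z z' : ℝ)) • W.W (z + z') x := by
  have := congrArg (fun T => T x) (W.ccr z z')
  simpa [symp] using this

theorem adjoint_apply_apply (z : Z s) (x : H) :
    ContinuousLinearMap.adjoint (W.W z) (W.W z x) = x := by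
  have := congrArg (fun T => T x) (Unitary.mem_iff.1 (W.mem_unitary z)).1
  simpa [ContinuousLinearMap.star_eq_adjoint] using this

theorem inner_map_map (z : Z s) (x y : H) : ⟪W.W z x, W.W z y⟫_ℂ = ⟪x, y⟫_ℂ := by
  rw [← ContinuousLinearMap.adjoint_inner_right, W.adjoint_apply_apply]

theorem norm_map (z : Z s) (x : H) : ‖W.W z x‖ = ‖x‖ := by
  rw [norm_eq_sqrt_re_inner (𝕜 := ℂ), norm_eq_sqrt_re_inner (𝕜 := ℂ), inner_map_map]

/-- By the CCR `W 0` is idempotent, and an isometric idempotent is the identity. -/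
theorem zero_apply (x : H) : W.W 0 x = x := by
  have h := W.apply_apply 0 0 x
  rw [symp_self] at h
  have h2 : W.W 0 (W.W 0 x - x) = 0 := by simp [h]
  have h3 := W.norm_map 0 (W.W 0 x - x)
  rw [h2, norm_zero] at h3
  exact sub_eq_zero.1 (norm_eq_zero.1 h3.symm)

theorem neg_apply_apply (z : Z s) (x : H) : W.W (-z) (W.W z x) = x := by
  rw [apply_apply, symp_neg_left, symp_self, neg_add_cancel, zero_apply]
  simp

theorem apply_neg_apply (z : Z s) (x : H) : W.W z (W.W (-z) x) = x := by
  simpa using W.neg_apply_apply (-z) x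

theorem inner_apply_left (z : Z s) (x y : H) : ⟪W.W z x, y⟫_ℂ = ⟪x, W.W (-z) y⟫_ℂ := by
  rw [← W.inner_map_map z x, apply_neg_apply]

theorem inner_apply_right (z : Z s) (x y : H) : ⟪x, W.W z y⟫_ℂ = ⟪W.W (-z) x, y⟫_ℂ := by
  rw [inner_apply_left, neg_neg]

theorem apply_comm (z z' : Z s) (x : H) :
    W.W z (W.W z' x) = Complex.exp (Complex.I * (symp z z' : ℝ)) • W.W z' (W.W z x) := by
  rw [apply_apply, apply_apply, smul_smul, ← Complex.exp_add, add_comm z' z, symp_swap z' z]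
  congr 2
  push_cast
  ring

theorem norm_inner_le (z : Z s) (x y : H) : ‖⟪x, W.W z y⟫_ℂ‖ ≤ ‖x‖ * ‖y‖ := by
  simpa [norm_map] using norm_inner_le_norm (𝕜 := ℂ) x (W.W z y)

@[fun_prop]
theorem continuous_inner (x y : H) : Continuous fun z => ⟪x, W.W z y⟫_ℂ :=
  continuous_const.inner (W.continuous y)

theorem integrable_gauss_inner (x y : H) : Integrable fun z => gauss z * ⟪x, W.W z y⟫_ℂ := by
  refine integrable_gauss.mul_bdd (c := ‖x‖ * ‖y‖) (W.continuous_inner x y).aestronglyMeasurable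
    (Filter.Eventually.of_forall fun z => W.norm_inner_le z x y)

theorem integrable_gauss_smul (y : H) : Integrable fun z => gauss z • W.W z y := by
  refine (integrable_gauss.norm.mul_const ‖y‖).mono'
    (continuous_gauss.smul (W.continuous y)).aestronglyMeasurable
    (Filter.Eventually.of_forall fun z => ?_)
  rw [norm_smul, norm_map]

/-- The operator `∫ exp(-|z|²/4) W(z) dz`, which is a multiple of the projection to the vacuum. -/
def vacuumMap (y : H) : H := ∫ z, gauss z • W.W z y

theorem inner_vacuumMap (x y : H) :
    ⟪x, W.vacuumMap y⟫_ℂ = ∫ z, gauss z * ⟪x, W.W z y⟫_ℂ := by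
  rw [vacuumMap, ← integral_inner (W.integrable_gauss_smul y)]
  simp_rw [inner_smul_right]

/-- The Gaussian is real and even and W(z)* = W(-z), so conjugation amounts to z ↦ -z. -/
theorem inner_vacuumMap_left (x y : H) : ⟪W.vacuumMap x, y⟫_ℂ = ⟪x, W.vacuumMap y⟫_ℂ := by
  rw [← inner_conj_symm, inner_vacuumMap, inner_vacuumMap, ← integral_conj,
    ← integral_neg_eq_self]
  refine integral_congr_ae (Filter.Eventually.of_forall fun z => ?_)
  simp only [map_mul, inner_conj_symm, gauss_neg]
  rw [inner_apply_left, neg_neg, gauss_eq_ofReal, Complex.conj_ofReal]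

/-- Symmetry alone forces linearity: the map is moved to the other side of the inner product. -/
theorem vacuumMap_sub (x y : H) : W.vacuumMap (x - y) = W.vacuumMap x - W.vacuumMap y := by
  refine ext_inner_left ℂ fun v => ?_
  rw [inner_sub_right, ← inner_vacuumMap_left, ← inner_vacuumMap_left, ← inner_vacuumMap_left,
    inner_sub_right]

theorem vacuumMap_smul (c : ℂ) (x : H) : W.vacuumMap (c • x) = c • W.vacuumMap x := by
  refine ext_inner_left ℂ fun v => ?_
  rw [inner_smul_right, ← inner_vacuumMap_left, ← inner_vacuumMap_left, inner_smul_right]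

end WeylSystem

namespace WeylSystem

variable {s : ℕ} {H : Type*} [NormedAddCommGroup H] [InnerProductSpace ℂ H] [CompleteSpace H]
  (W : WeylSystem s H)

/-- The relation P W(w) P = (2π)^s gauss(w) P in weak form. The three Weyl operators merge into one
W(u) by the CCR and a translation; Fubini then leaves the z-integral of `integral_gauss_mul_gauss`.
-/
theorem inner_vacuumMap_apply_vacuumMap (x y : H) (w : Z s) :
    ⟪x, W.vacuumMap (W.W w (W.vacuumMap y))⟫_ℂ = planck s * gauss w * ⟪x, W.vacuumMap y⟫_ℂ := by
  set K : Z s → Z s → ℂ := fun z u => gauss z * gauss (u - (z + w)) *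
    Complex.exp (Complex.I / 2 * (symp z w + symp (z + w) (u - (z + w)) : ℝ)) with hK
  have hsymp : Continuous fun p : Z s × Z s => symp p.1 w + symp (p.1 + w) (p.2 - (p.1 + w)) := by
    unfold symp
    fun_prop
  have hKc : Continuous fun p : Z s × Z s => K p.1 p.2 := by
    simp only [hK]
    fun_prop
  have hKn : ∀ z u, ‖K z u‖ = ‖gauss z‖ * ‖gauss (u - (z + w))‖ := by
    intro z u
    have : Complex.I / 2 * ((symp z w + symp (z + w) (u - (z + w)) : ℝ) : ℂ) =
        (((symp z w + symp (z + w) (u - (z + w))) / 2 : ℝ) : ℂ) * Complex.I := by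
      push_cast; ring
    rw [hK]
    simp only
    rw [norm_mul, norm_mul, this, Complex.norm_exp_ofReal_mul_I, mul_one]
  -- For fixed z the modulus is a translated Gaussian in u times a Gaussian in z.
  have hKint : Integrable (fun p : Z s × Z s => K p.1 p.2) (volume.prod volume) := by
    rw [integrable_prod_iff hKc.aestronglyMeasurable]
    refine ⟨Filter.Eventually.of_forall fun z => ?_, ?_⟩
    · refine Integrable.mono' ((integrable_gauss.comp_sub_right (z + w)).norm.const_mul ‖gauss z‖)
        (hKc.comp (by fun_prop : Continuous fun u => (z, u))).aestronglyMeasurable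
        (Filter.Eventually.of_forall fun u => (hKn z u).le)
    · simp_rw [hKn, integral_const_mul]
      refine (integrable_gauss.norm.mul_const (∫ u : Z s, ‖gauss u‖)).congr
        (Filter.Eventually.of_forall fun z => ?_)
      simp only
      rw [integral_sub_right_eq_self (fun u : Z s => ‖gauss u‖) (z + w)]
  have hF : Integrable (fun p : Z s × Z s => K p.1 p.2 * ⟪x, W.W p.2 y⟫_ℂ)
      (volume.prod volume) :=
    hKint.mul_bdd (c := ‖x‖ * ‖y‖)
      ((W.continuous_inner x y).comp continuous_snd).aestronglyMeasurable
      (Filter.Eventually.of_forall fun p => W.norm_inner_le p.2 x y)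
  have h1 : ∀ z, gauss z * ⟪x, W.W z (W.W w (W.vacuumMap y))⟫_ℂ =
      ∫ u, K z u * ⟪x, W.W u y⟫_ℂ := by
    intro z
    rw [inner_apply_right, inner_apply_right, inner_vacuumMap, ← integral_const_mul,
      ← integral_sub_right_eq_self _ (z + w)]
    refine integral_congr_ae (Filter.Eventually.of_forall fun u => ?_)
    simp only [hK]
    rw [← inner_apply_right, ← inner_apply_right, apply_apply, apply_apply, smul_smul, inner_smul_right,
      ← Complex.exp_add, add_sub_cancel]
    push_cast
    ring_nf
  rw [inner_vacuumMap]
  simp_rw [h1]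
  rw [integral_integral_swap hF, inner_vacuumMap, ← integral_const_mul]
  refine integral_congr_ae (Filter.Eventually.of_forall fun u => ?_)
  simp only
  rw [integral_mul_const, integral_gauss_mul_gauss]
  ring

theorem vacuumMap_apply_vacuumMap (y : H) (w : Z s) :
    W.vacuumMap (W.W w (W.vacuumMap y)) = (planck s * gauss w) • W.vacuumMap y :=
  ext_inner_left ℂ fun x => by rw [inner_vacuumMap_apply_vacuumMap, inner_smul_right]

/-- Evaluating P at W(w)x multiplies the integrand by the character exp(iΔ(z, w)). So if P = 0, the
Fourier transform of gauss(z)⟨x, W(z)x⟩ vanishes identically, hence so does this function, and its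
value at z = 0 is ‖x‖². -/
theorem eq_zero_of_vacuumMap_eq_zero (h : ∀ x, W.vacuumMap x = 0) (x : H) : x = 0 := by
  set f : Z s → ℂ := fun z => gauss z * ⟪x, W.W z x⟫_ℂ with hf
  have hfc : Continuous f := by simp only [hf]; fun_prop
  have h0 : ∀ w, ∫ z, Complex.exp (Complex.I * (symp z w : ℝ)) * f z = 0 := by
    intro w
    have h1 : ⟪W.W w x, W.vacuumMap (W.W w x)⟫_ℂ = 0 := by rw [h, inner_zero_right]
    rw [inner_vacuumMap] at h1
    rw [← h1]
    refine integral_congr_ae (Filter.Eventually.of_forall fun z => ?_)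
    simp only [hf]
    rw [apply_comm, inner_smul_right, inner_map_map]
    ring
  -- `Z s` carries the sup norm; Fourier inversion takes place on the Euclidean space with the same
  -- volume.
  let F : EuclideanSpace ℝ (Fin 2 × Fin s) → ℂ := fun v => f (WithLp.ofLp v)
  have hmp := PiLp.volume_preserving_ofLp (Fin 2 × Fin s)
  have hemb : MeasurableEmbedding
      (WithLp.ofLp : EuclideanSpace ℝ (Fin 2 × Fin s) → Fin 2 × Fin s → ℝ) :=
    (MeasurableEquiv.toLp 2 (Fin 2 × Fin s → ℝ)).symm.measurableEmbedding
  have hFc : Continuous F := hfc.comp (PiLp.continuous_ofLp 2 _)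
  have hFi : Integrable F := (hmp.integrable_comp_emb hemb).2 (W.integrable_gauss_inner x x)
  have hFF : FourierTransform.fourier F = 0 := by
    funext ξ
    rw [Real.fourier_eq']
    -- Since Δ² = -1, this w turns the symplectic character into the Fourier character of ξ.
    set w : Z s := sympl s *ᵥ ((2 * Real.pi) • WithLp.ofLp ξ) with hw
    have h2 := h0 w
    rw [← hmp.integral_comp hemb] at h2
    rw [Pi.zero_apply, ← h2]
    refine integral_congr_ae (Filter.Eventually.of_forall fun v => ?_)
    simp only [smul_eq_mul, F]
    congr 2
    have : symp (WithLp.ofLp v) w = -2 * Real.pi * ⟪v, ξ⟫_ℝ := by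
      rw [symp, hw, sympl_mulVec_sympl, dotProduct_neg, dotProduct_smul]
      simp [PiLp.inner_apply, dotProduct, mul_comm]
    rw [this]
    push_cast
    ring
  have hinv := hFc.fourierInv_fourier_eq hFi (by rw [hFF]; exact integrable_zero _ _ _)
  rw [hFF] at hinv
  have h3 : F 0 = 0 := by
    rw [← hinv, Real.fourierInv_eq']
    simp
  have h4 : F 0 = ⟪x, x⟫_ℂ := by
    simp only [F, hf]
    rw [WithLp.ofLp_zero, gauss_zero, zero_apply, one_mul]
  rwa [h4, inner_self_eq_zero] at h3

/-- A vector orthogonal to the orbit of a nonzero vector vanishes. -/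
theorem eq_zero_of_inner_orbit {Ω x : H} (hΩ : Ω ≠ 0) (h : ∀ w, ⟪x, W.W w Ω⟫_ℂ = 0) : x = 0 := by
  -- The orthogonal complement of the orbit of `x` is closed and invariant. It cannot be zero, as it
  -- contains `Ω`; if it is everything, then x ⊥ x.
  let V : Submodule ℂ H := ⨅ w, LinearMap.ker (innerSL ℂ (W.W w x)).toLinearMap
  have hV : ∀ ψ, ψ ∈ V ↔ ∀ w, ⟪W.W w x, ψ⟫_ℂ = 0 := fun ψ => by
    simp [V, Submodule.mem_iInf]
  have hVc : IsClosed (V : Set H) := by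
    have : (V : Set H) = ⋂ w, {ψ | ⟪W.W w x, ψ⟫_ℂ = 0} := by
      ext ψ; simp [hV]
    rw [this]
    exact isClosed_iInter fun w => isClosed_eq (by fun_prop) continuous_const
  rcases W.irreducible V hVc (fun z ψ hψ => (hV _).2 fun w => by
    rw [inner_apply_right, apply_apply, inner_smul_left, (hV ψ).1 hψ, mul_zero]) with h1 | h1
  · refine absurd ((hV Ω).2 fun w => ?_) (by rw [h1]; simpa using hΩ)
    rw [inner_apply_left, h]
  · have : x ∈ V := by rw [h1]; trivial
    simpa [zero_apply] using (hV x).1 this 0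

theorem dense_span_orbit {Ω : H} (hΩ : Ω ≠ 0) :
    Dense (Submodule.span ℂ (Set.range fun w => W.W w Ω) : Set H) := by
  rw [Submodule.dense_iff_topologicalClosure_eq_top, Submodule.topologicalClosure_eq_top_iff,
    Submodule.eq_bot_iff]
  intro x hx
  refine W.eq_zero_of_inner_orbit hΩ fun w => ?_
  exact (Submodule.mem_orthogonal' _ x).1 hx _ (Submodule.subset_span ⟨w, rfl⟩)

/-- A suitable multiple of P is a projection. If ψ lies in its range and ψ ⊥ Ω, where Ω is a unit
vector of the range, then ⟨ψ, W(w)Ω⟩ is proportional to ⟨ψ, P W(w) P Ω⟩, hence to ⟨ψ, Ω⟩ = 0. So ψ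
is orthogonal to the orbit of Ω and vanishes: the range is a line. -/
theorem exists_vacuum : ∃ Ω : H, ‖Ω‖ = 1 ∧ ∀ x, W.vacuumMap x = (planck s * ⟪Ω, x⟫_ℂ) • Ω := by
  obtain ⟨x₀, hx₀⟩ : ∃ x, W.vacuumMap x ≠ 0 := by
    by_contra! h
    have := W.nontrivial
    obtain ⟨x, hx⟩ := exists_ne (0 : H)
    exact hx (W.eq_zero_of_vacuumMap_eq_zero h x)
  have hp := planck_ne_zero (s := s)
  set y := W.vacuumMap x₀ with hy
  have hfix : ∀ v, W.vacuumMap (W.vacuumMap v) = planck s • W.vacuumMap v := fun v => by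
    have := W.vacuumMap_apply_vacuumMap v 0
    rwa [zero_apply, gauss_zero, mul_one] at this
  set Ω : H := ((‖y‖ : ℂ)⁻¹) • y with hΩ
  have hΩn : ‖Ω‖ = 1 := by
    rw [hΩ, norm_smul, norm_inv, Complex.norm_real, norm_norm,
      inv_mul_cancel₀ (norm_ne_zero_iff.2 hx₀)]
  have hΩ0 : Ω ≠ 0 := by rw [← norm_ne_zero_iff, hΩn]; exact one_ne_zero
  have hΩfix : W.vacuumMap Ω = planck s • Ω := by
    rw [hΩ, vacuumMap_smul, hy, hfix, smul_comm]
  refine ⟨Ω, hΩn, fun x => ?_⟩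
  set ψ := W.vacuumMap x - (planck s * ⟪Ω, x⟫_ℂ) • Ω with hψ
  have hψfix : W.vacuumMap ψ = planck s • ψ := by
    rw [hψ, vacuumMap_sub, vacuumMap_smul, hfix, hΩfix, smul_sub, smul_comm]
  have hψΩ : ⟪ψ, Ω⟫_ℂ = 0 := by
    have hc : (starRingEnd ℂ) (planck s) = planck s := by
      rw [planck_eq_ofReal, Complex.conj_ofReal]
    rw [hψ, inner_sub_left, inner_vacuumMap_left, hΩfix, inner_smul_left, inner_smul_right, map_mul,
      inner_conj_symm, inner_self_eq_norm_sq_to_K, hΩn, hc]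
    simp
  have : ψ = 0 := by
    refine W.eq_zero_of_inner_orbit hΩ0 fun w => ?_
    have h1 : ⟪W.vacuumMap ψ, W.W w (W.vacuumMap Ω)⟫_ℂ = 0 := by
      rw [inner_vacuumMap_left, vacuumMap_apply_vacuumMap, inner_smul_right, hΩfix,
        inner_smul_right, hψΩ, mul_zero, mul_zero]
    rw [hψfix, hΩfix, map_smul, inner_smul_left, inner_smul_right] at h1
    simpa [hp] using h1
  exact sub_eq_zero.1 this

end WeylSystem

/-! ### Schur orthogonality. -/

namespace WeylSystem

variable {s : ℕ} {H : Type*} [NormedAddCommGroup H] [InnerProductSpace ℂ H] [CompleteSpace H]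
  (W : WeylSystem s H)

/-- Vacuum vectors. -/
def IsVacuum (Ω : H) : Prop := ‖Ω‖ = 1 ∧ ∀ x, W.vacuumMap x = (planck s * ⟪Ω, x⟫_ℂ) • Ω

variable {W}

theorem IsVacuum.ne_zero {Ω : H} (hΩ : W.IsVacuum Ω) : Ω ≠ 0 := by
  rw [← norm_ne_zero_iff, hΩ.1]; exact one_ne_zero

theorem IsVacuum.inner_self {Ω : H} (hΩ : W.IsVacuum Ω) : ⟪Ω, Ω⟫_ℂ = 1 := by
  rw [inner_self_eq_norm_sq_to_K, hΩ.1]; simp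

theorem IsVacuum.vacuumMap_self {Ω : H} (hΩ : W.IsVacuum Ω) : W.vacuumMap Ω = planck s • Ω := by
  rw [hΩ.2, hΩ.inner_self, mul_one]

/-- Sandwiching W(w) between two copies of P, each acting on Ω as (2π)^s, and cancelling. -/
theorem IsVacuum.inner_apply {Ω : H} (hΩ : W.IsVacuum Ω) (w : Z s) :
    ⟪Ω, W.W w Ω⟫_ℂ = gauss w := by
  have h := W.inner_vacuumMap_apply_vacuumMap Ω Ω w
  rw [← inner_vacuumMap_left, hΩ.vacuumMap_self, inner_smul_right, hΩ.inner_self, map_smul,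
    inner_smul_right, inner_smul_left, planck_eq_ofReal, Complex.conj_ofReal,
    ← planck_eq_ofReal] at h
  have hp := planck_ne_zero (s := s)
  field_simp at h
  exact h

/-- The coherent matrix element is a phase times gauss(z + u - v). After a translation and a
reflection the integral becomes ⟨W(-u)φ, P W(-v)φ'⟩, which factors since P has rank one. -/
theorem IsVacuum.inner_coherent {Ω : H} (hΩ : W.IsVacuum Ω) (u v : Z s) (φ φ' : H) :
    Integrable (fun z => ⟪φ, W.W (-z) φ'⟫_ℂ * ⟪W.W v Ω, W.W z (W.W u Ω)⟫_ℂ) ∧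
    ∫ z, ⟪φ, W.W (-z) φ'⟫_ℂ * ⟪W.W v Ω, W.W z (W.W u Ω)⟫_ℂ =
      planck s * (⟪φ, W.W u Ω⟫_ℂ * ⟪W.W v Ω, φ'⟫_ℂ) := by
  set f : Z s → ℂ := fun z => gauss z * ⟪W.W (-u) φ, W.W z (W.W (-v) φ')⟫_ℂ with hf
  have hfi : Integrable f := W.integrable_gauss_inner _ _
  have hpt : ∀ z, ⟪φ, W.W (-z) φ'⟫_ℂ * ⟪W.W v Ω, W.W z (W.W u Ω)⟫_ℂ = f (-(z + (u - v))) := by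
    intro z
    simp only [hf]
    rw [← inner_apply_right, apply_apply, apply_apply, inner_smul_right, inner_apply_left,
      apply_apply, inner_smul_right, hΩ.inner_apply, inner_smul_right, apply_apply,
      inner_smul_right, gauss_neg]
    have e1 : u + -(z + (u - v)) + -v = -z := by abel
    have e2 : -v + (z + u) = z + (u - v) := by abel
    have e3 : Complex.exp (Complex.I / 2 * (symp z u : ℝ)) *
        Complex.exp (Complex.I / 2 * (symp (-v) (z + u) : ℝ)) =
        Complex.exp (Complex.I / 2 * (symp u (-(z + (u - v))) : ℝ)) *
        Complex.exp (Complex.I / 2 * (symp (u + -(z + (u - v))) (-v) : ℝ)) := by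
      rw [← Complex.exp_add, ← Complex.exp_add, ← mul_add, ← mul_add, ← Complex.ofReal_add,
        ← Complex.ofReal_add]
      congr 3
      simp only [sub_eq_add_neg, symp_add_left, symp_add_right, symp_neg_left, symp_neg_right,
        symp_self]
      rw [symp_swap v z, symp_swap v u, symp_swap u z]
      ring
    rw [e1, e2]
    linear_combination (⟪φ, W.W (-z) φ'⟫_ℂ * gauss (z + (u - v))) * e3
  simp_rw [hpt]
  refine ⟨(hfi.comp_neg).comp_add_right (u - v), ?_⟩
  rw [integral_add_right_eq_self (fun z => f (-z)), integral_neg_eq_self, hf, ← inner_vacuumMap,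
    hΩ.2, inner_smul_right, ← inner_apply_right, W.inner_apply_left v]
  ring

/-- The orthogonality relation for the vectors `a`, `b`. -/
def Orthogonality (W : WeylSystem s H) (a b : H) : Prop :=
  ∀ φ φ', Integrable (fun z => ⟪φ, W.W (-z) φ'⟫_ℂ * ⟪b, W.W z a⟫_ℂ) ∧
    ∫ z, ⟪φ, W.W (-z) φ'⟫_ℂ * ⟪b, W.W z a⟫_ℂ = planck s * (⟪φ, a⟫_ℂ * ⟪b, φ'⟫_ℂ)

theorem IsVacuum.orthogonality_span {Ω : H} (hΩ : W.IsVacuum Ω) {a b : H}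
    (ha : a ∈ Submodule.span ℂ (Set.range fun w => W.W w Ω))
    (hb : b ∈ Submodule.span ℂ (Set.range fun w => W.W w Ω)) : W.Orthogonality a b := by
  induction ha, hb using Submodule.span_induction₂ with
  | mem_mem a b ha hb =>
    obtain ⟨u, rfl⟩ := ha
    obtain ⟨v, rfl⟩ := hb
    exact fun φ φ' => hΩ.inner_coherent u v φ φ'
  | zero_left b hb => exact fun φ φ' => by simp
  | zero_right a ha => exact fun φ φ' => by simp
  | add_left a a' b _ _ _ h h' =>
    intro φ φ'
    simp only [map_add, inner_add_right, mul_add, add_mul]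
    refine ⟨(h φ φ').1.add (h' φ φ').1, ?_⟩
    rw [integral_add (h φ φ').1 (h' φ φ').1, (h φ φ').2, (h' φ φ').2]
  | add_right a b b' _ _ _ h h' =>
    intro φ φ'
    simp only [inner_add_left, mul_add]
    refine ⟨(h φ φ').1.add (h' φ φ').1, ?_⟩
    rw [integral_add (h φ φ').1 (h' φ φ').1, (h φ φ').2, (h' φ φ').2]
  | smul_left r a b _ _ h =>
    intro φ φ'
    simp only [map_smul, inner_smul_right, mul_left_comm _ r, mul_assoc r]
    refine ⟨(h φ φ').1.const_mul r, ?_⟩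
    rw [integral_const_mul, (h φ φ').2]
  | smul_right r a b _ _ h =>
    intro φ φ'
    simp only [inner_smul_left, mul_left_comm _ ((starRingEnd ℂ) r)]
    refine ⟨(h φ φ').1.const_mul _, ?_⟩
    rw [integral_const_mul, (h φ φ').2]

/-- The choice φ = a, φ' = b turns the integrand into |⟨b, W(z)a⟩|². -/
theorem Orthogonality.lintegral_enorm_sq {a b : H} (h : W.Orthogonality a b) :
    ∫⁻ z, ‖⟪b, W.W z a⟫_ℂ‖ₑ ^ 2 = ENNReal.ofReal ((2 * Real.pi) ^ s * (‖a‖ ^ 2 * ‖b‖ ^ 2)) := by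
  obtain ⟨h1, h2⟩ := h a b
  have h3 : ∀ z, ⟪a, W.W (-z) b⟫_ℂ * ⟪b, W.W z a⟫_ℂ = ((‖⟪b, W.W z a⟫_ℂ‖ ^ 2 : ℝ) : ℂ) := by
    intro z
    rw [← inner_apply_left, ← inner_conj_symm, ← Complex.normSq_eq_conj_mul_self,
      Complex.normSq_eq_norm_sq]
  simp_rw [h3] at h1 h2
  have h1' : Integrable fun z => ‖⟪b, W.W z a⟫_ℂ‖ ^ 2 := by
    simpa only [RCLike.re_to_complex, Complex.ofReal_re] using h1.re
  have h4 : ∫ z, ‖⟪b, W.W z a⟫_ℂ‖ ^ 2 = (2 * Real.pi) ^ s * (‖a‖ ^ 2 * ‖b‖ ^ 2) := by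
    rw [integral_complex_ofReal, planck_eq_ofReal, inner_self_eq_norm_sq_to_K,
      inner_self_eq_norm_sq_to_K] at h2
    refine Complex.ofReal_injective (h2.trans ?_)
    push_cast
    rfl
  rw [← h4, ofReal_integral_eq_lintegral_ofReal h1' (Filter.Eventually.of_forall fun _ => by positivity)]
  simp only [ENNReal.ofReal_pow (norm_nonneg _), ofReal_norm]

variable (W)

/-- Fatou along approximations from the coherent span, where equality is known. The inequality is
enough to make the orthogonality integral converge and depend continuously on the vectors. -/
theorem lintegral_enorm_sq_le (a b : H) :
    ∫⁻ z, ‖⟪b, W.W z a⟫_ℂ‖ₑ ^ 2 ≤ ENNReal.ofReal ((2 * Real.pi) ^ s * (‖a‖ ^ 2 * ‖b‖ ^ 2)) := by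
  obtain ⟨Ω, hΩ⟩ := W.exists_vacuum
  have hd := W.dense_span_orbit (IsVacuum.ne_zero (W := W) hΩ)
  obtain ⟨a', ha', hal⟩ := mem_closure_iff_seq_limit.1 (hd a)
  obtain ⟨b', hb', hbl⟩ := mem_closure_iff_seq_limit.1 (hd b)
  have hpt : ∀ z, Filter.Tendsto (fun n => ‖⟪b' n, W.W z (a' n)⟫_ℂ‖ₑ ^ 2) Filter.atTop
      (nhds (‖⟪b, W.W z a⟫_ℂ‖ₑ ^ 2)) := fun z => by
    have h1 := hbl.inner (((W.W z).continuous.tendsto a).comp hal) (𝕜 := ℂ)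
    exact ((ENNReal.continuous_pow 2).tendsto _).comp ((continuous_enorm.tendsto _).comp h1)
  have hlim : Filter.Tendsto (fun n => ENNReal.ofReal ((2 * Real.pi) ^ s * (‖a' n‖ ^ 2 * ‖b' n‖ ^ 2)))
      Filter.atTop (nhds (ENNReal.ofReal ((2 * Real.pi) ^ s * (‖a‖ ^ 2 * ‖b‖ ^ 2)))) :=
    (ENNReal.continuous_ofReal.tendsto _).comp
      (((hal.norm.pow 2).mul (hbl.norm.pow 2)).const_mul _)
  calc ∫⁻ z, ‖⟪b, W.W z a⟫_ℂ‖ₑ ^ 2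
      = ∫⁻ z, Filter.liminf (fun n => ‖⟪b' n, W.W z (a' n)⟫_ℂ‖ₑ ^ 2) Filter.atTop :=
        lintegral_congr fun z => (hpt z).liminf_eq.symm
    _ ≤ Filter.liminf (fun n => ∫⁻ z, ‖⟪b' n, W.W z (a' n)⟫_ℂ‖ₑ ^ 2) Filter.atTop :=
        lintegral_liminf_le fun n => (W.continuous_inner _ _).enorm.measurable.pow_const 2
    _ = ENNReal.ofReal ((2 * Real.pi) ^ s * (‖a‖ ^ 2 * ‖b‖ ^ 2)) := by
        rw [← hlim.liminf_eq]
        congr 1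
        funext n
        exact (IsVacuum.orthogonality_span (W := W) hΩ (ha' n) (hb' n)).lintegral_enorm_sq

theorem lintegral_enorm_mul_le (a b φ φ' : H) :
    ∫⁻ z, ‖⟪φ, W.W (-z) φ'⟫_ℂ * ⟪b, W.W z a⟫_ℂ‖ₑ ≤
      ENNReal.ofReal ((2 * Real.pi) ^ s * (‖φ‖ * ‖φ'‖ * (‖a‖ * ‖b‖))) := by
  have hrw : ∀ z, ‖⟪φ, W.W (-z) φ'⟫_ℂ * ⟪b, W.W z a⟫_ℂ‖ₑ =
      ‖⟪φ', W.W z φ⟫_ℂ‖ₑ * ‖⟪b, W.W z a⟫_ℂ‖ₑ := fun z => by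
    rw [enorm_mul, ← inner_apply_left, ← inner_conj_symm, RCLike.enorm_conj]
  simp_rw [hrw]
  have hc : ∀ x y : H, AEMeasurable fun z => ‖⟪x, W.W z y⟫_ℂ‖ₑ := fun x y =>
    (W.continuous_inner x y).enorm.measurable.aemeasurable
  refine (ENNReal.lintegral_mul_le_Lp_mul_Lq volume Real.HolderConjugate.two_two (hc _ _)
    (hc _ _)).trans ?_
  have hb : ∀ x y : H, (∫⁻ z, ‖⟪x, W.W z y⟫_ℂ‖ₑ ^ (2 : ℝ)) ^ (1 / (2 : ℝ)) ≤
      ENNReal.ofReal (√((2 * Real.pi) ^ s) * (‖y‖ * ‖x‖)) := fun x y => by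
    have h1 := W.lintegral_enorm_sq_le y x
    have h2 : (2 * Real.pi) ^ s * (‖y‖ ^ 2 * ‖x‖ ^ 2) = (√((2 * Real.pi) ^ s) * (‖y‖ * ‖x‖)) ^ 2 := by
      rw [mul_pow √_, mul_pow ‖y‖, Real.sq_sqrt (by positivity)]
    rw [h2, ENNReal.ofReal_pow (by positivity)] at h1
    rw [one_div, ENNReal.rpow_inv_le_iff (by norm_num)]
    simpa using h1
  refine (mul_le_mul' (hb _ _) (hb _ _)).trans_eq ?_
  rw [← ENNReal.ofReal_mul (by positivity)]
  congr 1
  have := Real.mul_self_sqrt (show 0 ≤ (2 * Real.pi) ^ s by positivity)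
  linear_combination (‖φ‖ * ‖φ'‖ * (‖a‖ * ‖b‖)) * this

theorem integrable_inner_mul_inner (a b φ φ' : H) :
    Integrable fun z => ⟪φ, W.W (-z) φ'⟫_ℂ * ⟪b, W.W z a⟫_ℂ := by
  refine ⟨(((W.continuous_inner φ φ').comp continuous_neg).mul
    (W.continuous_inner b a)).aestronglyMeasurable, ?_⟩
  exact (W.lintegral_enorm_mul_le a b φ φ').trans_lt ENNReal.ofReal_lt_top

theorem integral_norm_inner_mul_inner_le (a b φ φ' : H) :
    ∫ z, ‖⟪φ, W.W (-z) φ'⟫_ℂ * ⟪b, W.W z a⟫_ℂ‖ ≤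
      (2 * Real.pi) ^ s * (‖φ‖ * ‖φ'‖ * (‖a‖ * ‖b‖)) := by
  rw [integral_norm_eq_lintegral_enorm (W.integrable_inner_mul_inner a b φ φ').1]
  exact ENNReal.toReal_le_of_le_ofReal (by positivity) (W.lintegral_enorm_mul_le a b φ φ')

/-- The integral in the orthogonality relation as a bounded sesquilinear form. -/
def coefficientForm (φ φ' : H) : H →L⋆[ℂ] H →L[ℂ] ℂ :=
  LinearMap.mkContinuous₂
    (LinearMap.mk₂'ₛₗ (starRingEnd ℂ) (RingHom.id ℂ)
      (fun b a => ∫ z, ⟪φ, W.W (-z) φ'⟫_ℂ * ⟪b, W.W z a⟫_ℂ)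
      (fun b b' a => by
        simp only [inner_add_left, mul_add]
        exact integral_add (W.integrable_inner_mul_inner a b φ φ')
          (W.integrable_inner_mul_inner a b' φ φ'))
      (fun c b a => by
        simp only [inner_smul_left, mul_left_comm _ ((starRingEnd ℂ) c)]
        exact integral_const_mul _ _)
      (fun b a a' => by
        simp only [map_add, inner_add_right, mul_add]
        exact integral_add (W.integrable_inner_mul_inner a b φ φ')
          (W.integrable_inner_mul_inner a' b φ φ'))
      (fun c b a => by
        simp only [map_smul, inner_smul_right, mul_left_comm _ c]
        exact integral_const_mul _ _))
    ((2 * Real.pi) ^ s * (‖φ‖ * ‖φ'‖)) (fun b a => by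
      refine (norm_integral_le_integral_norm _).trans
        ((W.integral_norm_inner_mul_inner_le a b φ φ').trans_eq ?_)
      ring)

/-- Schur orthogonality for irreducible Weyl systems. -/
theorem integral_inner_mul_inner (a b φ φ' : H) :
    ∫ z, ⟪φ, W.W (-z) φ'⟫_ℂ * ⟪b, W.W z a⟫_ℂ = planck s * (⟪φ, a⟫_ℂ * ⟪b, φ'⟫_ℂ) := by
  obtain ⟨Ω, hΩ⟩ := W.exists_vacuum
  have hd := W.dense_span_orbit (IsVacuum.ne_zero (W := W) hΩ)
  -- Density is used in one variable at a time: for coherent b both sides are continuous and linear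
  -- in a and agree on coherent a; afterwards a is fixed and b varies.
  have h1 : ∀ w a, ∫ z, ⟪φ, W.W (-z) φ'⟫_ℂ * ⟪W.W w Ω, W.W z a⟫_ℂ =
      planck s * (⟪φ, a⟫_ℂ * ⟪W.W w Ω, φ'⟫_ℂ) := by
    intro w a
    have : W.coefficientForm φ φ' (W.W w Ω) =
        (planck s * ⟪W.W w Ω, φ'⟫_ℂ) • innerSL ℂ φ := by
      refine ContinuousLinearMap.ext_on hd ?_
      rintro _ ⟨u, rfl⟩
      refine (IsVacuum.inner_coherent (W := W) hΩ u w φ φ').2.trans ?_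
      simp
      ring
    refine (congrArg (fun T => T a) this).trans ?_
    simp
    ring
  have h2 : (W.coefficientForm φ φ').flip a = (planck s * ⟪φ, a⟫_ℂ) • (innerSLFlip ℂ φ') := by
    refine ContinuousLinearMap.ext_on hd ?_
    rintro _ ⟨u, rfl⟩
    refine (h1 u a).trans ?_
    simp
    ring
  refine (congrArg (fun T => T b) h2).trans ?_
  simp
  ring

end WeylSystem

/-! ### Smooth vectors: differentiating under the Gaussian integral. -/

section ShiftedGaussian

variable {s : ℕ}

/-- The kernel of `W(te) ∫ exp(-|z|²/4) W(z) dz`. -/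
def shiftKernel (e : Z s) (t : ℝ) (z : Z s) : ℂ :=
  Complex.exp (-(1 / 4) * ∑ i, ((z i - t * e i : ℝ) : ℂ) ^ 2 + Complex.I / 2 * (t * symp e z : ℝ))

theorem hasDerivAt_shiftKernel (e z : Z s) (t : ℝ) :
    HasDerivAt (fun t => shiftKernel e t z)
      (((1 / 2 * ∑ i, (z i - t * e i) * e i : ℝ) + Complex.I / 2 * (symp e z : ℝ)) *
        shiftKernel e t z) t := by
  have h1 : HasDerivAt (fun t : ℝ => -(1 / 4) * ∑ i, (z i - t * e i) ^ 2)
      (1 / 2 * ∑ i, (z i - t * e i) * e i) t := by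
    have : ∀ i, HasDerivAt (fun t : ℝ => (z i - t * e i) ^ 2) (-2 * ((z i - t * e i) * e i)) t := by
      intro i
      refine ((((hasDerivAt_id t).mul_const (e i)).const_sub (z i)).fun_pow 2).congr_deriv ?_
      simp
      ring
    refine ((HasDerivAt.fun_sum fun i (_ : i ∈ Finset.univ) => this i).const_mul
      (-(1 / 4) : ℝ)).congr_deriv ?_
    rw [← Finset.mul_sum]
    ring
  have h2 : HasDerivAt (fun t : ℝ => t * symp e z) (symp e z) t := by
    simpa using (hasDerivAt_id t).mul_const (symp e z)
  have h3 := (h1.ofReal_comp.add (h2.ofReal_comp.const_mul (Complex.I / 2))).cexp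
  convert h3 using 1
  · funext t
    simp [shiftKernel]
  · rw [mul_comm]
    simp [shiftKernel]

theorem norm_shiftKernel (e z : Z s) (t : ℝ) :
    ‖shiftKernel e t z‖ = Real.exp (-(1 / 4) * ∑ i, (z i - t * e i) ^ 2) := by
  rw [shiftKernel, Complex.norm_exp]
  congr 1
  rw [Complex.add_re]
  have h1 : (-(1 / 4) * ∑ i, ((z i - t * e i : ℝ) : ℂ) ^ 2) =
      ((-(1 / 4) * ∑ i, (z i - t * e i) ^ 2 : ℝ) : ℂ) := by push_cast; ring
  have h2 : (Complex.I / 2 * (t * symp e z : ℝ)) = ((t * symp e z / 2 : ℝ) : ℂ) * Complex.I := by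
    push_cast; ring
  rw [h1, h2, Complex.ofReal_re, Complex.re_ofReal_mul, Complex.I_re, mul_zero, add_zero]

/-- A dominating function uniform in |t| ≤ 1. Half of the decay exp(-|z|²/8) absorbs the polynomial
factor, leaving exp(-|z|²/16). -/
theorem norm_shiftKernel_deriv_le (e z : Z s) {t : ℝ} (ht : |t| ≤ 1) :
    ‖((1 / 2 * ∑ i, (z i - t * e i) * e i : ℝ) + Complex.I / 2 * (symp e z : ℝ)) *
        shiftKernel e t z‖ ≤
      (16 + 2 * ∑ i, e i ^ 2) * Real.exp (1 / 4 * ∑ i, e i ^ 2) *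
        Real.exp (-(1 / 16) * ∑ i, z i ^ 2) := by
  set M := ∑ i, e i ^ 2 with hM
  set S := ∑ i, z i ^ 2 with hS
  have ht2 : t ^ 2 ≤ 1 := by rw [← sq_abs]; exact pow_le_one₀ (abs_nonneg t) ht
  have hM0 : 0 ≤ M := Finset.sum_nonneg fun _ _ => sq_nonneg _
  have hS0 : 0 ≤ S := Finset.sum_nonneg fun _ _ => sq_nonneg _
  have hcs : ∀ a b : Z s, |∑ i, a i * b i| ≤ (∑ i, a i ^ 2 + ∑ i, b i ^ 2) / 2 := by
    intro a b
    refine (Finset.abs_sum_le_sum_abs _ _).trans ?_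
    rw [← Finset.sum_add_distrib, Finset.sum_div]
    refine Finset.sum_le_sum fun i _ => ?_
    rw [abs_mul, ← sq_abs (a i), ← sq_abs (b i)]
    nlinarith [sq_nonneg (|a i| - |b i|)]
  have h1 : |∑ i, (z i - t * e i) * e i| ≤ (S + M) / 2 + M := by
    have : ∑ i, (z i - t * e i) * e i = ∑ i, z i * e i - t * M := by
      rw [hM, Finset.mul_sum, ← Finset.sum_sub_distrib]
      exact Finset.sum_congr rfl fun i _ => by ring
    rw [this]
    refine (abs_sub _ _).trans (add_le_add (hcs z e) ?_)
    rw [abs_mul, abs_of_nonneg hM0]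
    exact mul_le_of_le_one_left hM0 ht
  have h2 : |symp e z| ≤ (S + M) / 2 := by
    have := hcs e (sympl s *ᵥ z)
    rw [sum_sympl_sq] at this
    rw [symp_eq_sum, add_comm S]
    exact this
  have h3 : ‖((1 / 2 * ∑ i, (z i - t * e i) * e i : ℝ) : ℂ) + Complex.I / 2 * (symp e z : ℝ)‖ ≤
      S + 2 * M := by
    refine (norm_add_le _ _).trans ?_
    rw [Complex.norm_real, Real.norm_eq_abs, abs_mul, norm_mul, Complex.norm_real, Real.norm_eq_abs]
    have : ‖Complex.I / 2‖ = 1 / 2 := by simp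
    rw [this, abs_of_nonneg (by norm_num : (0 : ℝ) ≤ 1 / 2)]
    linarith
  have h4 : S + 2 * M ≤ (16 + 2 * M) * Real.exp (1 / 16 * S) := by
    have := Real.add_one_le_exp (1 / 16 * S)
    nlinarith [Real.one_le_exp (by positivity : 0 ≤ 1 / 16 * S)]
  -- From |z - te|² ≥ |z|²/2 - |te|², which is the square |z - 2te|² ≥ 0 rearranged.
  have h5 : -(1 / 4) * ∑ i, (z i - t * e i) ^ 2 ≤ 1 / 4 * M - 1 / 8 * S := by
    have : 1 / 2 * S - M ≤ ∑ i, (z i - t * e i) ^ 2 := by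
      rw [hM, hS, Finset.mul_sum, ← Finset.sum_sub_distrib]
      refine Finset.sum_le_sum fun i _ => ?_
      nlinarith [sq_nonneg (z i - 2 * (t * e i)), mul_le_mul_of_nonneg_right ht2 (sq_nonneg (e i))]
    linarith
  rw [norm_mul, norm_shiftKernel]
  calc _ ≤ ((16 + 2 * M) * Real.exp (1 / 16 * S)) * Real.exp (1 / 4 * M - 1 / 8 * S) := by
        gcongr
        exact h3.trans h4
    _ = _ := by
        rw [mul_assoc, mul_assoc, ← Real.exp_add, ← Real.exp_add]
        ring_nf

theorem integrable_exp_neg_sum_sq {c : ℝ} (hc : 0 < c) :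
    Integrable fun z : Z s => Real.exp (-c * ∑ i, z i ^ 2) := by
  have := GaussianFourier.integrable_cexp_neg_mul_sum_add (ι := Fin 2 × Fin s)
    (b := (c : ℂ)) (by simpa using hc) 0
  refine this.norm.congr (Filter.Eventually.of_forall fun z => ?_)
  have h1 : (-(c : ℂ) * ∑ i, (z i : ℂ) ^ 2 + ∑ i, (0 : Fin 2 × Fin s → ℂ) i * z i) =
      ((-c * ∑ i, z i ^ 2 : ℝ) : ℂ) := by
    simp
  simp only [h1, Complex.norm_exp_ofReal]

end ShiftedGaussian

namespace WeylSystem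

variable {s : ℕ} {H : Type*} [NormedAddCommGroup H] [InnerProductSpace ℂ H] [CompleteSpace H]
  (W : WeylSystem s H)

/-- Translating the integration variable moves all dependence on t into a scalar kernel, so
differentiability in t no longer involves any operator. -/
theorem apply_smul_vacuumMap (x : H) (e : Z s) (t : ℝ) :
    W.W (t • e) (W.vacuumMap x) = ∫ z, shiftKernel e t z • W.W z x := by
  rw [vacuumMap, ← ContinuousLinearMap.integral_comp_comm _ (W.integrable_gauss_smul x),
    ← integral_sub_right_eq_self _ (t • e)]
  refine integral_congr_ae (Filter.Eventually.of_forall fun z => ?_)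
  simp only
  rw [map_smul, apply_apply, smul_smul, gauss, ← Complex.exp_add, add_sub_cancel, shiftKernel,
    sub_eq_add_neg z, symp_add_right, symp_neg_right, symp_self, symp_smul_left]
  congr 3
  simp

theorem differentiableAt_vacuumMap (x : H) (e : Z s) :
    DifferentiableAt ℝ (fun t : ℝ => W.W (t • e) (W.vacuumMap x)) 0 := by
  simp_rw [apply_smul_vacuumMap]
  have hcont : ∀ t, Continuous (shiftKernel e t) := fun t => by
    unfold shiftKernel symp
    fun_prop
  have := hasDerivAt_integral_of_dominated_loc_of_deriv_le (μ := (volume : Measure (Z s)))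
    (F := fun t z => shiftKernel e t z • W.W z x) (x₀ := (0 : ℝ))
    (F' := fun t z => (((1 / 2 * ∑ i, (z i - t * e i) * e i : ℝ) +
      Complex.I / 2 * (symp e z : ℝ)) * shiftKernel e t z) • W.W z x)
    (bound := fun z => (16 + 2 * ∑ i, e i ^ 2) * Real.exp (1 / 4 * ∑ i, e i ^ 2) *
        Real.exp (-(1 / 16) * ∑ i, z i ^ 2) * ‖x‖)
    (Metric.ball_mem_nhds 0 one_pos)
    (Filter.Eventually.of_forall fun t => ((hcont t).smul (W.continuous x)).aestronglyMeasurable)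
    ?_ ?_ ?_ ?_ ?_
  · exact this.2.differentiableAt
  · refine (W.integrable_gauss_smul x).congr (Filter.Eventually.of_forall fun z => ?_)
    simp [shiftKernel, gauss]
  · refine Continuous.aestronglyMeasurable ?_
    refine Continuous.smul (Continuous.mul ?_ (hcont 0)) (W.continuous x)
    unfold symp
    fun_prop
  · refine Filter.Eventually.of_forall fun z t ht => ?_
    rw [norm_smul, norm_map]
    gcongr
    refine norm_shiftKernel_deriv_le e z ?_
    simpa using (Metric.mem_ball.1 ht).le
  · exact ((integrable_exp_neg_sum_sq (by norm_num)).const_mul _).mul_const _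
  · refine Filter.Eventually.of_forall fun z t _ => ?_
    exact (hasDerivAt_shiftKernel e z t).smul_const _

/-- The vectors which lie in the domain of all `R·e`. -/
def smoothVectors : Submodule ℂ H := ⨅ e : Z s, (stoneGenerator fun t => W.W (t • e)).domain

theorem mem_smoothVectors {x : H} :
    x ∈ W.smoothVectors ↔ ∀ e : Z s, DifferentiableAt ℝ (fun t : ℝ => W.W (t • e) x) 0 := by
  simp only [smoothVectors, Submodule.mem_iInf]
  rfl

/-- The CCR moves `W w` past `W (t • e)` at the cost of a phase smooth in t. -/
theorem differentiableAt_apply {e : Z s} {x : H}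
    (h : DifferentiableAt ℝ (fun t : ℝ => W.W (t • e) x) 0) (w : Z s) :
    DifferentiableAt ℝ (fun t : ℝ => W.W (t • e) (W.W w x)) 0 := by
  have h1 : (fun t : ℝ => W.W (t • e) (W.W w x)) =
      fun t : ℝ => Complex.exp (Complex.I * ((t * symp e w : ℝ) : ℂ)) • W.W w (W.W (t • e) x) := by
    funext t
    rw [apply_comm, symp_smul_left]
  rw [h1]
  have h2 : DifferentiableAt ℝ (fun t : ℝ => W.W w (W.W (t • e) x)) 0 :=
    ((W.W w).restrictScalars ℝ).differentiableAt.comp _ h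
  refine DifferentiableAt.smul ?_ h2
  have h3 : DifferentiableAt ℝ (fun t : ℝ => Complex.I * ((t * symp e w : ℝ) : ℂ)) 0 := by
    push_cast
    fun_prop
  exact h3.cexp

/-- The vacuum is a multiple of its own image under `vacuumMap`, hence smooth; so is its orbit,
whose span is dense. -/
theorem dense_smoothVectors : Dense (W.smoothVectors : Set H) := by
  obtain ⟨Ω, hΩ⟩ := W.exists_vacuum
  refine (W.dense_span_orbit (IsVacuum.ne_zero (W := W) hΩ)).mono ?_
  refine Submodule.span_le.2 ?_
  rintro _ ⟨w, rfl⟩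
  refine W.mem_smoothVectors.2 fun e => W.differentiableAt_apply ?_ w
  have h := (W.differentiableAt_vacuumMap Ω e).fun_const_smul (planck s)⁻¹
  refine h.congr_of_eventuallyEq (Filter.Eventually.of_forall fun t => ?_)
  simp only
  rw [IsVacuum.vacuumMap_self (W := W) hΩ, map_smul, inv_smul_smul₀ planck_ne_zero]

end WeylSystem

/-! ### Conjugation and transposition. -/

section Transposes

variable {ι H : Type*} [NormedAddCommGroup H] [InnerProductSpace ℂ H] (b : HilbertBasis ι ℂ H)

theorem conjugation_conjugation (x : H) : conjugation b (conjugation b x) = x := by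
  simp [conjugation]

theorem inner_conjugation_conjugation (x y : H) :
    ⟪conjugation b x, conjugation b y⟫_ℂ = ⟪y, x⟫_ℂ := by
  simp only [conjugation, LinearIsometryEquiv.trans_apply, LinearIsometryEquiv.inner_map_map]
  rw [← b.repr.inner_map_map y x, lp.inner_eq_tsum, lp.inner_eq_tsum]
  refine tsum_congr fun i => ?_
  simp [mul_comm]

variable [CompleteSpace H]

theorem transpose_apply (X : H →L[ℂ] H) (x : H) :
    transpose b X x = conjugation b (ContinuousLinearMap.adjoint X (conjugation b x)) := rfl

/-- In this form transposition meets the conjugated vectors of the Choi-Jamiolkowski form. -/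
theorem inner_transpose (X : H →L[ℂ] H) (x y : H) :
    ⟪x, transpose b X y⟫_ℂ = ⟪conjugation b y, X (conjugation b x)⟫_ℂ := by
  rw [transpose_apply]
  nth_rw 1 [← conjugation_conjugation b x]
  rw [inner_conjugation_conjugation, ContinuousLinearMap.adjoint_inner_left]

theorem transpose_smul (c : ℂ) (X : H →L[ℂ] H) : transpose b (c • X) = c • transpose b X := by
  ext x
  refine ext_inner_left ℂ fun y => ?_
  rw [inner_transpose, _root_.smul_apply, _root_.smul_apply, inner_smul_right, inner_smul_right,
    inner_transpose]

end Transposes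

/-! ### The inversion formula. -/

section Inversion

variable {ι HA HB : Type*}
  [NormedAddCommGroup HA] [InnerProductSpace ℂ HA] [CompleteSpace HA]
  [NormedAddCommGroup HB] [InnerProductSpace ℂ HB] [CompleteSpace HB]

/-- Schur orthogonality holds for each rank-one term of a nuclear series, and the `n`-th term has L¹
norm at most a constant times ‖xₙ‖‖yₙ‖, so sum and integral commute. -/
theorem WeylSystem.integral_inner_mul_traceMul {s : ℕ} (W : WeylSystem s HB) (σ : traceClass HB)
    (φ φ' : HB) :
    Integrable (fun z => ⟪φ, W.W (-z) φ'⟫_ℂ * traceMul (W.W z) σ) ∧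
    ∫ z, ⟪φ, W.W (-z) φ'⟫_ℂ * traceMul (W.W z) σ =
      planck s * ⟪φ, (σ : HB →L[ℂ] HB) φ'⟫_ℂ := by
  obtain ⟨x, y, h, hσ⟩ := σ.2
  set F : ℕ → Z s → ℂ := fun n z => ⟪φ, W.W (-z) φ'⟫_ℂ * ⟪y n, W.W z (x n)⟫_ℂ with hF
  have htr : ∀ z, HasSum (fun n => ⟪y n, W.W z (x n)⟫_ℂ) (traceMul (W.W z) σ) := fun z =>
    hasSum_trace_comp h hσ (W.W z)
  have hFs : ∀ z, HasSum (fun n => F n z) (⟪φ, W.W (-z) φ'⟫_ℂ * traceMul (W.W z) σ) := fun z =>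
    (htr z).mul_left _
  have hcont : Continuous fun z => traceMul (W.W z) σ := by
    have : (fun z => traceMul (W.W z) σ) = fun z => ∑' n, ⟪y n, W.W z (x n)⟫_ℂ :=
      funext fun z => (htr z).tsum_eq.symm
    rw [this]
    refine continuous_tsum (fun n => W.continuous_inner _ _) h fun n z => ?_
    rw [mul_comm]
    exact W.norm_inner_le z (y n) (x n)
  have hint : Integrable fun z => ⟪φ, W.W (-z) φ'⟫_ℂ * traceMul (W.W z) σ := by
    refine ⟨(((W.continuous_inner φ φ').comp continuous_neg).mul hcont).aestronglyMeasurable, ?_⟩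
    calc ∫⁻ z, ‖⟪φ, W.W (-z) φ'⟫_ℂ * traceMul (W.W z) σ‖ₑ
        ≤ ∫⁻ z, ∑' n, ‖F n z‖ₑ := by
          refine lintegral_mono fun z => ?_
          simp only
          rw [← (hFs z).tsum_eq]
          exact enorm_tsum_le_tsum_enorm
      _ = ∑' n, ∫⁻ z, ‖F n z‖ₑ :=
          lintegral_tsum fun n => ((((W.continuous_inner φ φ').comp continuous_neg).mul
            (W.continuous_inner _ _)).enorm).measurable.aemeasurable
      _ ≤ ∑' n, ENNReal.ofReal ((2 * Real.pi) ^ s * (‖φ‖ * ‖φ'‖ * (‖x n‖ * ‖y n‖))) :=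
          ENNReal.tsum_le_tsum fun n => W.lintegral_enorm_mul_le _ _ _ _
      _ = ENNReal.ofReal (∑' n, (2 * Real.pi) ^ s * (‖φ‖ * ‖φ'‖ * (‖x n‖ * ‖y n‖))) :=
          (ENNReal.ofReal_tsum_of_nonneg (fun n => by positivity)
            ((h.mul_left _).mul_left _)).symm
      _ < ⊤ := ENNReal.ofReal_lt_top
  refine ⟨hint, ?_⟩
  have h1 := hasSum_integral_of_summable_integral_norm (F := F)
    (fun n => W.integrable_inner_mul_inner _ _ _ _)
    (Summable.of_nonneg_of_le (fun n => by positivity)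
      (fun n => W.integral_norm_inner_mul_inner_le _ _ _ _) ((h.mul_left _).mul_left _))
  have h2 : HasSum (fun n => planck s * (⟪φ, x n⟫_ℂ * ⟪y n, φ'⟫_ℂ))
      (planck s * ⟪φ, (σ : HB →L[ℂ] HB) φ'⟫_ℂ) := by
    refine HasSum.mul_left _ ?_
    have := (hσ.mapL (ContinuousLinearMap.apply ℂ HB φ')).mapL (innerSL ℂ φ)
    simpa [inner_smul_right, mul_comm] using this
  simp only [hF, W.integral_inner_mul_inner] at h1
  rw [← h1.unique h2]
  exact integral_congr_ae (Filter.Eventually.of_forall fun z => (hFs z).tsum_eq.symm)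

/-- The inversion formula for the Choi-Jamiolkowski form. -/
theorem cjForm_eq_integral {s : ℕ} (W : WeylSystem s HB) (b : HilbertBasis ι ℂ HA)
    {Φ : traceClass HA →ₗ[ℂ] traceClass HB} (hΦ : ∀ ρ, IsState ρ → IsState (Φ ρ))
    (x y : HB ⊗[ℂ] HA) :
    Integrable (fun z : Z s => ⟪x, TensorProduct.map (W.W (-z) : HB →ₗ[ℂ] HB)
      (transpose b (dual Φ (W.W z)) : HA →ₗ[ℂ] HA) y⟫_ℂ) ∧
    cjForm b Φ x y = (planck s)⁻¹ *
      ∫ z : Z s, ⟪x, TensorProduct.map (W.W (-z) : HB →ₗ[ℂ] HB)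
        (transpose b (dual Φ (W.W z)) : HA →ₗ[ℂ] HA) y⟫_ℂ := by
  induction x using TensorProduct.induction_on with
  | zero => simp
  | add x x' h h' =>
    simp only [inner_add_left, map_add, LinearMap.add_apply]
    refine ⟨h.1.add h'.1, ?_⟩
    rw [integral_add h.1 h'.1, h.2, h'.2, mul_add]
  | tmul φ ψ =>
    induction y using TensorProduct.induction_on with
    | zero => simp
    | add y y' h h' =>
      simp only [map_add, inner_add_right]
      refine ⟨h.1.add h'.1, ?_⟩
      rw [integral_add h.1 h'.1, h.2, h'.2, mul_add]
    | tmul φ' ψ' =>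
      -- On product vectors, transposition and duality turn the second tensor factor into Tr σ W(z)
      -- with σ = Φ(|ψ̄⟩⟨ψ̄'|).
      have h1 : ∀ z : Z s, ⟪φ ⊗ₜ[ℂ] ψ, TensorProduct.map (W.W (-z) : HB →ₗ[ℂ] HB)
          (transpose b (dual Φ (W.W z)) : HA →ₗ[ℂ] HA) (φ' ⊗ₜ[ℂ] ψ')⟫_ℂ =
          ⟪φ, W.W (-z) φ'⟫_ℂ *
            traceMul (W.W z) (Φ (ketBra (conjugation b ψ) (conjugation b ψ'))) := by
        intro z
        rw [TensorProduct.map_tmul, TensorProduct.inner_tmul,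
          ← (isDualValue_dual hΦ (W.W z)).inner_eq, ← inner_transpose]
        rfl
      simp_rw [h1]
      obtain ⟨h2, h3⟩ := W.integral_inner_mul_traceMul
        (Φ (ketBra (conjugation b ψ) (conjugation b ψ'))) φ φ'
      exact ⟨h2, by rw [h3, cjForm_tmul, inv_mul_cancel_left₀ planck_ne_zero]⟩

end Inversion

/-! ### One-parameter unitary groups and essential self-adjointness. -/

section UnitaryGroups

variable {E : Type*} [NormedAddCommGroup E] [InnerProductSpace ℂ E]

theorem mem_graph_stoneGenerator {U : ℝ → E →L[ℂ] E} {x y : E} :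
    (x, y) ∈ (stoneGenerator U).graph ↔ HasDerivAt (fun t => U t x) (Complex.I • y) 0 := by
  rw [LinearPMap.mem_graph_iff]
  constructor
  · rintro ⟨⟨v, hv⟩, rfl, rfl⟩
    change HasDerivAt (fun t => U t v) (Complex.I • -Complex.I • deriv (fun t => U t v) 0) 0
    rw [smul_smul, mul_neg, Complex.I_mul_I, neg_neg, one_smul]
    exact DifferentiableAt.hasDerivAt hv
  · intro h
    refine ⟨⟨x, h.differentiableAt⟩, rfl, ?_⟩
    change -Complex.I • deriv (fun t => U t x) 0 = y
    rw [h.deriv, smul_smul, neg_mul, Complex.I_mul_I, neg_neg, one_smul]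

variable [CompleteSpace E]

namespace IsUnitaryGroup

variable {U V : ℝ → E →L[ℂ] E} (hU : IsUnitaryGroup U)

include hU

theorem apply_add (t t' : ℝ) (x : E) : U (t + t') x = U t (U t' x) := by rw [hU.map_add]; rfl

theorem inner_map_map (t : ℝ) (x y : E) : ⟪U t x, U t y⟫_ℂ = ⟪x, y⟫_ℂ := by
  rw [← ContinuousLinearMap.adjoint_inner_right]
  congr 1
  have := congrArg (fun T => T y) (Unitary.mem_iff.1 (hU.mem_unitary t)).1
  simpa [ContinuousLinearMap.star_eq_adjoint] using this

theorem norm_map (t : ℝ) (x : E) : ‖U t x‖ = ‖x‖ := by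
  rw [norm_eq_sqrt_re_inner (𝕜 := ℂ), norm_eq_sqrt_re_inner (𝕜 := ℂ), hU.inner_map_map]

theorem zero_apply (x : E) : U 0 x = x := by
  have h := hU.apply_add 0 0 x
  rw [add_zero] at h
  have h3 := hU.norm_map 0 (U 0 x - x)
  rw [_root_.map_sub, ← h, sub_self, norm_zero] at h3
  exact sub_eq_zero.1 (norm_eq_zero.1 h3.symm)

theorem hasDerivAt_apply {x y : E} (h : HasDerivAt (fun t => U t x) (Complex.I • y) 0) (t : ℝ) :
    HasDerivAt (fun r => U r (U t x)) (Complex.I • U t y) 0 := by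
  have h1 : (fun r => U r (U t x)) = fun r => U t (U r x) := by
    funext r
    rw [← hU.apply_add, add_comm, hU.apply_add]
  rw [h1, ← map_smul]
  exact ((U t).restrictScalars ℝ).hasFDerivAt.comp_hasDerivAt 0 h

theorem hasDerivAt_of_zero {x y : E} {t : ℝ}
    (h : HasDerivAt (fun r => U r (U t x)) (Complex.I • y) 0) :
    HasDerivAt (fun r => U r x) (Complex.I • y) t := by
  have h1 : (fun r => U r x) = fun r => U (r - t) (U t x) := by
    funext r
    rw [← hU.apply_add, sub_add_cancel]
  rw [h1]
  exact HasDerivAt.comp_sub_const (f := fun r => U r (U t x)) t t (by rwa [sub_self])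

theorem hasDerivAt {x y : E} (h : HasDerivAt (fun t => U t x) (Complex.I • y) 0) (t : ℝ) :
    HasDerivAt (fun r => U r x) (Complex.I • U t y) t :=
  hU.hasDerivAt_of_zero (hU.hasDerivAt_apply h t)

theorem inner_symm {x y x' y' : E} (h : HasDerivAt (fun t => U t x) (Complex.I • y) 0)
    (h' : HasDerivAt (fun t => U t x') (Complex.I • y') 0) : ⟪y, x'⟫_ℂ = ⟪x, y'⟫_ℂ := by
  have h1 := h.inner ℂ h'
  simp only [hU.inner_map_map] at h1
  have h2 := h1.unique (hasDerivAt_const _ _)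
  rw [hU.zero_apply, hU.zero_apply, inner_smul_left, inner_smul_right, Complex.conj_I] at h2
  have h3 : Complex.I * (⟪x, y'⟫_ℂ - ⟪y, x'⟫_ℂ) = 0 := by rw [← h2]; ring
  rcases mul_eq_zero.1 h3 with h4 | h4
  · exact absurd h4 Complex.I_ne_zero
  · exact (sub_eq_zero.1 h4).symm

/-- For (xₙ, yₙ) → (x, y), the mean value inequality for r ↦ U(r)xₙ - r·iy bounds the
differentiation error by (‖yₙ - y‖ + ε)|t| on a ball independent of n. The limit in n gives the
derivative at x. -/
theorem isClosed_graph : IsClosed ((stoneGenerator U).graph : Set (E × E)) := by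
  refine isClosed_of_closure_subset ?_
  rintro ⟨x, y⟩ hxy
  obtain ⟨p, hp, hlim⟩ := mem_closure_iff_seq_limit.1 hxy
  have hx : Filter.Tendsto (fun n => (p n).1) Filter.atTop (nhds x) :=
    (continuous_fst.tendsto (x, y)).comp hlim
  have hy : Filter.Tendsto (fun n => (p n).2) Filter.atTop (nhds y) :=
    (continuous_snd.tendsto (x, y)).comp hlim
  refine mem_graph_stoneGenerator.2 ?_
  rw [hasDerivAt_iff_isLittleO, Asymptotics.isLittleO_iff]
  intro ε hε
  obtain ⟨δ, hδ, hball⟩ := Metric.continuousAt_iff.1 ((hU.continuous y).continuousAt (x := 0)) ε hε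
  filter_upwards [Metric.ball_mem_nhds 0 hδ] with t ht
  simp only [hU.zero_apply, sub_zero]
  have hn : ∀ n, ‖U t (p n).1 - (p n).1 - t • Complex.I • y‖ ≤ (‖(p n).2 - y‖ + ε) * ‖t‖ := by
    intro n
    have hd := hU.hasDerivAt (mem_graph_stoneGenerator.1 (hp n))
    have hd2 : ∀ r ∈ Metric.ball (0 : ℝ) δ, HasDerivWithinAt
        (fun r => U r (p n).1 - r • Complex.I • y)
        (Complex.I • U r (p n).2 - (1 : ℝ) • Complex.I • y) (Metric.ball 0 δ) r := fun r _ =>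
      ((hd r).sub ((hasDerivAt_id r).smul_const (Complex.I • y))).hasDerivWithinAt
    have hbd : ∀ r ∈ Metric.ball (0 : ℝ) δ,
        ‖Complex.I • U r (p n).2 - (1 : ℝ) • Complex.I • y‖ ≤ ‖(p n).2 - y‖ + ε := by
      intro r hr
      rw [one_smul, ← smul_sub, norm_smul, Complex.norm_I, one_mul]
      have h1 := hball hr
      rw [hU.zero_apply, dist_eq_norm] at h1
      calc ‖U r (p n).2 - y‖ = ‖U r ((p n).2 - y) + (U r y - y)‖ := by
            rw [_root_.map_sub]; congr 1; abel
        _ ≤ ‖(p n).2 - y‖ + ε := by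
            refine (norm_add_le _ _).trans ?_
            rw [hU.norm_map]
            gcongr
    have := (convex_ball (0 : ℝ) δ).norm_image_sub_le_of_norm_hasDerivWithin_le hd2 hbd
      (Metric.mem_ball_self hδ) ht
    simp only [zero_smul, sub_zero, hU.zero_apply] at this
    rwa [sub_right_comm]
  refine le_of_tendsto_of_tendsto' (((((U t).continuous.tendsto x).comp hx).sub hx).sub
    tendsto_const_nhds).norm ?_ hn
  have h0 : Filter.Tendsto (fun n => (‖(p n).2 - y‖ + ε) * ‖t‖) Filter.atTop
      (nhds ((‖y - y‖ + ε) * ‖t‖)) :=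
    ((hy.sub tendsto_const_nhds).norm.add_const ε).mul_const _
  simpa using h0

/-- If φ is orthogonal to the range of A - i, invariance of the domain makes eᵗ⟨φ, U(t)x⟩ constant.
It is bounded by eᵗ‖φ‖‖x‖, so t → -∞ shows that φ is orthogonal to the dense domain. -/
theorem dense_range_sub {A : E →ₗ.[ℂ] E}
    (hA : ∀ x y, (x, y) ∈ A.graph → HasDerivAt (fun t => U t x) (Complex.I • y) 0)
    (hd : Dense (A.domain : Set E)) (hinv : ∀ t, ∀ x ∈ A.domain, U t x ∈ A.domain) :
    Dense ((A.graph.map (LinearMap.snd ℂ E E - Complex.I • LinearMap.fst ℂ E E) :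
      Submodule ℂ E) : Set E) := by
  rw [Submodule.dense_iff_topologicalClosure_eq_top, Submodule.topologicalClosure_eq_top_iff,
    Submodule.eq_bot_iff]
  intro φ hφ
  have hφ' : ∀ x y, (x, y) ∈ A.graph → ⟪φ, y⟫_ℂ = Complex.I * ⟪φ, x⟫_ℂ := by
    intro x y hxy
    have := (Submodule.mem_orthogonal' _ φ).1 hφ _ (Submodule.mem_map_of_mem hxy)
    simpa [inner_sub_right, inner_smul_right, sub_eq_zero] using this
  have hdom : ∀ x ∈ A.domain, ⟪φ, x⟫_ℂ = 0 := by
    intro x hx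
    have hder : ∀ t : ℝ, HasDerivAt (fun t : ℝ => (Real.exp t : ℂ) * ⟪φ, U t x⟫_ℂ) 0 t := by
      intro t
      obtain ⟨w, hw⟩ := LinearPMap.mem_domain_iff.1 (hinv t x hx)
      have h1 := hU.hasDerivAt_of_zero (hA _ _ hw)
      have h2 := (hasDerivAt_const t φ).inner ℂ h1
      rw [inner_zero_left, add_zero, inner_smul_right, hφ' _ _ hw] at h2
      have h3 := ((Real.hasDerivAt_exp t).ofReal_comp).mul h2
      refine h3.congr_deriv ?_
      rw [← mul_assoc Complex.I, Complex.I_mul_I]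
      ring
    have hconst : ∀ t : ℝ, (Real.exp t : ℂ) * ⟪φ, U t x⟫_ℂ = ⟪φ, x⟫_ℂ := by
      intro t
      have := is_const_of_deriv_eq_zero (fun t => (hder t).differentiableAt)
        (fun t => (hder t).deriv) t 0
      simpa [hU.zero_apply] using this
    have hle : ∀ t : ℝ, ‖⟪φ, x⟫_ℂ‖ ≤ Real.exp t * (‖φ‖ * ‖x‖) := by
      intro t
      rw [← hconst t, norm_mul, Complex.norm_real, Real.norm_of_nonneg (Real.exp_nonneg _)]
      gcongr
      simpa [hU.norm_map] using norm_inner_le_norm (𝕜 := ℂ) φ (U t x)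
    have hlim := Real.tendsto_exp_atBot.mul_const (‖φ‖ * ‖x‖)
    rw [zero_mul] at hlim
    exact norm_le_zero_iff.1 (ge_of_tendsto' hlim hle)
  have : innerSL ℂ φ = 0 :=
    ContinuousLinearMap.ext_on (s := (A.domain : Set E)) (by simpa using hd)
      fun x hx => by simpa using hdom x hx
  simpa using congrArg (fun T => T φ) this

/-- A densely defined restriction of the generator with invariant domain is essentially
self-adjoint. -/
theorem stoneGenerator_eq_closure {A : E →ₗ.[ℂ] E}
    (hA : ∀ x y, (x, y) ∈ A.graph → HasDerivAt (fun t => U t x) (Complex.I • y) 0)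
    (hd : Dense (A.domain : Set E)) (hinv : ∀ t, ∀ x ∈ A.domain, U t x ∈ A.domain) :
    stoneGenerator U = A.closure := by
  have hle : A.graph ≤ (stoneGenerator U).graph := fun p hp =>
    mem_graph_stoneGenerator.2 (hA p.1 p.2 hp)
  have hgraph : A.graph.topologicalClosure = (stoneGenerator U).graph := by
    refine le_antisymm (A.graph.topologicalClosure_minimal hle hU.isClosed_graph) ?_
    rintro ⟨x, y⟩ hxy
    change (x, y) ∈ closure (A.graph : Set (E × E))
    rw [Metric.mem_closure_iff]
    intro ε hε
    -- For (u, v) in the graph of the symmetric generator, ‖v - iu‖² = ‖v‖² + ‖u‖². Hence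
    -- approximating y - ix by w - ia already approximates (x, y) by (a, w), and one of the two
    -- deficiency conditions suffices.
    obtain ⟨_, ⟨⟨a, w⟩, haw, rfl⟩, hdist⟩ := Metric.mem_closure_iff.1
      (hU.dense_range_sub hA hd hinv (y - Complex.I • x)) ε hε
    refine ⟨(a, w), haw, ?_⟩
    have huv := mem_graph_stoneGenerator.1 (Submodule.sub_mem _ hxy (hle haw))
    have hsym := hU.inner_symm huv huv
    set u := x - a with hu
    set v := y - w with hv
    have him : (⟪v, u⟫_ℂ).im = 0 := by
      rw [← Complex.conj_eq_iff_im, inner_conj_symm]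
      exact hsym.symm
    have hsq : ‖v - Complex.I • u‖ ^ 2 = ‖v‖ ^ 2 + ‖u‖ ^ 2 := by
      rw [norm_sub_sq (𝕜 := ℂ), inner_smul_right, norm_smul, Complex.norm_I]
      simp [him]
    have hlt : ‖v - Complex.I • u‖ < ε := by
      refine lt_of_eq_of_lt ?_ hdist
      rw [dist_eq_norm]
      congr 1
      simp only [LinearMap.sub_apply, LinearMap.smul_apply, LinearMap.snd_apply,
        LinearMap.fst_apply, hu, hv, smul_sub]
      abel
    have hn := norm_nonneg (v - Complex.I • u)
    rw [dist_eq_norm]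
    refine max_lt ?_ ?_
    · change ‖u‖ < ε
      nlinarith [norm_nonneg u, sq_nonneg ‖v‖]
    · change ‖v‖ < ε
      nlinarith [norm_nonneg v, sq_nonneg ‖u‖]
  have hc : A.IsClosable := ⟨_, hgraph⟩
  exact LinearPMap.eq_of_eq_graph (hgraph.symm.trans hc.graph_closure_eq_closure_graph)

/-- On the common domain ⟨V(t)x, U(t)x⟩ has zero derivative, so it stays equal to ‖x‖²; as both
groups are isometric, V(t)x = U(t)x. -/
theorem eq_of_stoneGenerator_eq (hV : IsUnitaryGroup V) (h : stoneGenerator U = stoneGenerator V)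
    (hd : Dense ((stoneGenerator U).domain : Set E)) : U = V := by
  funext t
  refine ContinuousLinearMap.ext_on (s := ((stoneGenerator U).domain : Set E)) (by simpa using hd)
    fun x hx => ?_
  obtain ⟨y, hy⟩ := LinearPMap.mem_domain_iff.1 hx
  have hyU := mem_graph_stoneGenerator.1 hy
  have hyV := mem_graph_stoneGenerator.1 (h ▸ hy)
  have hder : ∀ t, HasDerivAt (fun t => ⟪V t x, U t x⟫_ℂ) 0 t := by
    intro t
    refine ((hV.hasDerivAt hyV t).inner ℂ (hU.hasDerivAt hyU t)).congr_deriv ?_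
    have h1 : (V t x, V t y) ∈ (stoneGenerator U).graph := by
      rw [h]
      exact mem_graph_stoneGenerator.2 (hV.hasDerivAt_apply hyV t)
    have h2 := hU.inner_symm (mem_graph_stoneGenerator.1 h1) (hU.hasDerivAt_apply hyU t)
    rw [inner_smul_left, inner_smul_right, h2, Complex.conj_I]
    ring
  have hconst : ⟪V t x, U t x⟫_ℂ = ⟪x, x⟫_ℂ := by
    have := is_const_of_deriv_eq_zero (fun t => (hder t).differentiableAt)
      (fun t => (hder t).deriv) t 0
    simpa [hU.zero_apply, hV.zero_apply] using this
  have hsq : ‖V t x - U t x‖ ^ 2 = 0 := by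
    rw [norm_sub_sq (𝕜 := ℂ), hconst, hU.norm_map, hV.norm_map, inner_self_eq_norm_sq_to_K]
    norm_cast
    ring
  exact (sub_eq_zero.1 (norm_eq_zero.1 (pow_eq_zero_iff two_ne_zero |>.1 hsq))).symm

end IsUnitaryGroup

/-- `expI` is a choice; `U` shows that there is something to choose, and the previous lemma that
there is nothing else. -/
theorem expI_eq {A : E →ₗ.[ℂ] E} {U : ℝ → E →L[ℂ] E} (hU : IsExpGroup A U)
    (hd : Dense (A.domain : Set E)) : IsExpGroup A (expI A) ∧ expI A = U := by
  have h : IsExpGroup A (expI A) := Classical.epsilon_spec ⟨U, hU⟩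
  refine ⟨h, h.1.eq_of_stoneGenerator_eq hU.1 (h.2.trans hU.2.symm) ?_⟩
  rw [h.2]
  exact hd.mono (LinearPMap.le_closure A).1

end UnitaryGroups

/-! ### Generators of projective representations. -/

section ProjectiveRepresentations

/-- Isometric representations, up to the multiplier of an alternating form `B`, of a real vector
space, continuous along lines. -/
structure IsProjRep {M E : Type*} [AddCommGroup M] [Module ℝ M] [NormedAddCommGroup E]
    [InnerProductSpace ℂ E] (B : M →ₗ[ℝ] M →ₗ[ℝ] ℝ) (W : M → E →L[ℂ] E) : Prop where
  alternating : ∀ z, B z z = 0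
  norm_map : ∀ z x, ‖W z x‖ = ‖x‖
  zero_apply : ∀ x, W 0 x = x
  apply_apply : ∀ z z' x, W z (W z' x) =
    Complex.exp (Complex.I / 2 * (B z z' : ℝ)) • W (z + z') x
  continuous_line : ∀ z x, Continuous fun t : ℝ => W (t • z) x

namespace IsProjRep

variable {M E : Type*} [AddCommGroup M] [Module ℝ M] [NormedAddCommGroup E]
    [InnerProductSpace ℂ E] {B : M →ₗ[ℝ] M →ₗ[ℝ] ℝ} {W : M → E →L[ℂ] E} (hW : IsProjRep B W)

include hW

theorem skew (z z' : M) : B z' z = -B z z' := by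
  have := hW.alternating (z + z')
  simp only [map_add, LinearMap.add_apply, hW.alternating] at this
  linarith

theorem apply_comm (z z' : M) (x : E) :
    W z (W z' x) = Complex.exp (Complex.I * (B z z' : ℝ)) • W z' (W z x) := by
  rw [hW.apply_apply, hW.apply_apply z', smul_smul, ← Complex.exp_add, add_comm z' z, hW.skew z z']
  congr 2
  push_cast
  ring

theorem isUnitaryGroup [CompleteSpace E] (z : M) : IsUnitaryGroup fun t : ℝ => W (t • z) := by
  have hadd : ∀ (t t' : ℝ) x, W (t • z) (W (t' • z) x) = W ((t + t') • z) x := fun t t' x => by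
    rw [hW.apply_apply, add_smul]
    simp [hW.alternating]
  have hstar : ∀ t : ℝ, star (W (t • z)) * W (t • z) = 1 := fun t =>
    (ContinuousLinearMap.norm_map_iff_adjoint_comp_self _).1 (hW.norm_map _)
  refine ⟨fun t => Unitary.mem_iff.2 ⟨hstar t, ?_⟩, fun t t' => ?_, hW.continuous_line z⟩
  · have h1 : W (t • z) * W ((-t) • z) = 1 := by
      ext x
      have := hadd t (-t) x
      rwa [add_neg_cancel, zero_smul, hW.zero_apply] at this
    have h2 : star (W (t • z)) = W ((-t) • z) := by
      rw [← mul_one (star _), ← h1, ← mul_assoc, hstar, one_mul]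
    rw [h2, h1]
  · ext x
    exact (hadd t t' x).symm

omit hW in
theorem hasDerivAt_smul {z : M} {x y : E}
    (h : HasDerivAt (fun t : ℝ => W (t • z) x) (Complex.I • y) 0) (c : ℝ) :
    HasDerivAt (fun t : ℝ => W (t • c • z) x) (Complex.I • (c : ℂ) • y) 0 := by
  have h1 : HasDerivAt (fun t : ℝ => t * c) c 0 := by simpa using (hasDerivAt_id (0 : ℝ)).mul_const c
  have h2 := HasDerivAt.scomp (g₁ := fun t : ℝ => W (t • z) x) (x := (0 : ℝ))
    (h := fun t : ℝ => t * c) (g₁' := Complex.I • y) (by simpa using h) h1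
  refine (h2.congr_deriv ?_).congr_of_eventuallyEq (Filter.Eventually.of_forall fun t => ?_)
  · rw [smul_comm, Complex.coe_smul]
  · simp [mul_smul]

/-- W(t(z + z')) is W(tz)W(tz') up to a phase quadratic in t, invisible to the derivative at 0. In
the product, isometry controls the remainder of W(tz')x, and strong continuity controls the action
of W(tz) on the fixed vector iy'. -/
theorem hasDerivAt_add {z z' : M} {x y y' : E}
    (h : HasDerivAt (fun t : ℝ => W (t • z) x) (Complex.I • y) 0)
    (h' : HasDerivAt (fun t : ℝ => W (t • z') x) (Complex.I • y') 0) :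
    HasDerivAt (fun t : ℝ => W (t • (z + z')) x) (Complex.I • (y + y')) 0 := by
  have hcomp : HasDerivAt (fun t : ℝ => W (t • z) (W (t • z') x)) (Complex.I • (y + y')) 0 := by
    rw [hasDerivAt_iff_isLittleO] at h h' ⊢
    simp only [zero_smul, hW.zero_apply, sub_zero] at h h' ⊢
    have h1 : (fun t : ℝ => W (t • z) (W (t • z') x - x - t • Complex.I • y'))
        =o[nhds 0] fun t : ℝ => t := by
      rw [← Asymptotics.isLittleO_norm_left] at h' ⊢
      simpa only [hW.norm_map] using h'
    have h2 : (fun t : ℝ => t • (W (t • z) (Complex.I • y') - Complex.I • y'))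
        =o[nhds 0] fun t : ℝ => t := by
      have : (fun t : ℝ => W (t • z) (Complex.I • y') - Complex.I • y')
          =o[nhds 0] fun _ : ℝ => (1 : ℝ) := by
        rw [Asymptotics.isLittleO_one_iff]
        have := ((hW.continuous_line z (Complex.I • y')).tendsto 0).sub_const (Complex.I • y')
        simpa [hW.zero_apply] using this
      simpa using (Asymptotics.isBigO_refl (fun t : ℝ => t) (nhds 0)).smul_isLittleO this
    refine ((h1.add h2).add h).congr_left fun t => ?_
    have h3 : W (t • z) (t • Complex.I • y') = t • W (t • z) (Complex.I • y') :=
      ((W (t • z)).restrictScalars ℝ).map_smul t _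
    rw [map_sub, map_sub, h3]
    simp only [smul_sub, smul_add]
    abel
  have hphase : HasDerivAt (fun t : ℝ => Complex.exp (-(Complex.I / 2 * ((t * (t * B z z') : ℝ) : ℂ))))
      0 0 := by
    have h1 : HasDerivAt (fun t : ℝ => t * (t * B z z')) 0 0 := by
      refine ((hasDerivAt_id (0 : ℝ)).mul ((hasDerivAt_id (0 : ℝ)).mul_const _)).congr_deriv ?_
      simp
    refine ((h1.ofReal_comp.const_mul (Complex.I / 2)).neg.cexp).congr_deriv ?_
    simp
  refine ((hphase.smul hcomp).congr_deriv ?_).congr_of_eventuallyEq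
    (Filter.Eventually.of_forall fun t => ?_)
  · simp
  · simp only [Pi.smul_apply']
    rw [hW.apply_apply, smul_smul, ← Complex.exp_add]
    simp [smul_add]

theorem hasDerivAt_sum {κ : Type*} {z : κ → M} {x : E} {y : κ → E} (s : Finset κ)
    (h : ∀ i ∈ s, HasDerivAt (fun t : ℝ => W (t • z i) x) (Complex.I • y i) 0) :
    HasDerivAt (fun t : ℝ => W (t • ∑ i ∈ s, z i) x) (Complex.I • ∑ i ∈ s, y i) 0 := by
  induction s using Finset.cons_induction with
  | empty => simpa [hW.zero_apply] using hasDerivAt_const (0 : ℝ) x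
  | cons i s hi ih =>
    simp only [Finset.sum_cons]
    exact hW.hasDerivAt_add (h i (Finset.mem_cons_self _ _))
      (ih fun j hj => h j (Finset.mem_cons_of_mem hj))

/-- Commuting the operators costs only a smooth phase. This invariance feeds the criterion for
essential self-adjointness. -/
theorem apply_mem_domain {z : M} {x : E} (w : M)
    (h : x ∈ (stoneGenerator fun t : ℝ => W (t • z)).domain) :
    W w x ∈ (stoneGenerator fun t : ℝ => W (t • z)).domain := by
  change DifferentiableAt ℝ (fun t : ℝ => W (t • z) (W w x)) 0
  have h1 : (fun t : ℝ => W (t • z) (W w x)) =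
      fun t : ℝ => Complex.exp (Complex.I * ((t * B z w : ℝ) : ℂ)) • W w (W (t • z) x) := by
    funext t
    rw [hW.apply_comm]
    simp
  rw [h1]
  have h2 : DifferentiableAt ℝ (fun t : ℝ => W w (W (t • z) x)) 0 :=
    ((W w).restrictScalars ℝ).differentiableAt.comp _ h
  refine DifferentiableAt.smul ?_ h2
  have h3 : DifferentiableAt ℝ (fun t : ℝ => Complex.I * ((t * B z w : ℝ) : ℂ)) 0 := by
    push_cast
    fun_prop
  exact h3.cexp

end IsProjRep

end ProjectiveRepresentations

/-! ### Graphs of sums of unbounded operators. -/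

section PartialSums

variable {R E F κ : Type*} [Ring R] [AddCommGroup E] [Module R E] [AddCommGroup F] [Module R F]

theorem mem_domain_sum {f : κ → E →ₗ.[R] F} {s : Finset κ} {x : E} :
    x ∈ (∑ i ∈ s, f i).domain ↔ ∀ i ∈ s, x ∈ (f i).domain := by
  induction s using Finset.cons_induction with
  | empty => simp
  | cons i s hi ih =>
    rw [Finset.sum_cons, LinearPMap.add_domain, Submodule.mem_inf, ih]
    simp

theorem mem_graph_add {f g : E →ₗ.[R] F} {x : E} {y : F} (h : (x, y) ∈ (f + g).graph) :
    ∃ u v, (x, u) ∈ f.graph ∧ (x, v) ∈ g.graph ∧ y = u + v := by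
  obtain ⟨⟨x, hx⟩, rfl, rfl⟩ := (LinearPMap.mem_graph_iff _).1 h
  exact ⟨f ⟨x, hx.1⟩, g ⟨x, hx.2⟩, f.mem_graph ⟨x, hx.1⟩, g.mem_graph ⟨x, hx.2⟩,
    LinearPMap.add_apply f g ⟨x, hx⟩⟩

theorem mem_graph_sub {f g : E →ₗ.[R] F} {x : E} {y : F} (h : (x, y) ∈ (f - g).graph) :
    ∃ u v, (x, u) ∈ f.graph ∧ (x, v) ∈ g.graph ∧ y = u - v := by
  obtain ⟨⟨x, hx⟩, rfl, rfl⟩ := (LinearPMap.mem_graph_iff _).1 h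
  exact ⟨f ⟨x, hx.1⟩, g ⟨x, hx.2⟩, f.mem_graph ⟨x, hx.1⟩, g.mem_graph ⟨x, hx.2⟩,
    LinearPMap.sub_apply f g ⟨x, hx⟩⟩

theorem mem_graph_sum {f : κ → E →ₗ.[R] F} {s : Finset κ} {x : E} {y : F}
    (h : (x, y) ∈ (∑ i ∈ s, f i).graph) :
    ∃ u : κ → F, (∀ i ∈ s, (x, u i) ∈ (f i).graph) ∧ y = ∑ i ∈ s, u i := by
  classical
  induction s using Finset.cons_induction generalizing y with
  | empty =>
    rw [Finset.sum_empty] at h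
    obtain ⟨x, rfl, hx⟩ := (LinearPMap.mem_graph_iff _).1 h
    exact ⟨0, by simp, hx.symm.trans (LinearPMap.zero_apply x)⟩
  | cons i s hi ih =>
    rw [Finset.sum_cons] at h
    obtain ⟨v, w, hv, hw, rfl⟩ := mem_graph_add h
    obtain ⟨u, hu, rfl⟩ := ih hw
    refine ⟨Function.update u i v, ?_, ?_⟩
    · intro j hj
      rcases Finset.mem_cons.1 hj with rfl | hj
      · simpa using hv
      · rw [Function.update_of_ne (ne_of_mem_of_not_mem hj hi)]
        exact hu j hj
    · rw [Finset.sum_cons, Function.update_self]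
      congr 1
      refine Finset.sum_congr rfl fun j hj => ?_
      rw [Function.update_of_ne (ne_of_mem_of_not_mem hj hi)]

end PartialSums

theorem mem_graph_smul {E F : Type*} [AddCommGroup E] [Module ℂ E] [AddCommGroup F] [Module ℂ F]
    {f : E →ₗ.[ℂ] F} {c : ℝ} {x : E} {y : F} (h : (x, y) ∈ (c • f).graph) :
    ∃ u, (x, u) ∈ f.graph ∧ y = (c : ℂ) • u := by
  obtain ⟨x, rfl, rfl⟩ := (LinearPMap.mem_graph_iff _).1 h
  exact ⟨f x, f.mem_graph x, by rw [LinearPMap.smul_apply, Complex.coe_smul]⟩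

section WeightedSums

variable {s : ℕ} {E : Type*} [NormedAddCommGroup E] [InnerProductSpace ℂ E]
  {B : Z s →ₗ[ℝ] Z s →ₗ[ℝ] ℝ} {W : Z s → E →L[ℂ] E}

theorem IsProjRep.hasDerivAt_of_mem_graph (hW : IsProjRep B W) {c : Z s} {x y : E}
    (h : (x, y) ∈ (∑ k, c k • canonicalVariables W k).graph) :
    HasDerivAt (fun t : ℝ => W (t • c) x) (Complex.I • y) 0 := by
  obtain ⟨u, hu, rfl⟩ := mem_graph_sum h
  have h1 : c = ∑ k, c k • (Pi.single k 1 : Z s) := by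
    rw [← pi_eq_sum_univ' c]
  rw [h1]
  refine hW.hasDerivAt_sum _ fun k hk => ?_
  obtain ⟨v, hv, hvu⟩ := mem_graph_smul (hu k hk)
  rw [hvu]
  exact IsProjRep.hasDerivAt_smul (mem_graph_stoneGenerator.1 hv) (c k)

end WeightedSums

section GeneratorGraphs

variable {E F : Type*} [NormedAddCommGroup E] [InnerProductSpace ℂ E]
  [NormedAddCommGroup F] [InnerProductSpace ℂ F]

theorem map_mem_graph_stoneGenerator {U : ℝ → E →L[ℂ] E} {V : ℝ → F →L[ℂ] F} (L : E →L[ℂ] F)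
    (hL : ∀ t x, V t (L x) = L (U t x)) {x y : E} (h : (x, y) ∈ (stoneGenerator U).graph) :
    (L x, L y) ∈ (stoneGenerator V).graph := by
  rw [mem_graph_stoneGenerator] at h ⊢
  simp_rw [hL]
  rw [← L.map_smul]
  exact (L.restrictScalars ℝ).hasFDerivAt.comp_hasDerivAt 0 h

namespace IsProjRep

variable {M : Type*} [AddCommGroup M] [Module ℝ M] {B : M →ₗ[ℝ] M →ₗ[ℝ] ℝ} {W : M → E →L[ℂ] E}

theorem mem_graph_smul {z : M} {x y : E}
    (h : (x, y) ∈ (stoneGenerator fun t : ℝ => W (t • z)).graph) (c : ℝ) :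
    (x, (c : ℂ) • y) ∈ (stoneGenerator fun t : ℝ => W (t • c • z)).graph :=
  mem_graph_stoneGenerator.2 (hasDerivAt_smul (mem_graph_stoneGenerator.1 h) c)

theorem mem_graph_add (hW : IsProjRep B W) {z z' : M} {x y y' : E}
    (h : (x, y) ∈ (stoneGenerator fun t : ℝ => W (t • z)).graph)
    (h' : (x, y') ∈ (stoneGenerator fun t : ℝ => W (t • z')).graph) :
    (x, y + y') ∈ (stoneGenerator fun t : ℝ => W (t • (z + z'))).graph :=
  mem_graph_stoneGenerator.2
    (hW.hasDerivAt_add (mem_graph_stoneGenerator.1 h) (mem_graph_stoneGenerator.1 h'))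

theorem mem_graph_sum (hW : IsProjRep B W) {κ : Type*} {z : κ → M} {x : E} {y : κ → E}
    (s : Finset κ) (h : ∀ i ∈ s, (x, y i) ∈ (stoneGenerator fun t : ℝ => W (t • z i)).graph) :
    (x, ∑ i ∈ s, y i) ∈ (stoneGenerator fun t : ℝ => W (t • ∑ i ∈ s, z i)).graph :=
  mem_graph_stoneGenerator.2
    (hW.hasDerivAt_sum s fun i hi => mem_graph_stoneGenerator.1 (h i hi))

end IsProjRep

theorem continuous_apply_of_dense {U : ℝ → E →L[ℂ] E} (hU : ∀ t x, ‖U t x‖ = ‖x‖) {S : Set E}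
    (hS : Dense S) (h : ∀ x ∈ S, Continuous fun t => U t x) (x : E) :
    Continuous fun t => U t x := by
  refine continuous_of_uniform_approx_of_continuous fun u hu => ?_
  obtain ⟨ε, hε, hεu⟩ := Metric.mem_uniformity_dist.1 hu
  obtain ⟨y, hy, hxy⟩ := Metric.dense_iff.1 hS x ε hε
  refine ⟨_, h y hxy, fun t => hεu ?_⟩
  rw [dist_eq_norm, ← map_sub, hU, ← dist_eq_norm, dist_comm]
  exact Metric.mem_ball.1 hy

end GeneratorGraphs

/-! ### Representations and generators on the Hilbert space tensor product. -/

section TensorRepresentations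

variable {HA HB : Type*}
  [NormedAddCommGroup HA] [InnerProductSpace ℂ HA]
  [NormedAddCommGroup HB] [InnerProductSpace ℂ HB]

/-- The operator `f ⊗ g` on the Hilbert space tensor product. -/
def hmap (f : HB →L[ℂ] HB) (g : HA →L[ℂ] HA) : HTensor HB HA →L[ℂ] HTensor HB HA :=
  (TensorProduct.mapL f g).completion

theorem hmap_incl (f : HB →L[ℂ] HB) (g : HA →L[ℂ] HA) (u : HB ⊗[ℂ] HA) :
    hmap f g (incl u) = incl (TensorProduct.map (f : HB →ₗ[ℂ] HB) (g : HA →ₗ[ℂ] HA) u) :=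
  (ContinuousLinearMap.completion_apply_coe (TensorProduct.mapL f g) u).trans
    (congrArg incl (TensorProduct.mapL_apply f g u))

theorem norm_incl (u : HB ⊗[ℂ] HA) : ‖(incl u : HTensor HB HA)‖ = ‖u‖ :=
  UniformSpace.Completion.norm_coe u

theorem inner_incl (u v : HB ⊗[ℂ] HA) :
    ⟪(incl u : HTensor HB HA), incl v⟫_ℂ = ⟪u, v⟫_ℂ :=
  UniformSpace.Completion.inner_coe u v

theorem continuous_incl : Continuous (incl : HB ⊗[ℂ] HA → HTensor HB HA) :=
  UniformSpace.Completion.continuous_coe _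

theorem denseRange_incl : DenseRange (incl : HB ⊗[ℂ] HA → HTensor HB HA) :=
  UniformSpace.Completion.denseRange_coe

theorem norm_hmap {f : HB →L[ℂ] HB} {g : HA →L[ℂ] HA} (hf : ∀ x, ‖f x‖ = ‖x‖)
    (hg : ∀ x, ‖g x‖ = ‖x‖) (v : HTensor HB HA) : ‖hmap f g v‖ = ‖v‖ := by
  refine isClosed_property denseRange_incl (p := fun v => ‖hmap f g v‖ = ‖v‖)
    (isClosed_eq (hmap f g).continuous.norm continuous_norm) (fun u => ?_) v
  rw [hmap_incl, norm_incl, norm_incl]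
  exact TensorProduct.norm_map (⟨f, hf⟩ : HB →ₗᵢ[ℂ] HB) (⟨g, hg⟩ : HA →ₗᵢ[ℂ] HA) u

theorem hTensor_ext {f g : HTensor HB HA →L[ℂ] HTensor HB HA}
    (h : ∀ x y, f (incl (x ⊗ₜ y)) = g (incl (x ⊗ₜ y))) : f = g := by
  ext v
  refine isClosed_property denseRange_incl (p := fun v => f v = g v)
    (isClosed_eq f.continuous g.continuous) (fun u => ?_) v
  induction u using TensorProduct.induction_on with
  | zero => simp
  | tmul x y => exact h x y
  | add u u' hu hu' => simp only [map_add, hu, hu']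

/-- The multipliers of the factors multiply, so their forms add. Continuity need only be checked on
the algebraic tensor product, since the operators are isometric. -/
theorem IsProjRep.tensor {M N : Type*} [AddCommGroup M] [Module ℝ M] [AddCommGroup N] [Module ℝ N]
    {B : M →ₗ[ℝ] M →ₗ[ℝ] ℝ} {C : N →ₗ[ℝ] N →ₗ[ℝ] ℝ} {V : M → HB →L[ℂ] HB} {W : N → HA →L[ℂ] HA}
    (hV : IsProjRep B V) (hW : IsProjRep C W) :
    IsProjRep (B.compl₁₂ (LinearMap.fst ℝ M N) (LinearMap.fst ℝ M N) +
      C.compl₁₂ (LinearMap.snd ℝ M N) (LinearMap.snd ℝ M N))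
      (fun p : M × N => hmap (V p.1) (W p.2)) where
  alternating z := by simp [hV.alternating, hW.alternating]
  norm_map z := norm_hmap (hV.norm_map _) (hW.norm_map _)
  zero_apply x := by
    have : hmap (V 0) (W 0) = ContinuousLinearMap.id ℂ (HTensor HB HA) := hTensor_ext fun x y => by
      simp [hmap_incl, hV.zero_apply, hW.zero_apply]
    exact congrArg (fun T => T x) this
  apply_apply z z' x := by
    have : (hmap (V z.1) (W z.2)).comp (hmap (V z'.1) (W z'.2)) =
        Complex.exp (Complex.I / 2 * (B z.1 z'.1 + C z.2 z'.2 : ℝ)) •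
          hmap (V (z.1 + z'.1)) (W (z.2 + z'.2)) := hTensor_ext fun x y => by
      simp only [ContinuousLinearMap.comp_apply, hmap_incl, TensorProduct.map_tmul,
        ContinuousLinearMap.coe_coe, hV.apply_apply, hW.apply_apply, _root_.smul_apply,
        TensorProduct.smul_tmul_smul, map_smul, ← Complex.exp_add]
      congr 2
      push_cast
      ring
    exact congrArg (fun T => T x) this
  continuous_line z := by
    refine continuous_apply_of_dense (U := fun t : ℝ => hmap (V (t • z).1) (W (t • z).2))
      (fun t => norm_hmap (hV.norm_map _) (hW.norm_map _)) denseRange_incl ?_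
    rintro _ ⟨u, rfl⟩
    simp_rw [hmap_incl]
    refine continuous_incl.comp ?_
    induction u using TensorProduct.induction_on with
    | zero => simpa using continuous_const
    | tmul x y =>
      simp only [TensorProduct.map_tmul, ContinuousLinearMap.coe_coe, Prod.smul_fst, Prod.smul_snd]
      exact TensorProduct.continuous_tmul.comp
        ((hV.continuous_line z.1 x).prodMk (hW.continuous_line z.2 y))
    | add u u' hu hu' =>
      simp only [map_add]
      exact hu.add hu'

theorem mem_graph_tensorId {A : HB →ₗ.[ℂ] HB} {x y : HTensor HB HA}
    (h : (x, y) ∈ (tensorId A : HTensor HB HA →ₗ.[ℂ] HTensor HB HA).graph) :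
    ∃ m : A.domain ⊗[ℂ] HA, x = incl (TensorProduct.map A.domain.subtype LinearMap.id m) ∧
      y = incl (TensorProduct.map A.toFun LinearMap.id m) := by
  obtain ⟨⟨_, m, rfl⟩, rfl, rfl⟩ := (LinearPMap.mem_graph_iff _).1 h
  refine ⟨m, rfl, ?_⟩
  change (incl ∘ₗ TensorProduct.map A.toFun (LinearMap.id : HA →ₗ[ℂ] HA))
    ((LinearEquiv.ofInjective _ _).symm ⟨_, _⟩) = _
  rw [LinearMap.comp_apply]
  congr 2
  exact (LinearEquiv.ofInjective _ _).symm_apply_apply m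

theorem mem_graph_idTensor {A : HA →ₗ.[ℂ] HA} {x y : HTensor HB HA}
    (h : (x, y) ∈ (idTensor A : HTensor HB HA →ₗ.[ℂ] HTensor HB HA).graph) :
    ∃ m : HB ⊗[ℂ] A.domain, x = incl (TensorProduct.map LinearMap.id A.domain.subtype m) ∧
      y = incl (TensorProduct.map LinearMap.id A.toFun m) := by
  obtain ⟨⟨_, m, rfl⟩, rfl, rfl⟩ := (LinearPMap.mem_graph_iff _).1 h
  refine ⟨m, rfl, ?_⟩
  change (incl ∘ₗ TensorProduct.map (LinearMap.id : HB →ₗ[ℂ] HB) A.toFun)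
    ((LinearEquiv.ofInjective _ _).symm ⟨_, _⟩) = _
  rw [LinearMap.comp_apply]
  congr 2
  exact (LinearEquiv.ofInjective _ _).symm_apply_apply m

/-- `ψ ↦ ψ ⊗ h` as a map to the Hilbert space tensor product. -/
def tmulRight (h : HA) : HB →L[ℂ] HTensor HB HA :=
  UniformSpace.Completion.toComplL.comp ((TensorProduct.mkL ℂ HB HA).flip h)

/-- `ψ ↦ h ⊗ ψ` as a map to the Hilbert space tensor product. -/
def tmulLeft (h : HB) : HA →L[ℂ] HTensor HB HA :=
  UniformSpace.Completion.toComplL.comp (TensorProduct.mkL ℂ HB HA h)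

/-- For fixed h the bounded map ψ ↦ ψ ⊗ h intertwines the two families and so carries one graph into
the other; sums of elementary tensors follow because a graph is a subspace. -/
theorem mem_graph_of_tensorId {A : HB →ₗ.[ℂ] HB} {U : ℝ → HB →L[ℂ] HB}
    {V : ℝ → HTensor HB HA →L[ℂ] HTensor HB HA} (hA : A.graph ≤ (stoneGenerator U).graph)
    (hV : ∀ t x h, V t (incl (x ⊗ₜ h)) = incl (U t x ⊗ₜ h)) {x y : HTensor HB HA}
    (h : (x, y) ∈ (tensorId A : HTensor HB HA →ₗ.[ℂ] HTensor HB HA).graph) :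
    (x, y) ∈ (stoneGenerator V).graph := by
  obtain ⟨m, rfl, rfl⟩ := mem_graph_tensorId h
  clear h
  induction m using TensorProduct.induction_on with
  | zero => simp only [map_zero]; exact Submodule.zero_mem _
  | tmul u h =>
    exact map_mem_graph_stoneGenerator (tmulRight h) (fun t x => hV t x h) (hA (A.mem_graph u))
  | add m m' hm hm' => simp only [map_add]; exact Submodule.add_mem _ hm hm'

theorem mem_graph_of_idTensor {A : HA →ₗ.[ℂ] HA} {U : ℝ → HA →L[ℂ] HA}
    {V : ℝ → HTensor HB HA →L[ℂ] HTensor HB HA} (hA : A.graph ≤ (stoneGenerator U).graph)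
    (hV : ∀ t h x, V t (incl (h ⊗ₜ x)) = incl (h ⊗ₜ U t x)) {x y : HTensor HB HA}
    (h : (x, y) ∈ (idTensor A : HTensor HB HA →ₗ.[ℂ] HTensor HB HA).graph) :
    (x, y) ∈ (stoneGenerator V).graph := by
  obtain ⟨m, rfl, rfl⟩ := mem_graph_idTensor h
  clear h
  induction m using TensorProduct.induction_on with
  | zero => simp only [map_zero]; exact Submodule.zero_mem _
  | tmul h u =>
    exact map_mem_graph_stoneGenerator (tmulLeft h) (fun t x => hV t h x) (hA (A.mem_graph u))
  | add m m' hm hm' => simp only [map_add]; exact Submodule.add_mem _ hm hm'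

theorem hmap_mem_domain_tensorId {A : HB →ₗ.[ℂ] HB} {f : HB →L[ℂ] HB} (g : HA →L[ℂ] HA)
    (hf : ∀ x ∈ A.domain, f x ∈ A.domain) {v : HTensor HB HA}
    (h : v ∈ (tensorId A : HTensor HB HA →ₗ.[ℂ] HTensor HB HA).domain) :
    hmap f g v ∈ (tensorId A : HTensor HB HA →ₗ.[ℂ] HTensor HB HA).domain := by
  obtain ⟨m, rfl⟩ := h
  induction m using TensorProduct.induction_on with
  | zero => simp only [map_zero]; exact Submodule.zero_mem _
  | tmul u h => exact ⟨⟨f u, hf u u.2⟩ ⊗ₜ g h, (hmap_incl f g ((u : HB) ⊗ₜ h)).symm⟩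
  | add m m' hm hm' => simp only [map_add]; exact Submodule.add_mem _ hm hm'

theorem hmap_mem_domain_idTensor {A : HA →ₗ.[ℂ] HA} (f : HB →L[ℂ] HB) {g : HA →L[ℂ] HA}
    (hg : ∀ x ∈ A.domain, g x ∈ A.domain) {v : HTensor HB HA}
    (h : v ∈ (idTensor A : HTensor HB HA →ₗ.[ℂ] HTensor HB HA).domain) :
    hmap f g v ∈ (idTensor A : HTensor HB HA →ₗ.[ℂ] HTensor HB HA).domain := by
  obtain ⟨m, rfl⟩ := h
  induction m using TensorProduct.induction_on with
  | zero => simp only [map_zero]; exact Submodule.zero_mem _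
  | tmul h u => exact ⟨f h ⊗ₜ ⟨g u, hg u u.2⟩, (hmap_incl f g (h ⊗ₜ (u : HA))).symm⟩
  | add m m' hm hm' => simp only [map_add]; exact Submodule.add_mem _ hm hm'

theorem tmul_mem_domain_tensorId {A : HB →ₗ.[ℂ] HB} {x : HB} (hx : x ∈ A.domain) (y : HA) :
    incl (x ⊗ₜ y) ∈ (tensorId A : HTensor HB HA →ₗ.[ℂ] HTensor HB HA).domain :=
  ⟨⟨x, hx⟩ ⊗ₜ y, rfl⟩

theorem tmul_mem_domain_idTensor {A : HA →ₗ.[ℂ] HA} (x : HB) {y : HA} (hy : y ∈ A.domain) :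
    incl (x ⊗ₜ y) ∈ (idTensor A : HTensor HB HA →ₗ.[ℂ] HTensor HB HA).domain :=
  ⟨x ⊗ₜ ⟨y, hy⟩, rfl⟩

theorem dense_of_tmul_mem {S : Set HB} {T : Set HA} (hS : Dense S) (hT : Dense T)
    {D : Submodule ℂ (HTensor HB HA)} (hD : ∀ x ∈ S, ∀ y ∈ T, incl (x ⊗ₜ y) ∈ D) :
    Dense (D : Set (HTensor HB HA)) := by
  have h1 : ∀ x y, incl (x ⊗ₜ y) ∈ D.topologicalClosure := by
    intro x y
    have hcl : IsClosed {p : HB × HA | incl (p.1 ⊗ₜ p.2) ∈ D.topologicalClosure} :=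
      D.isClosed_topologicalClosure.preimage
        (continuous_incl.comp TensorProduct.continuous_tmul)
    exact closure_minimal (s := S ×ˢ T) (fun p hp => D.le_topologicalClosure
      (hD p.1 hp.1 p.2 hp.2)) hcl ((hS.prod hT) (x, y))
  have h2 : ∀ u, incl u ∈ D.topologicalClosure := by
    intro u
    induction u using TensorProduct.induction_on with
    | zero => rw [map_zero]; exact Submodule.zero_mem _
    | tmul x y => exact h1 x y
    | add u u' hu hu' => rw [map_add]; exact Submodule.add_mem _ hu hu'
  exact fun v => isClosed_property denseRange_incl (p := fun v => v ∈ D.topologicalClosure)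
    D.isClosed_topologicalClosure h2 v

end TensorRepresentations

/-! ### The operators R_BA·z and their exponentials. -/

section GaussianExponential

/-- The symplectic form as a bilinear map. -/
def sympBilin (s : ℕ) : Z s →ₗ[ℝ] Z s →ₗ[ℝ] ℝ :=
  LinearMap.mk₂ ℝ symp symp_add_left symp_smul_left symp_add_right symp_smul_right

theorem sympBilin_apply {s : ℕ} (z z' : Z s) : sympBilin s z z' = symp z z' := rfl

theorem WeylSystem.isProjRep {s : ℕ} {H : Type*} [NormedAddCommGroup H] [InnerProductSpace ℂ H]
    [CompleteSpace H] (W : WeylSystem s H) : IsProjRep (sympBilin s) W.W where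
  alternating := symp_self
  norm_map := W.norm_map
  zero_apply := W.zero_apply
  apply_apply := W.apply_apply
  continuous_line z x := (W.continuous x).comp (by fun_prop)

variable {ι HA HB : Type*}
  [NormedAddCommGroup HA] [InnerProductSpace ℂ HA] [CompleteSpace HA]
  [NormedAddCommGroup HB] [InnerProductSpace ℂ HB] [CompleteSpace HB]
  {sA sB : ℕ} (b : HilbertBasis ι ℂ HA) (WA : WeylSystem sA HA) (WB : WeylSystem sB HB)
  (K : Matrix (Fin 2 × Fin sA) (Fin 2 × Fin sB) ℝ)

theorem transpose_weyl_apply (z : Z sA) (x : HA) :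
    transpose b (WA.W z) x = conjugation b (WA.W (-z) (conjugation b x)) := by
  rw [transpose_apply]
  congr 1
  refine ext_inner_left ℂ fun y => ?_
  rw [ContinuousLinearMap.adjoint_inner_right, WA.inner_apply_left]

/-- Transposition reverses products, which changes the sign of the form. -/
theorem isProjRep_transpose :
    IsProjRep (-sympBilin sA) fun z => transpose b (WA.W z) where
  alternating z := by simp [sympBilin_apply, symp_self]
  norm_map z x := by
    rw [transpose_weyl_apply, LinearIsometryEquiv.norm_map, WA.norm_map,
      LinearIsometryEquiv.norm_map]
  zero_apply x := by
    rw [transpose_weyl_apply, neg_zero, WA.zero_apply, conjugation_conjugation]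
  apply_apply z z' x := by
    rw [transpose_weyl_apply, transpose_weyl_apply, transpose_weyl_apply, conjugation_conjugation,
      WA.apply_apply, LinearIsometryEquiv.map_smulₛₗ, ← Complex.exp_conj, neg_add]
    congr 2
    simp [sympBilin_apply, symp_neg_left, symp_neg_right,
      show (starRingEnd ℂ) 2 = 2 from map_ofNat _ 2]
    ring
  continuous_line z x := by
    simp_rw [transpose_weyl_apply]
    exact (conjugation b).continuous.comp ((WA.continuous _).comp (by fun_prop))

/-- The representation `(z, z') ↦ W_B(z) ⊗ W_A(z')ᵀ`. -/
def jointWeyl (p : Z sB × Z sA) : HTensor HB HA →L[ℂ] HTensor HB HA :=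
  hmap (WB.W p.1) (transpose b (WA.W p.2))

theorem isProjRep_jointWeyl : ∃ B, IsProjRep B (jointWeyl b WA WB) := by
  have h := WB.isProjRep.tensor (isProjRep_transpose b WA)
  have e : jointWeyl b WA WB = fun p => hmap (WB.W p.1) (transpose b (WA.W p.2)) := rfl
  rw [e]
  exact ⟨_, h⟩

/-- The label (z, -Kz) equals ∑ zⱼ (eⱼ, -Keⱼ), and real combinations of labels correspond to
combinations of generators, taken on a common domain vector. -/
theorem mem_graph_of_dotOp {z : Z sB} {x y : HTensor HB HA}
    (h : (x, y) ∈ (dotOp (RBA b WA WB K) z).graph) :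
    (x, y) ∈ (stoneGenerator fun t : ℝ => jointWeyl b WA WB (t • (z, -(K *ᵥ z)))).graph := by
  obtain ⟨B, hB⟩ := isProjRep_jointWeyl b WA WB
  obtain ⟨u, hu, rfl⟩ := mem_graph_sum h
  have hz : (z, -(K *ᵥ z)) = ∑ j, z j • ((Pi.single j 1 : Z sB), -(K *ᵥ Pi.single j 1)) := by
    have h1 : z = ∑ j, z j • (Pi.single j 1 : Z sB) := pi_eq_sum_univ' z
    have h2 : K *ᵥ z = ∑ j, z j • K *ᵥ (Pi.single j 1 : Z sB) := by
      conv_lhs => rw [h1]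
      rw [Matrix.mulVec_sum]
      simp only [Matrix.mulVec_smul]
    refine Prod.ext ?_ ?_
    · simpa [Prod.fst_sum] using h1
    · simpa [Prod.snd_sum] using h2
  rw [hz]
  refine hB.mem_graph_sum _ fun j hj => ?_
  obtain ⟨v, hv, hvu⟩ := CJ.mem_graph_smul (hu j hj)
  rw [hvu]
  refine IsProjRep.mem_graph_smul ?_ (z j)
  obtain ⟨p, q, hp, hq, rfl⟩ := mem_graph_sub hv
  have h1 : (x, p) ∈ (stoneGenerator fun t : ℝ =>
      jointWeyl b WA WB (t • ((Pi.single j 1 : Z sB), (0 : Z sA)))).graph := by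
    refine mem_graph_of_tensorId (U := fun t : ℝ => WB.W (t • Pi.single j 1)) le_rfl
      (fun t x' h' => ?_) hp
    rw [jointWeyl, hmap_incl, TensorProduct.map_tmul]
    simp [(isProjRep_transpose b WA).zero_apply]
  have h2 : (x, q) ∈ (stoneGenerator fun t : ℝ =>
      jointWeyl b WA WB (t • ((0 : Z sB), K *ᵥ Pi.single j 1))).graph := by
    refine mem_graph_of_idTensor
      (U := fun t : ℝ => transpose b (WA.W (t • K *ᵥ Pi.single j 1))) ?_ (fun t h' x' => ?_) hq
    · rintro ⟨x', y'⟩ hxy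
      refine mem_graph_stoneGenerator.2
        ((isProjRep_transpose b WA).hasDerivAt_of_mem_graph ?_)
      rw [Matrix.mulVec_single_one]
      exact hxy
    · rw [jointWeyl, hmap_incl, TensorProduct.map_tmul]
      simp [WB.zero_apply]
  have h3 := hB.mem_graph_add h1 (IsProjRep.mem_graph_smul h2 (-1))
  have e1 : p - q = p + ((-1 : ℝ) : ℂ) • q := by push_cast; module
  have e2 : ((Pi.single j 1 : Z sB), -(K *ᵥ Pi.single j 1)) =
      ((Pi.single j 1 : Z sB), (0 : Z sA)) + (-1 : ℝ) • ((0 : Z sB), K *ᵥ Pi.single j 1) := by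
    ext <;> simp
  rw [e1, e2]
  exact h3

theorem mem_domain_dotOp {z : Z sB} {x : HTensor HB HA} :
    x ∈ (dotOp (RBA b WA WB K) z).domain ↔ ∀ j,
      x ∈ (tensorId (canonicalVariables WB.W j) : HTensor HB HA →ₗ.[ℂ] HTensor HB HA).domain ∧
      x ∈ (idTensor (∑ k, K k j • canonicalVariables (fun z => transpose b (WA.W z)) k) :
        HTensor HB HA →ₗ.[ℂ] HTensor HB HA).domain := by
  rw [dotOp, mem_domain_sum]
  simp only [Finset.mem_univ, true_imp_iff]
  rfl

/-- The domain contains all ψ_B ⊗ ψ_A with ψ_B and the conjugate of ψ_A smooth. -/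
theorem dense_domain_dotOp (z : Z sB) :
    Dense ((dotOp (RBA b WA WB K) z).domain : Set (HTensor HB HA)) := by
  have hA : Dense ((conjugation b) ⁻¹' (WA.smoothVectors : Set HA)) :=
    WA.dense_smoothVectors.preimage (conjugation b).toHomeomorph.isOpenMap
  refine dense_of_tmul_mem WB.dense_smoothVectors hA fun x hx y hy => ?_
  refine (mem_domain_dotOp b WA WB K).2 fun j => ⟨tmul_mem_domain_tensorId ?_ _,
    tmul_mem_domain_idTensor _ (mem_domain_sum.2 fun k _ => ?_)⟩
  · exact WB.mem_smoothVectors.1 hx _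
  · change DifferentiableAt ℝ (fun t : ℝ => transpose b (WA.W (t • Pi.single k 1)) y) 0
    have h1 : (fun t : ℝ => transpose b (WA.W (t • Pi.single k 1)) y) =
        fun t : ℝ => conjugation b (WA.W (t • -Pi.single k 1) (conjugation b y)) := by
      funext t
      rw [transpose_weyl_apply, smul_neg]
    rw [h1]
    -- Conjugation is antilinear, so derivatives pass through it as through a real-linear map.
    let J : HA →L[ℝ] HA :=
      { toFun := conjugation b
        map_add' := map_add _
        map_smul' := fun r x => by
          rw [← Complex.coe_smul, LinearIsometryEquiv.map_smulₛₗ, Complex.conj_ofReal]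
          simp
        cont := (conjugation b).continuous }
    exact J.differentiableAt.comp 0 (WA.mem_smoothVectors.1 hy (-Pi.single k 1))

theorem jointWeyl_mem_domain {z : Z sB} (p : Z sB × Z sA) {x : HTensor HB HA}
    (h : x ∈ (dotOp (RBA b WA WB K) z).domain) :
    jointWeyl b WA WB p x ∈ (dotOp (RBA b WA WB K) z).domain := by
  rw [mem_domain_dotOp] at h ⊢
  refine fun j => ⟨hmap_mem_domain_tensorId _ (fun x hx => ?_) (h j).1,
    hmap_mem_domain_idTensor _ (fun x hx => ?_) (h j).2⟩
  · exact WB.isProjRep.apply_mem_domain p.1 hx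
  · exact mem_domain_sum.2 fun k hk =>
      (isProjRep_transpose b WA).apply_mem_domain p.2 (mem_domain_sum.1 hx k hk)

theorem isExpGroup_jointWeyl (z : Z sB) :
    IsExpGroup (dotOp (RBA b WA WB K) z)
      fun t : ℝ => jointWeyl b WA WB (t • (z, -(K *ᵥ z))) := by
  obtain ⟨B, hB⟩ := isProjRep_jointWeyl b WA WB
  have hU := hB.isUnitaryGroup (z, -(K *ᵥ z))
  exact ⟨hU, hU.stoneGenerator_eq_closure
    (fun x y h => mem_graph_stoneGenerator.1 (mem_graph_of_dotOp b WA WB K h))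
    (dense_domain_dotOp b WA WB K z) fun t x hx => jointWeyl_mem_domain b WA WB K _ hx⟩

theorem isExpGroup_expI_dotOp (z : Z sB) :
    IsExpGroup (dotOp (RBA b WA WB K) z) (expI (dotOp (RBA b WA WB K) z)) :=
  (expI_eq (isExpGroup_jointWeyl b WA WB K z) (dense_domain_dotOp b WA WB K z)).1

theorem expI_dotOp_incl (z : Z sB) (t : ℝ) (y : HB ⊗[ℂ] HA) :
    expI (dotOp (RBA b WA WB K) z) t (incl y) =
      incl (TensorProduct.map (WB.W (t • z) : HB →ₗ[ℂ] HB)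
        (transpose b (WA.W (-(t • K *ᵥ z))) : HA →ₗ[ℂ] HA) y) := by
  rw [(expI_eq (isExpGroup_jointWeyl b WA WB K z) (dense_domain_dotOp b WA WB K z)).2,
    ← smul_neg]
  exact hmap_incl _ _ y

end GaussianExponential

end CJ

end

/-! ### The main theorem. -/

theorem mainTheorem6 {ι HA HB : Type*}
    [NormedAddCommGroup HA] [InnerProductSpace ℂ HA] [CompleteSpace HA]
    [NormedAddCommGroup HB] [InnerProductSpace ℂ HB] [CompleteSpace HB]
    {sA sB : ℕ} (WA : CJ.WeylSystem sA HA) (WB : CJ.WeylSystem sB HB)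
    (b : HilbertBasis ι ℂ HA)
    (Φ : CJ.traceClass HA →ₗ[ℂ] CJ.traceClass HB) (hΦ : CJ.IsChannel b Φ) :
    -- the dual map is well defined
    (∀ X : HB →L[ℂ] HB, CJ.IsDualValue Φ X (CJ.dual Φ X) ∧
      ∀ Y : HA →L[ℂ] HA, CJ.IsDualValue Φ X Y → Y = CJ.dual Φ X) ∧
    -- the inversion formula, as an equality of forms on the algebraic tensor product
    (∀ x y : HB ⊗[ℂ] HA,
      Integrable (fun z : CJ.Z sB => ⟪x, TensorProduct.map (WB.W (-z) : HB →ₗ[ℂ] HB)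
        (CJ.transpose b (CJ.dual Φ (WB.W z)) : HA →ₗ[ℂ] HA) y⟫_ℂ) ∧
      CJ.cjForm b Φ x y = ((2 * Real.pi : ℂ) ^ sB)⁻¹ *
        ∫ z : CJ.Z sB, ⟪x, TensorProduct.map (WB.W (-z) : HB →ₗ[ℂ] HB)
          (CJ.transpose b (CJ.dual Φ (WB.W z)) : HA →ₗ[ℂ] HA) y⟫_ℂ) ∧
    -- Gaussian channels
    (∀ (K : Matrix (Fin 2 × Fin sA) (Fin 2 × Fin sB) ℝ)
      (μ : Matrix (Fin 2 × Fin sB) (Fin 2 × Fin sB) ℝ), CJ.IsGaussian WA WB K μ Φ →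
      (∀ x y : HB ⊗[ℂ] HA,
        Integrable (fun z : CJ.Z sB => ⟪x, TensorProduct.map (WB.W (-z) : HB →ₗ[ℂ] HB)
          (CJ.transpose b (WA.W (K *ᵥ z)) : HA →ₗ[ℂ] HA) y⟫_ℂ *
            (Real.exp (-(1 / 2) * (z ⬝ᵥ μ *ᵥ z)) : ℂ)) ∧
        CJ.cjForm b Φ x y = ((2 * Real.pi : ℂ) ^ sB)⁻¹ *
          ∫ z : CJ.Z sB, ⟪x, TensorProduct.map (WB.W (-z) : HB →ₗ[ℂ] HB)
            (CJ.transpose b (WA.W (K *ᵥ z)) : HA →ₗ[ℂ] HA) y⟫_ℂ *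
              (Real.exp (-(1 / 2) * (z ⬝ᵥ μ *ᵥ z)) : ℂ)) ∧
      -- `R_BA·z` is essentially self-adjoint and `exp(i R_BA·z) = W_B(z) ⊗ W_A(-Kz)ᵀ`
      (∀ z : CJ.Z sB,
        CJ.IsExpGroup (CJ.dotOp (CJ.RBA b WA WB K) z)
          (CJ.expI (CJ.dotOp (CJ.RBA b WA WB K) z)) ∧
        ∀ y : HB ⊗[ℂ] HA, CJ.expI (CJ.dotOp (CJ.RBA b WA WB K) z) 1 (CJ.incl y) =
          CJ.incl (TensorProduct.map (WB.W z : HB →ₗ[ℂ] HB)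
            (CJ.transpose b (WA.W (-(K *ᵥ z))) : HA →ₗ[ℂ] HA) y)) ∧
      ∀ x y : HB ⊗[ℂ] HA,
        Integrable (fun z : CJ.Z sB =>
          ⟪CJ.incl x, CJ.expI (CJ.dotOp (CJ.RBA b WA WB K) z) (-1) (CJ.incl y)⟫_ℂ *
            (Real.exp (-(1 / 2) * (z ⬝ᵥ μ *ᵥ z)) : ℂ)) ∧
        CJ.cjForm b Φ x y = ((2 * Real.pi : ℂ) ^ sB)⁻¹ *
          ∫ z : CJ.Z sB,
            ⟪CJ.incl x, CJ.expI (CJ.dotOp (CJ.RBA b WA WB K) z) (-1) (CJ.incl y)⟫_ℂ *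
              (Real.exp (-(1 / 2) * (z ⬝ᵥ μ *ᵥ z)) : ℂ)) := by
  have hst := hΦ.map_state
  have hinv := CJ.cjForm_eq_integral WB b hst
  refine ⟨fun X => ⟨CJ.isDualValue_dual hst X, fun Y hY => hY.unique (CJ.isDualValue_dual hst X)⟩,
    hinv, fun K μ hG => ?_⟩
  have hgauss : ∀ x y : HB ⊗[ℂ] HA,
      Integrable (fun z : CJ.Z sB => ⟪x, TensorProduct.map (WB.W (-z) : HB →ₗ[ℂ] HB)
        (CJ.transpose b (WA.W (K *ᵥ z)) : HA →ₗ[ℂ] HA) y⟫_ℂ *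
          (Real.exp (-(1 / 2) * (z ⬝ᵥ μ *ᵥ z)) : ℂ)) ∧
      CJ.cjForm b Φ x y = ((2 * Real.pi : ℂ) ^ sB)⁻¹ *
        ∫ z : CJ.Z sB, ⟪x, TensorProduct.map (WB.W (-z) : HB →ₗ[ℂ] HB)
          (CJ.transpose b (WA.W (K *ᵥ z)) : HA →ₗ[ℂ] HA) y⟫_ℂ *
            (Real.exp (-(1 / 2) * (z ⬝ᵥ μ *ᵥ z)) : ℂ) := by
    intro x y
    have h1 : ∀ z : CJ.Z sB, ⟪x, TensorProduct.map (WB.W (-z) : HB →ₗ[ℂ] HB)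
        (CJ.transpose b (CJ.dual Φ (WB.W z)) : HA →ₗ[ℂ] HA) y⟫_ℂ =
        ⟪x, TensorProduct.map (WB.W (-z) : HB →ₗ[ℂ] HB)
          (CJ.transpose b (WA.W (K *ᵥ z)) : HA →ₗ[ℂ] HA) y⟫_ℂ *
            (Real.exp (-(1 / 2) * (z ⬝ᵥ μ *ᵥ z)) : ℂ) := by
      intro z
      -- Transposition is linear, not antilinear, so the Gaussian factor leaves it unchanged.
      rw [hG.dual_weyl, CJ.transpose_smul, ContinuousLinearMap.toLinearMap_smul,
        TensorProduct.map_smul_right, LinearMap.smul_apply, inner_smul_right, mul_comm,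
        Complex.ofReal_exp]
    simpa only [h1, CJ.planck] using hinv x y
  refine ⟨hgauss, fun z => ⟨CJ.isExpGroup_expI_dotOp b WA WB K z, fun y => ?_⟩, fun x y => ?_⟩
  · simpa using CJ.expI_dotOp_incl b WA WB K z 1 y
  · have h1 : ∀ z : CJ.Z sB,
        ⟪(CJ.incl x : CJ.HTensor HB HA),
          CJ.expI (CJ.dotOp (CJ.RBA b WA WB K) z) (-1) (CJ.incl y)⟫_ℂ =
        ⟪x, TensorProduct.map (WB.W (-z) : HB →ₗ[ℂ] HB)
          (CJ.transpose b (WA.W (K *ᵥ z)) : HA →ₗ[ℂ] HA) y⟫_ℂ := by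
      intro z
      -- At time -1 both labels change sign, giving W_B(-z) ⊗ W_A(Kz)ᵀ.
      rw [CJ.expI_dotOp_incl, CJ.inner_incl, neg_one_smul, neg_one_smul, neg_neg]
    simpa only [h1] using hgauss x y
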